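/- Let $U$ be a universe and let $E$ be a $U$-site (the sets of morphisms are $U$-small and there is a $U$-small family of topological generators; no final object is assumed). All sheaves are sheaves of $U$-small sets or groups. **Conventions.** A *sheaf of crossed groups* $\Phi=(A,\rho,\Pi)$ on $E$ consists of sheaves of groups $A,\Pi$, a homomorphism $\rho\colon A\to\Pi$ and an action of $\Pi$ on $A$ by group automorphisms with $\rho(\alpha\cdot a)=\alpha\rho(a)\alpha^{-1}$ and $\rho(a)\cdot b=aba^{-1}$. A morphism $(f,\varphi)\colon(A,\rho,\Pi)\to(A',\rho',\Pi')$ is a pair of homomorphisms $f\colon A\to A'$, $\varphi\colon\Pi\to\Pi'$ with $\rho' f=\varphi\rho$ and $f(\alpha\cdot a)=\varphi(\alpha)\cdot f(a)$. A sequence $e\to(A,\Pi)\xrightarrow{(f,\varphi)}(A',\Pi')\xrightarrow{(h,\psi)}(A'',\Pi'')\to e$ is *short exact* if $1\to A\xrightarrow{f}A'\xrightarrow{h}A''\to1$ is an exact sequence of sheaves of groups, $\varphi$ is an isomorphism and $\psi$ is an epimorphism; one then identifies $\Pi'$ with $\Pi$, so that $\varphi=1_\Pi$. For a sheaf of groups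 $G$, $\mathrm{TORSC}(E;G)$ is the stack whose fiber at $S$ is the category of right $G|_{E/S}$-torsors on $E/S$. For a right $G$-torsor $Q$ and a sheaf $X$ with a left $G$-action, $Q\wedge^G X$ is the sheaf associated with the presheaf of orbits of $Q\times X$ under $(q,x)\mapsto(qg,g^{-1}x)$, with local sections $[(q,x)]$. For $u\colon G\to H$ the extension $Q\mapsto Q\wedge^G H$ defines $\mathrm{TORSC}(u)\colon\mathrm{TORSC}(E;G)\to\mathrm{TORSC}(E;H)$. For a $\Pi$-torsor $Q$, the sheaf $Q\wedge^\Pi A$ is a sheaf of groups with $[(q,a)][(q,b)]=[(q,ab)]$. For a local section $q$ of a $G$-torsor and a local section $b$ of $G$, $\sigma_q(b)$ denotes the local automorphism $q b'\mapsto (q b)b'$ of the torsor. A *gerbe* on $E$ is a stack in groupoids on $E$ that is locally non-empty and in which any two objects of a fiber are locally isomorphic. An *$(A,\Pi)$-gerbe* is a triple $(G,\mu,j)$ with $G$ a gerbe, $\mu\colon G\to\mathrm{TORSC}(E;\Pi)$ a morphism of stacks and $j\colon\underline{\mathrm{Aut}}(G)\xrightarrow{\sim}(-\wedge^\Pi A)\circ\mu$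 an isomorphism of morphisms from $G$ to the stack of sheaves of groups (that is, isomorphisms of sheaves of groups $j_x\colon\underline{\mathrm{Aut}}_S(x)\to\mu(x)\wedge^\Pi A$ on $E/S$, natural in $x\in G_S$ and compatible with base change), such that, if a section $z$ of $\mu(x)\wedge^\Pi A$ is locally represented by $(p,a)$, then locally $\mu(j_x^{-1}(z))(p)=p\cdot\rho(a)$. An *$(f,\varphi)$-morphism* $(G,\mu,j)\to(G',\mu',j')$ is a morphism of stacks $\lambda\colon G\to G'$ for which there is an isomorphism $i\colon\mathrm{TORSC}(\varphi)\circ\mu\xrightarrow{\sim}\mu'\circ\lambda$ with $j'_{\lambda(x)}\circ\underline{\mathrm{Aut}}(\lambda)_x=\omega_x\circ j_x$ for all $x$, where $\omega_x\colon\mu(x)\wedge^\Pi A\to\mu'(\lambda(x))\wedge^{\Pi'}A'$ is the composite of $p_x\wedge f$, for the canonical map $p_x\colon\mu(x)\to\mu(x)\wedge^\Pi\Pi'$, $q\mapsto[(q,1)]$, with $i_x\wedge A'$. **Theorem.** Let $$e\to(A,\rho,\Pi)\xrightarrow{(f,1_\Pi)}(A',\rho',\Pi)\xrightarrow{(h,\psi)}(A'',\rho'',\Pi'')\to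 e$$ be a short exact sequence of sheaves of crossed groups on $E$ and let $P$ be an $A''$-torsor on $E$. Let $K(P)$ be the fibered category of liftings of $P$ to $A'$: the objects over $S$ are the pairs $(Q,\lambda)$ with $Q$ an $A'$-torsor on $E/S$ and $\lambda\colon Q\to P|_{E/S}$ an $h$-morphism, and the morphisms are the morphisms of $A'$-torsors compatible with $\lambda$. 1. Let $\mu_P\colon K(P)\to\mathrm{TORSC}(E;\Pi)$, $(Q,\lambda)\mapsto Q\wedge^{A'}\Pi$ (along $\rho'$). There is a unique isomorphism $j_P\colon\underline{\mathrm{Aut}}(K(P))\xrightarrow{\sim}(-\wedge^\Pi A)\circ\mu_P$ such that, for every section of $(Q\wedge^{A'}\Pi)\wedge^\Pi A$ locally represented by $([(q,\alpha)],a)$, its image under $j_P^{-1}$ is the automorphism of $(Q,\lambda)$ that is locally equal to $\sigma_q(f(\alpha\cdot a))$. With these data, $(K(P),\mu_P,j_P)$ is an $(A,\Pi)$-gerbe; in particular $K(P)$ is a gerbe. 2. Let $\mu_{\mathrm{TORS}}\colon\mathrm{TORSC}(E;A')\to\mathrm{TORSC}(E;\Pi)$, $Q\mapsto Q\wedge^{A'}\Pi$.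 There is a unique isomorphism $j_{\mathrm{TORS}}\colon\underline{\mathrm{Aut}}(\mathrm{TORSC}(E;A'))\xrightarrow{\sim}(-\wedge^\Pi A')\circ\mu_{\mathrm{TORS}}$ such that $j_{\mathrm{TORS}}^{-1}$ maps a section locally represented by $([(q,\alpha)],a')$ to the automorphism of $Q$ that is locally equal to $\sigma_q(\alpha\cdot a')$; and $(\mathrm{TORSC}(E;A'),\mu_{\mathrm{TORS}},j_{\mathrm{TORS}})$ is an $(A',\Pi)$-gerbe. 3. For these structures, the forgetful functor $k(P)\colon K(P)\to\mathrm{TORSC}(E;A')$, $(Q,\lambda)\mapsto Q$, is an $(f,1_\Pi)$-morphism. -/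

import Mathlib

open CategoryTheory Category Opposite Limits Bicategory

universe w v u v' u'

/-- A `U`-site, for the universe `U = Type w`: the category has `w`-small sets of morphisms, and
there is a `w`-small family of objects such that every object is covered by the arrows
from the members of the family. -/
class IsUSite {C : Type u} [Category.{v} C] (J : GrothendieckTopology C) : Prop where
  locallySmall : LocallySmall.{w} C
  exists_generators : ∃ (ι : Type w) (X : ι → C), ∀ S : C,
    Sieve.generate (fun Y (_ : Y ⟶ S) => ∃ i, Y = X i) ∈ J S

namespace IsUSite

variable {C : Type u} [Category.{v} C] (J : GrothendieckTopology C)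

/-- The objects over `S` whose source is in a given family. -/
abbrev genOver {ι : Type w} (X : ι → C) (S : C) : ObjectProperty (Over S) :=
  fun T => ∃ i, T.left = X i

theorem essSmall [LocallySmall.{w} C] {ι : Type w} (X : ι → C) (S : C) :
    EssentiallySmall.{w} (genOver X S).FullSubcategory := by
  have h1 : LocallySmall.{w} (Over S) := locallySmall_of_faithful (Over.forget S)
  have h2 : Small.{w} (genOver X S).FullSubcategory := by
    refine small_of_surjective (α := Σ i : ι, (X i ⟶ S))
      (f := fun p => ⟨Over.mk p.2, p.1, rfl⟩) ?_
    rintro ⟨T, i, hi⟩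
    obtain ⟨T, ⟨⟨⟩⟩, f⟩ := T
    change T = X i at hi
    subst hi
    exact ⟨⟨i, f⟩, rfl⟩
  infer_instance

theorem exists_small [IsUSite.{w} J] (S : C) : ∃ (D : Type w) (_ : SmallCategory D)
    (F : D ⥤ Over S), F.Full ∧ F.Faithful ∧ F.IsCoverDense (J.over S) ∧
      LocallySmall.{w} (Over S) := by
  have h1 : LocallySmall.{w} C := locallySmall J
  obtain ⟨ι, X, hX⟩ := exists_generators (J := J)
  have h2 := essSmall X S
  have h3 : LocallySmall.{w} (Over S) := locallySmall_of_faithful (Over.forget S)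
  refine ⟨SmallModel.{w} (genOver X S).FullSubcategory, inferInstance,
    (equivSmallModel _).inverse ⋙ (genOver X S).ι, inferInstance, inferInstance, ⟨fun T => ?_⟩, h3⟩
  rw [GrothendieckTopology.mem_over_iff]
  refine J.superset_covering ?_ (hX T.left)
  rintro Y g ⟨Z, a, b, ⟨i, hi⟩, rfl⟩
  subst hi
  let U : (genOver X S).FullSubcategory := ⟨Over.mk (b ≫ T.hom), i, rfl⟩
  let U' := (equivSmallModel.{w} _).functor.obj U
  let e : (equivSmallModel _).inverse.obj U' ≅ U := (equivSmallModel _).unitIso.symm.app U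
  rw [Sieve.overEquiv_iff]
  refine ⟨⟨U', (Over.homMk (U := Over.mk ((a ≫ b) ≫ T.hom)) (V := U.obj) a (by simp [U])) ≫ e.inv.hom,
    e.hom.hom ≫ Over.homMk (U := U.obj) (V := T) b (by simp [U]), ?_⟩⟩
  have : e.inv.hom ≫ e.hom.hom = 𝟙 _ := congrArg (·.hom) e.inv_hom_id
  have h5 : e.inv.hom.left ≫ e.hom.hom.left = 𝟙 _ := congrArg (·.left) this
  ext
  change (a ≫ e.inv.hom.left) ≫ e.hom.hom.left ≫ b = a ≫ b
  rw [assoc, ← assoc e.inv.hom.left, h5]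
  exact congrArg (a ≫ ·) (id_comp b)

theorem main [IsUSite.{w} J] (S : C) :
    HasSheafify (J.over S) (Type w) ∧ (J.over S).WEqualsLocallyBijective (Type w) := by
  obtain ⟨D, _, F, _, _, _, _⟩ := exists_small.{w} J S
  have h : ∀ X : (Over S)ᵒᵖ, HasLimitsOfShape (StructuredArrow X F.op) (Type w) := fun X => by
    have : EssentiallySmall.{w} (StructuredArrow X F.op) := inferInstance
    exact hasLimitsOfShape_of_essentiallySmall.{w} _ _
  refine ⟨Functor.IsDenseSubsite.hasSheafify_of_isEquivalence (F.inducedTopology (J.over S))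
    (J.over S) F, ?_⟩
  exact GrothendieckTopology.WEqualsLocallyBijective.transport (J.over S)
    (F.inducedTopology (J.over S)) F (Functor.IsDenseSubsite.coverPreserving _ _ _)

instance [IsUSite.{w} J] (S : C) : HasSheafify (J.over S) (Type w) := (main J S).1

instance [IsUSite.{w} J] (S : C) : (J.over S).WEqualsLocallyBijective (Type w) := (main J S).2

end IsUSite

/-! ### Sheaves of sets and sheaves of groups -/

namespace CrossedGerbe

section Site

variable {D : Type u} [Category.{v} D] {K : GrothendieckTopology D}

/-- Restriction of the sections of a sheaf of sets. -/
def sres (F : Sheaf K (Type w)) {X Y : D} (f : Y ⟶ X) (s : F.obj.obj (op X)) : F.obj.obj (op Y) :=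
  F.obj.map f.op s

/-- The maps induced on sections by a morphism of sheaves of sets. -/
def sapp {F F' : Sheaf K (Type w)} (m : F ⟶ F') (X : D) (s : F.obj.obj (op X)) :
    F'.obj.obj (op X) :=
  m.hom.app (op X) s

/-- The group of sections of a sheaf of groups. -/
abbrev Sec (G : Sheaf K GrpCat.{w}) (X : D) : Type w := G.obj.obj (op X)

/-- Restriction of the sections of a sheaf of groups. -/
def gres (G : Sheaf K GrpCat.{w}) {X Y : D} (f : Y ⟶ X) : Sec G X →* Sec G Y :=
  (G.obj.map f.op).hom

/-- The homomorphisms induced on sections by a morphism of sheaves of groups. -/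
def gapp {G H : Sheaf K GrpCat.{w}} (m : G ⟶ H) (X : D) : Sec G X →* Sec H X :=
  (m.hom.app (op X)).hom

theorem sres_id (F : Sheaf K (Type w)) {X : D} (s : F.obj.obj (op X)) : sres F (𝟙 X) s = s := by
  simp [sres]

theorem sres_comp (F : Sheaf K (Type w)) {X Y Z : D} (f : Y ⟶ X) (g : Z ⟶ Y)
    (s : F.obj.obj (op X)) : sres F (g ≫ f) s = sres F g (sres F f s) := by
  simp [sres]

theorem gres_id (G : Sheaf K GrpCat.{w}) {X : D} (s : Sec G X) : gres G (𝟙 X) s = s := by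
  simp [gres]

theorem gres_comp (G : Sheaf K GrpCat.{w}) {X Y Z : D} (f : Y ⟶ X) (g : Z ⟶ Y) (s : Sec G X) :
    gres G (g ≫ f) s = gres G g (gres G f s) := by
  simp [gres]

theorem sapp_res {F F' : Sheaf K (Type w)} (m : F ⟶ F') {X Y : D} (f : Y ⟶ X)
    (s : F.obj.obj (op X)) : sapp m Y (sres F f s) = sres F' f (sapp m X s) :=
  ConcreteCategory.congr_hom (m.hom.naturality f.op) s

theorem gapp_res {G H : Sheaf K GrpCat.{w}} (m : G ⟶ H) {X Y : D} (f : Y ⟶ X) (s : Sec G X) :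
    gapp m Y (gres G f s) = gres H f (gapp m X s) :=
  ConcreteCategory.congr_hom (m.hom.naturality f.op) s

theorem glue (F : Sheaf K (Type w)) {X : D} (R : Sieve X) (hR : R ∈ K X)
    (x : ∀ ⦃Y : D⦄ (f : Y ⟶ X), R f → F.obj.obj (op Y))
    (hx : ∀ ⦃Y Z : D⦄ (f : Y ⟶ X) (hf : R f) (g : Z ⟶ Y),
      sres F g (x f hf) = x (g ≫ f) (R.downward_closed hf g)) :
    ∃! t : F.obj.obj (op X), ∀ ⦃Y : D⦄ (f : Y ⟶ X) (hf : R f), sres F f t = x f hf := by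
  have h := (isSheaf_iff_isSheaf_of_type K F.obj).1 F.property R hR x
    ((Presieve.compatible_iff_sieveCompatible (P := F.obj) x).2
      (fun Y Z f g hf => (hx f hf g).symm))
  exact h

/-- The sheaf of sets which underlies a sheaf of groups. -/
def und (G : Sheaf K GrpCat.{w}) : Sheaf K (Type w) :=
  ⟨G.obj ⋙ forget GrpCat, (isSheaf_iff_isSheaf_of_type K _).2 (Presieve.isSheaf_iso K
    (Functor.isoWhiskerLeft G.obj GrpCat.coyonedaObjIsoForget) (G.property _))⟩

theorem sres_eq_of_cover (F : Sheaf K (Type w)) {X : D} (R : Sieve X) (hR : R ∈ K X)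
    (s t : F.obj.obj (op X)) (h : ∀ ⦃Y : D⦄ (f : Y ⟶ X), R f → sres F f s = sres F f t) : s = t :=
  (glue F R hR (fun _ f _ => sres F f t)
    (fun _ _ f _ g => (sres_comp F f g t).symm)).unique
    (fun _ f hf => h f hf) (fun _ _ _ => rfl)

theorem gres_eq_of_cover (G : Sheaf K GrpCat.{w}) {X : D} (R : Sieve X) (hR : R ∈ K X)
    (s t : Sec G X) (h : ∀ ⦃Y : D⦄ (f : Y ⟶ X), R f → gres G f s = gres G f t) : s = t :=
  sres_eq_of_cover (und G) R hR s t h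

/-! ### Torsors -/

/-- A (right) torsor under a sheaf of groups `G` (on a site that may have no final object): a
sheaf of sets with a right action of `G` which is simply transitive on sections, and which
locally has a section. -/
structure Torsor (G : Sheaf K GrpCat.{w}) where
  /-- the underlying sheaf of sets -/
  carrier : Sheaf K (Type w)
  /-- the right action -/
  act : ∀ {X : D}, carrier.obj.obj (op X) → Sec G X → carrier.obj.obj (op X)
  act_one : ∀ {X : D} (p : carrier.obj.obj (op X)), act p 1 = p
  act_mul : ∀ {X : D} (p : carrier.obj.obj (op X)) (g g' : Sec G X),
    act p (g * g') = act (act p g) g'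
  act_res : ∀ {X Y : D} (f : Y ⟶ X) (p : carrier.obj.obj (op X)) (g : Sec G X),
    sres carrier f (act p g) = act (sres carrier f p) (gres G f g)
  simply_transitive : ∀ {X : D} (p p' : carrier.obj.obj (op X)), ∃! g : Sec G X, act p g = p'
  locally_nonempty : ∀ X : D, ∃ R ∈ K X, ∀ ⦃Y : D⦄ (f : Y ⟶ X), R f →
    Nonempty (carrier.obj.obj (op Y))

namespace Torsor

variable {G H : Sheaf K GrpCat.{w}}

/-- The sections of a torsor. -/
abbrev sec (P : Torsor G) (X : D) : Type w := P.carrier.obj.obj (op X)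

/-- The restriction maps of a torsor. -/
abbrev res (P : Torsor G) {X Y : D} (f : Y ⟶ X) (p : P.sec X) : P.sec Y := sres P.carrier f p

theorem act_inj (P : Torsor G) {X : D} (p : P.sec X) {g g' : Sec G X}
    (h : P.act p g = P.act p g') : g = g' :=
  (P.simply_transitive p (P.act p g')).unique h rfl

/-- Morphisms of torsors: equivariant morphisms of sheaves. -/
@[ext]
structure Hom (P Q : Torsor G) where
  /-- the maps on sections -/
  app : ∀ {X : D}, P.sec X → Q.sec X
  app_res : ∀ {X Y : D} (f : Y ⟶ X) (p : P.sec X), app (P.res f p) = Q.res f (app p)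
  app_act : ∀ {X : D} (p : P.sec X) (g : Sec G X), app (P.act p g) = Q.act (app p) g

instance : Category (Torsor G) where
  Hom := Hom
  id P := ⟨fun p => p, fun _ _ => rfl, fun _ _ => rfl⟩
  comp m n := ⟨fun p => n.app (m.app p), fun f p => by rw [m.app_res, n.app_res],
    fun p g => by rw [m.app_act, n.app_act]⟩

theorem hom_ext {P Q : Torsor G} {m n : P ⟶ Q}
    (h : ∀ {X : D} (p : P.sec X), Hom.app m p = Hom.app n p) : m = n :=
  Hom.ext (by funext X p; exact h p)

theorem id_app (P : Torsor G) {X : D} (p : P.sec X) : Hom.app (𝟙 P) p = p := rfl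

theorem comp_app {P Q R : Torsor G} (m : P ⟶ Q) (n : Q ⟶ R) {X : D} (p : P.sec X) :
    Hom.app (m ≫ n) p = Hom.app n (Hom.app m p) := rfl

/-- Gluing along a torsor: sections of a sheaf may be defined by means of a local
section of a torsor, if the result does not depend on the choice of this section. -/
theorem glue (P : Torsor G) (F : Sheaf K (Type w)) (X : D)
    (x : ∀ {Y : D} (_ : Y ⟶ X), P.sec Y → F.obj.obj (op Y))
    (hx : ∀ {Y Z : D} (f : Y ⟶ X) (g : Z ⟶ Y) (p : P.sec Y),
      sres F g (x f p) = x (g ≫ f) (P.res g p))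
    (hx' : ∀ {Y : D} (f : Y ⟶ X) (p : P.sec Y) (g : Sec G Y), x f (P.act p g) = x f p) :
    ∃! t : F.obj.obj (op X), ∀ {Y : D} (f : Y ⟶ X) (p : P.sec Y), sres F f t = x f p := by
  have hx'' : ∀ {Y : D} (f : Y ⟶ X) (p p' : P.sec Y), x f p = x f p' := fun f p p' => by
    obtain ⟨g, rfl, -⟩ := P.simply_transitive p' p
    exact hx' f p' g
  obtain ⟨R, hR, h⟩ := P.locally_nonempty X
  obtain ⟨t, ht, ht'⟩ := CrossedGerbe.glue F R hR (fun Y f hf => x f (h f hf).some)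
    (fun Y Z f hf g => by rw [hx]; apply hx'')
  refine ⟨t, fun {Y} f p => ?_, fun t' h' => ht' t' fun Y f hf => h' f _⟩
  refine sres_eq_of_cover F (R.pullback f) (K.pullback_stable f hR) _ _ fun Z g hg => ?_
  rw [hx, ← sres_comp, ht (g ≫ f) hg]
  apply hx''

/-- Every morphism of torsors is bijective on sections. -/
theorem hom_bijective {P Q : Torsor G} (m : P ⟶ Q) (X : D) :
    Function.Bijective (fun p : P.sec X => Hom.app m p) := by
  constructor
  · intro p p' h
    obtain ⟨g, rfl, -⟩ := P.simply_transitive p p'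
    have h' : Q.act (Hom.app m p) 1 = Q.act (Hom.app m p) g := by
      rw [Q.act_one, ← m.app_act]; exact h
    rw [← Q.act_inj _ h', P.act_one]
  · intro q
    have key : ∀ {Y : D} (q : Q.sec Y) (p : P.sec Y), ∃! p', Hom.app m p' = q := fun q p => by
      obtain ⟨g, hg, hg'⟩ := Q.simply_transitive (Hom.app m p) q
      refine ⟨P.act p g, (m.app_act p g).trans hg, fun p' hp' => ?_⟩
      obtain ⟨g', rfl, -⟩ := P.simply_transitive p p'
      rw [hg' g' ((m.app_act p g').symm.trans hp')]
    choose k hk hk' using @key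
    obtain ⟨t, ht, -⟩ := P.glue P.carrier X (fun f p => k (Q.res f q) p)
      (fun f g p => hk' _ _ _ (by
        dsimp only
        rw [m.app_res, hk]
        exact (sres_comp _ _ _ _).symm))
      (fun f p g => hk' _ p _ (hk _ _))
    refine ⟨t, ?_⟩
    obtain ⟨R, hR, h⟩ := P.locally_nonempty X
    refine sres_eq_of_cover _ R hR _ _ fun Y f hf => ?_
    refine (m.app_res f t).symm.trans ?_
    rw [Torsor.res, ht f (h f hf).some]
    exact hk _ _

/-- Every morphism of torsors is an isomorphism. -/
noncomputable def isoOfHom {P Q : Torsor G} (m : P ⟶ Q) : P ≅ Q where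
  hom := m
  inv := ⟨fun {X} q => ((hom_bijective m X).2 q).choose, fun {X Y} f q =>
      (hom_bijective m Y).1 (((hom_bijective m Y).2 _).choose_spec.trans
        ((congrArg (Q.res f) ((hom_bijective m X).2 q).choose_spec.symm).trans
          (m.app_res f _).symm)),
    fun {X} q g => (hom_bijective m X).1 (((hom_bijective m X).2 _).choose_spec.trans
        ((congrArg (Q.act · g) ((hom_bijective m X).2 q).choose_spec.symm).trans
          (m.app_act _ g).symm))⟩
  hom_inv_id := hom_ext fun {X} p => (hom_bijective m X).1
    ((hom_bijective m X).2 (Hom.app m p)).choose_spec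
  inv_hom_id := hom_ext fun {X} q => ((hom_bijective m X).2 q).choose_spec

/-- Morphisms of torsors along a homomorphism `u` of sheaves of groups (`u`-morphisms). -/
@[ext]
structure SemiHom (u : G ⟶ H) (P : Torsor G) (Q : Torsor H) where
  /-- the maps on sections -/
  app : ∀ {X : D}, P.sec X → Q.sec X
  app_res : ∀ {X Y : D} (f : Y ⟶ X) (p : P.sec X), app (P.res f p) = Q.res f (app p)
  app_act : ∀ {X : D} (p : P.sec X) (g : Sec G X), app (P.act p g) = Q.act (app p) (gapp u X g)

end Torsor

/-! ### Contracted products -/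

/-- A left action of a sheaf of groups `G` on (the sheaf of sets underlying) `X`. -/
structure LeftAction (G X : Sheaf K GrpCat.{w}) where
  /-- the action on sections -/
  smul : ∀ {U : D}, Sec G U → Sec X U → Sec X U
  one_smul : ∀ {U : D} (x : Sec X U), smul 1 x = x
  mul_smul : ∀ {U : D} (g g' : Sec G U) (x : Sec X U), smul (g * g') x = smul g (smul g' x)
  smul_res : ∀ {U V : D} (f : V ⟶ U) (g : Sec G U) (x : Sec X U),
    gres X f (smul g x) = smul (gres G f g) (gres X f x)

/-- The action of `G` on `H` by left translations, through a homomorphism `G ⟶ H`. -/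
def translation {G H : Sheaf K GrpCat.{w}} (m : G ⟶ H) : LeftAction G H where
  smul {U} g x := gapp m U g * x
  one_smul x := by simp
  mul_smul g g' x := by simp [mul_assoc]
  smul_res f g x := by simp [gapp_res]

section Contr

variable {G H X : Sheaf K GrpCat.{w}} (Q : Torsor G) (s : LeftAction G X)

/-- The relation on `Q × X` whose quotient is the set of orbits of the diagonal action
`(q, x) ↦ (q g, g⁻¹ x)`. -/
def contrRel (U : D) (a b : Q.sec U × Sec X U) : Prop :=
  ∃ g : Sec G U, b = (Q.act a.1 g, s.smul g⁻¹ a.2)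

theorem contrRel_equiv (U : D) : Equivalence (contrRel Q s U) where
  refl a := ⟨1, by rw [Q.act_one, inv_one, s.one_smul]⟩
  symm := by
    rintro ⟨q, x⟩ _ ⟨g, rfl⟩
    refine ⟨g⁻¹, ?_⟩
    dsimp only
    rw [← Q.act_mul, ← s.mul_smul]
    simp [Q.act_one, s.one_smul]
  trans := by
    rintro ⟨q, x⟩ _ _ ⟨g, rfl⟩ ⟨g', rfl⟩
    refine ⟨g * g', ?_⟩
    dsimp only
    rw [← Q.act_mul, ← s.mul_smul, mul_inv_rev]

/-- The presheaf of orbits of `Q × X`. -/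
def contrPre : Dᵒᵖ ⥤ Type w where
  obj U := Quot (contrRel Q s U.unop)
  map {U V} f := ↾(Quot.map (fun a => (Q.res f.unop a.1, gres X f.unop a.2)) (by
    rintro ⟨q, x⟩ _ ⟨g, rfl⟩
    refine ⟨gres G f.unop g, ?_⟩
    dsimp only
    rw [Torsor.res, Q.act_res, s.smul_res, map_inv]))
  map_id U := by
    ext z
    obtain ⟨⟨q, x⟩, rfl⟩ := Quot.exists_rep z
    exact congrArg (Quot.mk _) (Prod.ext (sres_id _ q) (gres_id _ x))
  map_comp f g := by
    ext z
    obtain ⟨⟨q, x⟩, rfl⟩ := Quot.exists_rep z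
    exact congrArg (Quot.mk _) (Prod.ext (sres_comp _ _ _ q) (gres_comp _ _ _ x))

variable [HasSheafify K (Type w)]

/-- The contracted product `Q ∧^G X`: the sheaf associated with the presheaf of orbits. -/
noncomputable def contr : Sheaf K (Type w) := (presheafToSheaf K (Type w)).obj (contrPre Q s)

/-- The sections of `Q ∧^G X`. -/
abbrev CSec (U : D) : Type w := (contr Q s).obj.obj (op U)

namespace contr

variable {Q}

/-- The section `[[q, x]]` of `Q ∧^G X`. -/
noncomputable def mk {U : D} (q : Q.sec U) (x : Sec X U) : CSec Q s U :=
  (toSheafify K (contrPre Q s)).app (op U) (Quot.mk _ (q, x))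

theorem mk_res {U V : D} (f : V ⟶ U) (q : Q.sec U) (x : Sec X U) :
    sres (contr Q s) f (mk s q x) = mk s (Q.res f q) (gres X f x) :=
  (ConcreteCategory.congr_hom ((toSheafify K (contrPre Q s)).naturality f.op) (Quot.mk _ (q, x))).symm

theorem mk_act {U : D} (q : Q.sec U) (g : Sec G U) (x : Sec X U) :
    mk s (Q.act q g) x = mk s q (s.smul g x) := by
  refine congrArg ((toSheafify K (contrPre Q s)).app (op U)) (Quot.sound ⟨g, ?_⟩).symm
  simp [← s.mul_smul, s.one_smul]

/-- Morphisms from `Q ∧^G X` to a sheaf of sets. -/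
noncomputable def desc (F : Sheaf K (Type w)) (m : ∀ {U : D}, Q.sec U → Sec X U → F.obj.obj (op U))
    (hm : ∀ {U : D} (q : Q.sec U) (g : Sec G U) (x : Sec X U), m (Q.act q g) x = m q (s.smul g x))
    (hm' : ∀ {U V : D} (f : V ⟶ U) (q : Q.sec U) (x : Sec X U),
      sres F f (m q x) = m (Q.res f q) (gres X f x)) : contr Q s ⟶ F :=
  ⟨sheafifyLift K (P := contrPre Q s) (Q := F.obj)
    { app := fun U => ↾(Quot.lift (fun a => m a.1 a.2) (by
        rintro ⟨q, x⟩ _ ⟨g, rfl⟩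
        dsimp only
        rw [hm, ← s.mul_smul, mul_inv_cancel, s.one_smul]))
      naturality := fun U V f => by
        ext z
        obtain ⟨⟨q, x⟩, rfl⟩ := Quot.exists_rep z
        exact (hm' f.unop q x).symm } F.property⟩

theorem desc_mk (F : Sheaf K (Type w)) (m : ∀ {U : D}, Q.sec U → Sec X U → F.obj.obj (op U))
    (hm) (hm') {U : D} (q : Q.sec U) (x : Sec X U) :
    sapp (desc s F m hm hm') U (mk s q x) = m q x := by
  have h := toSheafify_sheafifyLift K (P := contrPre Q s) (Q := F.obj)
    { app := fun U => ↾(Quot.lift (fun a => m a.1 a.2) (by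
        rintro ⟨q, x⟩ _ ⟨g, rfl⟩
        dsimp only
        rw [hm, ← s.mul_smul, mul_inv_cancel, s.one_smul]))
      naturality := fun U V f => by
        ext z
        obtain ⟨⟨q, x⟩, rfl⟩ := Quot.exists_rep z
        exact (hm' f.unop q x).symm } F.property
  exact ConcreteCategory.congr_hom (congrArg (fun t => NatTrans.app t (op U)) h) (Quot.mk _ (q, x))

variable [K.WEqualsLocallyBijective (Type w)]

theorem mk_inj {U : D} (q : Q.sec U) {x x' : Sec X U} (h : mk s q x = mk s q x') : x = x' := by
  have h1 : Presheaf.IsLocallyInjective K (toSheafify K (contrPre Q s)) := inferInstance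
  refine gres_eq_of_cover X _ (Presheaf.equalizerSieve_mem K (toSheafify K (contrPre Q s))
    (Quot.mk _ (q, x)) (Quot.mk _ (q, x')) h) _ _ fun V f hf => ?_
  obtain ⟨g, hg⟩ := (contrRel_equiv Q s V).eqvGen_iff.1 (Quot.eqvGen_exact hf)
  have h2 : (1 : Sec G V) = g := Q.act_inj (Q.res f q)
    ((Q.act_one _).trans (congrArg Prod.fst hg))
  have h3 := congrArg Prod.snd hg
  dsimp only at h3
  rw [← h2, inv_one, s.one_smul] at h3
  exact h3.symm

theorem locally_mk {U : D} (z : CSec Q s U) : ∃ R ∈ K U, ∀ ⦃V : D⦄ (f : V ⟶ U), R f →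
    ∃ (q : Q.sec V) (x : Sec X V), sres (contr Q s) f z = mk s q x := by
  have h1 : Presheaf.IsLocallySurjective K (toSheafify K (contrPre Q s)) := inferInstance
  refine ⟨_, Presheaf.imageSieve_mem K (toSheafify K (contrPre Q s)) z, ?_⟩
  rintro V f ⟨y, hy⟩
  obtain ⟨⟨q, x⟩, rfl⟩ := Quot.exists_rep y
  exact ⟨q, x, hy.symm⟩

theorem exists_mk {U : D} (z : CSec Q s U) (q : Q.sec U) : ∃ x : Sec X U, z = mk s q x := by
  obtain ⟨R, hR, h⟩ := locally_mk s z
  have h' : ∀ ⦃V : D⦄ (f : V ⟶ U), R f → ∃ x : Sec X V, sres (contr Q s) f z = mk s (Q.res f q) x := by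
    intro V f hf
    obtain ⟨q', x, hx⟩ := h f hf
    obtain ⟨g, rfl, -⟩ := Q.simply_transitive (Q.res f q) q'
    exact ⟨s.smul g x, hx.trans (mk_act s _ g x)⟩
  choose x' hx' using h'
  obtain ⟨x, hx, -⟩ := glue (und X) R hR x' (fun V W f hf g => mk_inj s (Q.res (g ≫ f) q) (by
    rw [← hx' (g ≫ f) (R.downward_closed hf g), sres_comp, hx' f hf, mk_res]
    exact congrArg₂ (mk s) (sres_comp _ _ _ _) rfl))
  refine ⟨x, sres_eq_of_cover _ R hR _ _ fun V f hf => ?_⟩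
  rw [hx' f hf]
  exact (congrArg _ (hx f hf).symm).trans (mk_res s f q x).symm

/-- The unique `x` such that `z = [[q, x]]`. -/
noncomputable def rep {U : D} (z : CSec Q s U) (q : Q.sec U) : Sec X U := (exists_mk s z q).choose

theorem mk_rep {U : D} (z : CSec Q s U) (q : Q.sec U) : mk s q (rep s z q) = z :=
  (exists_mk s z q).choose_spec.symm

theorem rep_mk {U : D} (q : Q.sec U) (x : Sec X U) : rep s (mk s q x) q = x :=
  mk_inj s q (mk_rep s _ q)

theorem rep_act {U : D} (z : CSec Q s U) (q : Q.sec U) (g : Sec G U) :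
    rep s z (Q.act q g) = s.smul g⁻¹ (rep s z q) := by
  refine mk_inj s (Q.act q g) ?_
  rw [mk_rep, mk_act, ← s.mul_smul, mul_inv_cancel, s.one_smul, mk_rep]

theorem rep_res {U V : D} (f : V ⟶ U) (z : CSec Q s U) (q : Q.sec U) :
    rep s (sres _ f z) (Q.res f q) = gres X f (rep s z q) :=
  mk_inj s (Q.res f q) (by rw [mk_rep, ← mk_res, mk_rep])

theorem ext_rep {U : D} {z z' : CSec Q s U}
    (h : ∀ {V : D} (f : V ⟶ U) (q : Q.sec V), rep s (sres _ f z) q = rep s (sres _ f z') q) :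
    z = z' := by
  obtain ⟨R, hR, h'⟩ := Q.locally_nonempty U
  refine sres_eq_of_cover _ R hR _ _ fun V f hf => ?_
  rw [← mk_rep s (sres _ f z) (h' f hf).some, h f, mk_rep]

theorem hom_ext {F : Sheaf K (Type w)} {m m' : contr Q s ⟶ F}
    (h : ∀ {U : D} (q : Q.sec U) (x : Sec X U), sapp m U (mk s q x) = sapp m' U (mk s q x))
    {U : D} (z : CSec Q s U) : sapp m U z = sapp m' U z := by
  obtain ⟨R, hR, h'⟩ := Q.locally_nonempty U
  refine sres_eq_of_cover _ R hR _ _ fun V f hf => ?_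
  rw [← sapp_res, ← sapp_res, ← mk_rep s (sres _ f z) (h' f hf).some, h]

theorem exists_section {U : D} (x : ∀ {V : D} (_ : V ⟶ U), Q.sec V → Sec X V)
    (hx : ∀ {V W : D} (f : V ⟶ U) (g : W ⟶ V) (q : Q.sec V),
      gres X g (x f q) = x (g ≫ f) (Q.res g q))
    (hx' : ∀ {V : D} (f : V ⟶ U) (q : Q.sec V) (g : Sec G V),
      x f (Q.act q g) = s.smul g⁻¹ (x f q)) :
    ∃ z : CSec Q s U, ∀ {V : D} (f : V ⟶ U) (q : Q.sec V), rep s (sres _ f z) q = x f q := by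
  obtain ⟨z, hz, -⟩ := Q.glue (contr Q s) U (fun f q => mk s q (x f q))
    (fun f g q => by rw [mk_res, hx])
    (fun f q g => by rw [mk_act, hx', ← s.mul_smul, mul_inv_cancel, s.one_smul])
  exact ⟨z, fun f q => by rw [hz, rep_mk]⟩

end contr

end Contr
/-! ### Functoriality of contracted products, extension of the structural group -/

section Ext

variable [HasSheafify K (Type w)] {G H X Y : Sheaf K GrpCat.{w}}

/-- The morphism `m ∧ X : Q ∧^G X ⟶ Q' ∧^G X` defined by a morphism of torsors. -/
noncomputable def contrMap {Q Q' : Torsor G} (s : LeftAction G X) (m : Q ⟶ Q') :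
    contr Q s ⟶ contr Q' s :=
  contr.desc s (contr Q' s) (fun q x => contr.mk s (m.app q) x)
    (fun q g x => by rw [m.app_act, contr.mk_act])
    (fun f q x => by rw [contr.mk_res, m.app_res])

theorem contrMap_mk {Q Q' : Torsor G} (s : LeftAction G X) (m : Q ⟶ Q') {U : D} (q : Q.sec U)
    (x : Sec X U) : sapp (contrMap s m) U (contr.mk s q x) = contr.mk s (m.app q) x :=
  contr.desc_mk ..

/-- The morphism `m ∧ n : Q ∧^G X ⟶ Q' ∧^H Y` defined by a morphism of torsors `m` along `u`, and
a morphism `n` compatible with the actions. -/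
noncomputable def contrSemiMap {Q : Torsor G} {Q' : Torsor H} {s : LeftAction G X}
    {t : LeftAction H Y} {u : G ⟶ H} (m : Torsor.SemiHom u Q Q') (n : X ⟶ Y)
    (hn : ∀ {U : D} (g : Sec G U) (x : Sec X U),
      gapp n U (s.smul g x) = t.smul (gapp u U g) (gapp n U x)) :
    contr Q s ⟶ contr Q' t :=
  contr.desc s (contr Q' t) (fun {U} q x => contr.mk t (m.app q) (gapp n U x))
    (fun q g x => by rw [m.app_act, contr.mk_act, hn])
    (fun f q x => by rw [contr.mk_res, m.app_res, gapp_res])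

variable [K.WEqualsLocallyBijective (Type w)]

namespace ext

variable (u : G ⟶ H) (Q : Torsor G)

theorem exists_act {U : D} (z : CSec Q (translation u) U) (h : Sec H U) :
    ∃ z' : CSec Q (translation u) U, ∀ {V : D} (f : V ⟶ U) (q : Q.sec V),
      contr.rep _ (sres _ f z') q = contr.rep _ (sres _ f z) q * gres H f h :=
  contr.exists_section _ (fun f q => contr.rep _ (sres _ f z) q * gres H f h)
    (fun f g q => by rw [map_mul, ← contr.rep_res, sres_comp, gres_comp])
    (fun f q g => by rw [contr.rep_act]; exact mul_assoc _ _ _)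

/-- The right action of `H` on `Q ∧^G H`, such that `[[q, x]] h = [[q, x h]]`. -/
noncomputable def act {U : D} (z : CSec Q (translation u) U) (h : Sec H U) :
    CSec Q (translation u) U :=
  (exists_act u Q z h).choose

theorem rep_act {U V : D} (z : CSec Q (translation u) U) (h : Sec H U) (f : V ⟶ U) (q : Q.sec V) :
    contr.rep _ (sres _ f (act u Q z h)) q = contr.rep _ (sres _ f z) q * gres H f h :=
  (exists_act u Q z h).choose_spec f q

theorem act_res {U V : D} (f : V ⟶ U) (z : CSec Q (translation u) U) (h : Sec H U) :
    sres _ f (act u Q z h) = act u Q (sres _ f z) (gres H f h) :=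
  contr.ext_rep _ fun g q => by
    rw [rep_act, ← sres_comp, rep_act, sres_comp, gres_comp]

theorem act_mk {U : D} (q : Q.sec U) (x h : Sec H U) :
    act u Q (contr.mk _ q x) h = contr.mk _ q (x * h) := by
  have h1 := rep_act u Q (contr.mk _ q x) h (𝟙 U) q
  rw [sres_id, sres_id, gres_id, contr.rep_mk] at h1
  rw [← contr.mk_rep _ (act u Q (contr.mk _ q x) h) q, h1]

end ext

theorem contrMap_act {G H : Sheaf K GrpCat.{w}} (u : G ⟶ H) {Q Q' : Torsor G} (m : Q ⟶ Q') {U : D}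
    (z : CSec Q (translation u) U) (h : Sec H U) :
    sapp (contrMap (translation u) m) U (ext.act u Q z h) =
      ext.act u Q' (sapp (contrMap (translation u) m) U z) h := by
  obtain ⟨R, hR, hR'⟩ := Q.locally_nonempty U
  refine sres_eq_of_cover _ R hR _ _ fun V f hf => ?_
  rw [← sapp_res, ext.act_res, ext.act_res, ← sapp_res,
    ← contr.mk_rep _ (sres _ f z) (hR' f hf).some, ext.act_mk, contrMap_mk, contrMap_mk, ext.act_mk]

/-- The torsor `Q ∧^G H` deduced from `Q` by extension of the structural group along
`u : G ⟶ H`. -/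
noncomputable def ext (u : G ⟶ H) (Q : Torsor G) : Torsor H where
  carrier := contr Q (translation u)
  act := ext.act u Q
  act_one z := contr.ext_rep _ fun f q => by rw [ext.rep_act, map_one, mul_one]
  act_mul z h h' := contr.ext_rep _ fun f q => by
    rw [ext.rep_act, ext.rep_act, ext.rep_act, map_mul, mul_assoc]
  act_res f z h := ext.act_res u Q f z h
  simply_transitive {U} z z' := by
    have h1 : ∀ {V : D} (x a b : Sec H V), (x * a)⁻¹ * (x * b) = a⁻¹ * b := by intros; group
    obtain ⟨h, hh⟩ : ∃ h : Sec H U, ∀ {V : D} (f : V ⟶ U) (q : Q.sec V), gres H f h =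
        (contr.rep _ (sres _ f z) q)⁻¹ * contr.rep _ (sres _ f z') q := by
      obtain ⟨h, hh, -⟩ := Q.glue (und H) U
        (fun f q => ((contr.rep _ (sres _ f z) q)⁻¹ * contr.rep _ (sres _ f z') q : Sec H _))
        (fun f g q => by
          refine (map_mul (gres H g) _ _).trans ?_
          rw [map_inv, ← contr.rep_res, ← contr.rep_res, sres_comp, sres_comp])
        (fun f q g => by
          rw [contr.rep_act, contr.rep_act]
          exact h1 _ _ _)
      exact ⟨h, hh⟩
    refine ⟨h, contr.ext_rep _ fun f q => ?_, fun h' hh' => ?_⟩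
    · rw [ext.rep_act, hh f q, mul_inv_cancel_left]
    · obtain ⟨R, hR, hR'⟩ := Q.locally_nonempty U
      refine gres_eq_of_cover H R hR _ _ fun V f hf => ?_
      rw [hh f (hR' f hf).some, ← hh', ext.rep_act, inv_mul_cancel_left]
  locally_nonempty U := by
    obtain ⟨R, hR, hR'⟩ := Q.locally_nonempty U
    exact ⟨R, hR, fun V f hf => ⟨contr.mk _ (hR' f hf).some 1⟩⟩

namespace ext

/-- The section `[[q, x]]` of the torsor `Q ∧^G H`. -/
noncomputable def mk (u : G ⟶ H) {Q : Torsor G} {U : D} (q : Q.sec U) (x : Sec H U) :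
    (ext u Q).sec U :=
  contr.mk (translation u) q x

theorem exists_mk (u : G ⟶ H) {Q : Torsor G} {U : D} (z : (ext u Q).sec U) (q : Q.sec U) :
    ∃ x, z = mk u q x :=
  contr.exists_mk _ z q

theorem mk_res (u : G ⟶ H) {Q : Torsor G} {U V : D} (f : V ⟶ U) (q : Q.sec U) (x : Sec H U) :
    (ext u Q).res f (mk u q x) = mk u (Q.res f q) (gres H f x) :=
  contr.mk_res ..

theorem mk_act (u : G ⟶ H) {Q : Torsor G} {U : D} (q : Q.sec U) (g : Sec G U) (x : Sec H U) :
    mk u (Q.act q g) x = mk u q (gapp u U g * x) :=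
  contr.mk_act ..

theorem act_mk' (u : G ⟶ H) {Q : Torsor G} {U : D} (q : Q.sec U) (x h : Sec H U) :
    (ext u Q).act (mk u q x) h = mk u q (x * h) :=
  act_mk ..

/-- The morphism of extended torsors defined by a morphism of torsors. -/
noncomputable def map (u : G ⟶ H) {Q Q' : Torsor G} (m : Q ⟶ Q') : ext u Q ⟶ ext u Q' where
  app {U} z := sapp (contrMap (translation u) m) U z
  app_res f z := sapp_res _ f z
  app_act z h := contrMap_act u m z h

theorem map_mk (u : G ⟶ H) {Q Q' : Torsor G} (m : Q ⟶ Q') {U : D} (q : Q.sec U) (x : Sec H U) :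
    (map u m).app (mk u q x) = mk u (m.app q) x :=
  contrMap_mk ..

theorem hom_ext (u : G ⟶ H) {Q : Torsor G} {P : Torsor H} {m n : ext u Q ⟶ P}
    (h : ∀ {U : D} (q : Q.sec U), m.app (mk u q 1) = n.app (mk u q 1)) : m = n :=
  Torsor.hom_ext fun {U} z => by
    obtain ⟨R, hR, hR'⟩ := Q.locally_nonempty U
    refine sres_eq_of_cover _ R hR _ _ fun V f hf => ?_
    refine (m.app_res f z).symm.trans (Eq.trans ?_ (n.app_res f z))
    obtain ⟨x, hx⟩ := exists_mk u ((ext u Q).res f z) (hR' f hf).some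
    rw [hx, ← one_mul x, ← act_mk', m.app_act, n.app_act, h]

/-- The canonical morphism `Q ⟶ Q ∧^G H`, `q ↦ [[q, 1]]`, along `u`. -/
noncomputable def unit (u : G ⟶ H) (Q : Torsor G) : Torsor.SemiHom u Q (ext u Q) where
  app q := mk u q 1
  app_res f q := by rw [mk_res, map_one]
  app_act {U} q g := by rw [mk_act, act_mk', mul_one, one_mul]

end ext

end Ext

/-! ### Sheaves of crossed groups -/

/-- A sheaf of crossed groups `(A, ρ, Π, φ)`: sheaves of groups `A` and `Π`, a homomorphism
`ρ : A ⟶ Π` and an action of `Π` on `A` by automorphisms. -/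
structure CrossedGroup (A Pi : Sheaf K GrpCat.{w}) where
  /-- the homomorphism -/
  ρ : A ⟶ Pi
  /-- the action -/
  action : LeftAction Pi A
  smul_mul : ∀ {U : D} (α : Sec Pi U) (a b : Sec A U),
    action.smul α (a * b) = action.smul α a * action.smul α b
  ρ_smul : ∀ {U : D} (α : Sec Pi U) (a : Sec A U),
    gapp ρ U (action.smul α a) = α * gapp ρ U a * α⁻¹
  smul_ρ : ∀ {U : D} (a b : Sec A U), action.smul (gapp ρ U a) b = a * b * a⁻¹

namespace CrossedGroup

variable {A Pi : Sheaf K GrpCat.{w}} (Φ : CrossedGroup A Pi)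

theorem smul_one {U : D} (α : Sec Pi U) : Φ.action.smul α 1 = 1 := by
  have h := Φ.smul_mul α 1 1
  rwa [one_mul, left_eq_mul] at h

theorem smul_inv {U : D} (α : Sec Pi U) (a : Sec A U) :
    Φ.action.smul α a⁻¹ = (Φ.action.smul α a)⁻¹ := by
  rw [eq_inv_iff_mul_eq_one, ← Φ.smul_mul, inv_mul_cancel, smul_one]

section

variable [HasSheafify K (Type w)] [K.WEqualsLocallyBijective (Type w)] (Q : Torsor Pi)

theorem exists_mul {U : D} (z z' : CSec Q Φ.action U) :
    ∃ y : CSec Q Φ.action U, ∀ {V : D} (f : V ⟶ U) (q : Q.sec V),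
      contr.rep _ (sres _ f y) q = contr.rep _ (sres _ f z) q * contr.rep _ (sres _ f z') q :=
  contr.exists_section _ (fun f q => contr.rep _ (sres _ f z) q * contr.rep _ (sres _ f z') q)
    (fun f g q => by rw [map_mul, ← contr.rep_res, ← contr.rep_res, sres_comp, sres_comp])
    (fun f q g => by rw [contr.rep_act, contr.rep_act, Φ.smul_mul])

theorem exists_one (U : D) :
    ∃ y : CSec Q Φ.action U, ∀ {V : D} (f : V ⟶ U) (q : Q.sec V),
      contr.rep _ (sres _ f y) q = 1 :=
  contr.exists_section _ (fun _ _ => 1) (fun _ _ _ => map_one _) (fun _ _ _ => (Φ.smul_one _).symm)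

theorem exists_inv {U : D} (z : CSec Q Φ.action U) :
    ∃ y : CSec Q Φ.action U, ∀ {V : D} (f : V ⟶ U) (q : Q.sec V),
      contr.rep _ (sres _ f y) q = (contr.rep _ (sres _ f z) q)⁻¹ :=
  contr.exists_section _ (fun f q => (contr.rep _ (sres _ f z) q)⁻¹)
    (fun f g q => by rw [map_inv, ← contr.rep_res, sres_comp])
    (fun f q g => by rw [contr.rep_act, Φ.smul_inv])

/-- The group structure on the sections of `Q ∧^Π A`, such that `[[q, a]] [[q, b]] = [[q, a b]]`. -/
noncomputable instance {U : D} : Group (CSec Q Φ.action U) where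
  mul z z' := (Φ.exists_mul Q z z').choose
  one := (Φ.exists_one Q U).choose
  inv z := (Φ.exists_inv Q z).choose
  mul_assoc a b c := contr.ext_rep _ fun f q => by
    have h := @fun z z' => (Φ.exists_mul Q (U := U) z z').choose_spec f q
    exact (h _ c).trans (((congrArg (· * _) (h a b)).trans (mul_assoc _ _ _)).trans
      ((h a _).trans (congrArg (_ * ·) (h b c))).symm)
  one_mul a := contr.ext_rep _ fun f q => by
    have h := @fun z z' => (Φ.exists_mul Q (U := U) z z').choose_spec f q
    exact (h _ a).trans ((congrArg (· * _) ((Φ.exists_one Q U).choose_spec f q)).trans (one_mul _))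
  mul_one a := contr.ext_rep _ fun f q => by
    have h := @fun z z' => (Φ.exists_mul Q (U := U) z z').choose_spec f q
    exact (h a _).trans ((congrArg (_ * ·) ((Φ.exists_one Q U).choose_spec f q)).trans (mul_one _))
  inv_mul_cancel a := contr.ext_rep _ fun f q => by
    have h := @fun z z' => (Φ.exists_mul Q (U := U) z z').choose_spec f q
    exact (h _ a).trans (((congrArg (· * _) ((Φ.exists_inv Q a).choose_spec f q)).trans
      (inv_mul_cancel _)).trans ((Φ.exists_one Q U).choose_spec f q).symm)

theorem mk_mul {U : D} (q : Q.sec U) (a b : Sec A U) :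
    contr.mk Φ.action q (a * b) = contr.mk Φ.action q a * contr.mk Φ.action q b := by
  have h : contr.rep Φ.action (sres (contr Q Φ.action) (𝟙 U)
      (contr.mk Φ.action q a * contr.mk Φ.action q b)) q = _ :=
    (Φ.exists_mul Q _ _).choose_spec (𝟙 U) q
  rw [sres_id, sres_id, sres_id, contr.rep_mk, contr.rep_mk] at h
  rw [← h, contr.mk_rep]

end

end CrossedGroup

end Site

/-! ### Localization -/

section Over

variable {C : Type u} [Category.{v} C] {J : GrothendieckTopology C}

/-- The restriction to `C/S` of a morphism of sheaves of groups. -/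
abbrev homOver {G H : Sheaf J GrpCat.{w}} (m : G ⟶ H) (S : C) : G.over S ⟶ H.over S :=
  (J.overPullback GrpCat S).map m

/-- The restriction to `C/S` of an action of a sheaf of groups. -/
def LeftAction.over {G X : Sheaf J GrpCat.{w}} (s : LeftAction G X) (S : C) :
    LeftAction (G.over S) (X.over S) where
  smul {U} g x := s.smul (U := U.left) g x
  one_smul {U} x := s.one_smul (U := U.left) x
  mul_smul {U} g g' x := s.mul_smul (U := U.left) g g' x
  smul_res f g x := s.smul_res f.left g x

/-- The restriction to `C/S` of a sheaf of crossed groups. -/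
def CrossedGroup.over {A Pi : Sheaf J GrpCat.{w}} (Φ : CrossedGroup A Pi) (S : C) :
    CrossedGroup (A.over S) (Pi.over S) where
  ρ := homOver Φ.ρ S
  action := Φ.action.over S
  smul_mul {U} α a b := Φ.smul_mul (U := U.left) α a b
  ρ_smul {U} α a := Φ.ρ_smul (U := U.left) α a
  smul_ρ {U} a b := Φ.smul_ρ (U := U.left) a b

namespace Torsor

variable {G H : Sheaf J GrpCat.{w}}

/-- The restriction to `C/S` of a torsor on `C`. -/
def localize (P : Torsor G) (S : C) : Torsor (G.over S) where
  carrier := P.carrier.over S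
  act {U} p g := P.act (X := U.left) p g
  act_one {U} p := P.act_one (X := U.left) p
  act_mul {U} p g g' := P.act_mul (X := U.left) p g g'
  act_res f p g := P.act_res f.left p g
  simply_transitive {U} p p' := P.simply_transitive (X := U.left) p p'
  locally_nonempty U := by
    obtain ⟨R, hR, h⟩ := P.locally_nonempty U.left
    exact ⟨(Sieve.overEquiv U).symm R, J.overEquiv_symm_mem_over U R hR, fun V f hf =>
      h f.left (by simpa [Sieve.overEquiv_symm_iff] using hf)⟩

/-- The inverse image along `f : T ⟶ S` of a torsor on `C/S`. -/
def pull {S T : C} (f : T ⟶ S) (P : Torsor (G.over S)) : Torsor (G.over T) where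
  carrier := (J.overMapPullback (Type w) f).obj P.carrier
  act {U} p g := P.act (X := (Over.map f).obj U) p g
  act_one {U} p := P.act_one (X := (Over.map f).obj U) p
  act_mul {U} p g g' := P.act_mul (X := (Over.map f).obj U) p g g'
  act_res g p x := P.act_res ((Over.map f).map g) p x
  simply_transitive {U} p p' := P.simply_transitive (X := (Over.map f).obj U) p p'
  locally_nonempty U := by
    obtain ⟨R, hR, h⟩ := P.locally_nonempty ((Over.map f).obj U)
    refine ⟨(Sieve.overEquiv U).symm (Sieve.overEquiv ((Over.map f).obj U) R),
      J.overEquiv_symm_mem_over U _ hR, fun V g hg => ?_⟩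
    have h1 := (Sieve.overEquiv_iff R g.left).1 (by simpa [Sieve.overEquiv_symm_iff] using hg)
    have h2 := R.downward_closed h1
      (Over.homMk (𝟙 V.left) (by simp) : (Over.map f).obj V ⟶ Over.mk (g.left ≫ U.hom ≫ f))
    refine h ((Over.map f).map g) ?_
    convert h2 using 1
    ext
    simp

/-- The inverse image of a morphism of torsors. -/
def pullMap {S T : C} (f : T ⟶ S) {P Q : Torsor (G.over S)} (m : P ⟶ Q) : P.pull f ⟶ Q.pull f where
  app {U} p := m.app (X := (Over.map f).obj U) p
  app_res g p := m.app_res ((Over.map f).map g) p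
  app_act {U} p g := m.app_act (X := (Over.map f).obj U) p g

/-- The inverse image functor on torsors. -/
def pullFunctor (G : Sheaf J GrpCat.{w}) {S T : C} (f : T ⟶ S) :
    Torsor (G.over S) ⥤ Torsor (G.over T) where
  obj P := P.pull f
  map m := pullMap f m

theorem sres_over_congr {S : C} (F : Sheaf (J.over S) (Type w)) {U V : Over S} {a b : V ⟶ U}
    (h : a.left = b.left) (x : F.obj.obj (op U)) : sres F a x = sres F b x := by
  rw [show a = b by ext; exact h]

/-- The isomorphism between two inverse images `P.pull f` and `P.pull f'` with `f = f'`. -/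
def pullCongr {S T : C} {f f' : T ⟶ S} (h : f = f') (P : Torsor (G.over S)) :
    P.pull f ⟶ P.pull f' where
  app {U} p := P.res (X := (Over.map f).obj U) (Y := (Over.map f').obj U)
    (Over.homMk (𝟙 U.left) (by simp [h])) p
  app_res h p := by
    refine (sres_comp _ _ _ _).symm.trans (Eq.trans ?_ (sres_comp _ _ _ _))
    exact sres_over_congr _ (by simp) _
  app_act {U} p g := (P.act_res ..).trans (congrArg _ (gres_id G (X := U.left) g))

/-- The isomorphism between the inverse image of `P` along an identity and `P`. -/
def pullId {S : C} (P : Torsor (G.over S)) : P.pull (𝟙 S) ≅ P where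
  hom :=
    { app {U} p := P.res (X := (Over.map (𝟙 S)).obj U) (Over.homMk (𝟙 U.left)) p
      app_res g p := by
        refine (sres_comp _ _ _ _).symm.trans (Eq.trans ?_ (sres_comp _ _ _ _))
        exact sres_over_congr _ (by simp) _
      app_act {U} p g := (P.act_res ..).trans (congrArg _ (gres_id G (X := U.left) g)) }
  inv :=
    { app {U} p := P.res (Y := (Over.map (𝟙 S)).obj U) (Over.homMk (𝟙 U.left)) p
      app_res g p := by
        refine (sres_comp _ _ _ _).symm.trans (Eq.trans ?_ (sres_comp _ _ _ _))
        exact sres_over_congr _ (by simp) _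
      app_act {U} p g := (P.act_res ..).trans (congrArg _ (gres_id G (X := U.left) g)) }
  hom_inv_id := hom_ext fun p => by
    refine (sres_comp _ _ _ _).symm.trans (Eq.trans ?_ (sres_id _ _))
    exact sres_over_congr _ (by simp) _
  inv_hom_id := hom_ext fun p => by
    refine (sres_comp _ _ _ _).symm.trans (Eq.trans ?_ (sres_id _ _))
    exact sres_over_congr _ (by simp) _

/-- The isomorphism between the inverse image of `P` along a composition and the composition of
the inverse images. -/
def pullComp {S T V : C} (f : T ⟶ S) (g : V ⟶ T) (P : Torsor (G.over S)) :
    P.pull (g ≫ f) ≅ (P.pull f).pull g where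
  hom :=
    { app {U} p := P.res (X := (Over.map (g ≫ f)).obj U)
        (Y := (Over.map f).obj ((Over.map g).obj U)) (Over.homMk (𝟙 U.left)) p
      app_res h p := by
        refine (sres_comp _ _ _ _).symm.trans (Eq.trans ?_ (sres_comp _ _ _ _))
        exact sres_over_congr _ (by simp) _
      app_act {U} p g := (P.act_res ..).trans (congrArg _ (gres_id G (X := U.left) g)) }
  inv :=
    { app {U} p := P.res (Y := (Over.map (g ≫ f)).obj U)
        (X := (Over.map f).obj ((Over.map g).obj U)) (Over.homMk (𝟙 U.left)) p
      app_res h p := by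
        refine (sres_comp _ _ _ _).symm.trans (Eq.trans ?_ (sres_comp _ _ _ _))
        exact sres_over_congr _ (by simp) _
      app_act {U} p g := (P.act_res ..).trans (congrArg _ (gres_id G (X := U.left) g)) }
  hom_inv_id := hom_ext fun p => by
    refine (sres_comp _ _ _ _).symm.trans (Eq.trans ?_ (sres_id _ _))
    exact sres_over_congr _ (by simp) _
  inv_hom_id := hom_ext fun p => by
    refine (sres_comp _ _ _ _).symm.trans (Eq.trans ?_ (sres_id _ _))
    exact sres_over_congr _ (by simp) _

theorem pullId_naturality {S : C} {P Q : Torsor (G.over S)} (m : P ⟶ Q) :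
    pullMap (𝟙 S) m ≫ (pullId Q).hom = (pullId P).hom ≫ m :=
  hom_ext fun _ => (m.app_res _ _).symm

theorem pullComp_naturality {S T V : C} (f : T ⟶ S) (g : V ⟶ T) {P Q : Torsor (G.over S)}
    (m : P ⟶ Q) : pullMap (g ≫ f) m ≫ (pullComp f g Q).hom =
      (pullComp f g P).hom ≫ pullMap g (pullMap f m) :=
  hom_ext fun _ => (m.app_res _ _).symm

theorem pull_assoc {S T V W : C} (f : T ⟶ S) (g : V ⟶ T) (h : W ⟶ V) (P : Torsor (G.over S)) :
    (pullComp (g ≫ f) h P).hom ≫ pullMap h (pullComp f g P).hom ≫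
      (pullComp g h (P.pull f)).inv ≫ (pullComp f (h ≫ g) P).inv =
    pullCongr (by simp) P :=
  hom_ext fun p => by
    refine (congrArg (fun x => P.res _ (P.res _ x)) (sres_comp _ _ _ _).symm).trans ?_
    refine (congrArg (fun x => P.res _ x) (sres_comp _ _ _ _).symm).trans ?_
    refine (sres_comp _ _ _ _).symm.trans ?_
    exact sres_over_congr _ (by simp) _

theorem pull_id_comp {S T : C} (f : T ⟶ S) (P : Torsor (G.over S)) :
    (pullComp (𝟙 S) f P).hom ≫ pullMap f (pullId P).hom = pullCongr (by simp) P :=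
  hom_ext fun p => by
    refine (sres_comp _ _ _ _).symm.trans ?_
    exact sres_over_congr _ (by simp) _

theorem pull_comp_id {S T : C} (f : T ⟶ S) (P : Torsor (G.over S)) :
    (pullComp f (𝟙 T) P).hom ≫ (pullId (P.pull f)).hom = pullCongr (by simp) P :=
  hom_ext fun {U} p => by
    refine (sres_comp P.carrier (Z := (Over.map f).obj U) (Over.homMk (𝟙 U.left))
      ((Over.map f).map (Over.homMk (V := (Over.map (𝟙 T)).obj U) (𝟙 U.left))) p).symm.trans ?_
    exact sres_over_congr _ (by simp) _

theorem eqToHom_pull {S T : C} {f f' : T ⟶ S} (h : f = f')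
    (e : (pullFunctor G f).toCatHom = (pullFunctor G f').toCatHom) (P : Torsor (G.over S)) :
    (eqToHom e).toNatTrans.app P = pullCongr h P := by
  subst h
  refine hom_ext (P := P.pull f) (Q := P.pull f) fun p => ?_
  refine (sres_id P.carrier p).symm.trans ?_
  exact sres_over_congr _ rfl _

/-- The isomorphism between the inverse image along an identity and the identity. -/
def pullFunctorId (G : Sheaf J GrpCat.{w}) (S : C) : pullFunctor G (𝟙 S) ≅ 𝟭 _ :=
  NatIso.ofComponents pullId pullId_naturality

/-- The isomorphism between the inverse image along a composition and the composition of the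
inverse images. -/
def pullFunctorComp (G : Sheaf J GrpCat.{w}) {S T V : C} (f : T ⟶ S) (g : V ⟶ T) :
    pullFunctor G (g ≫ f) ≅ pullFunctor G f ⋙ pullFunctor G g :=
  NatIso.ofComponents (pullComp f g) (pullComp_naturality f g)

end Torsor

/-- The fibered category of torsors under `G`, as a pseudofunctor: its fiber at `S` is the
category of torsors under the restriction of `G` to `C/S`. -/
def TORSC (G : Sheaf J GrpCat.{w}) :
    LocallyDiscrete Cᵒᵖ ⥤ᵖ Cat.{max u v w, max u v (w + 1)} :=
  LocallyDiscrete.mkPseudofunctor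
    (fun S => Cat.of (Torsor (G.over S.unop)))
    (fun f => (Torsor.pullFunctor G f.unop).toCatHom)
    (fun S => Cat.Hom.isoMk (Torsor.pullFunctorId G S.unop))
    (fun f g => Cat.Hom.isoMk (Torsor.pullFunctorComp G f.unop g.unop))
    (fun f g h => by
      ext P : 3
      exact (Torsor.pull_assoc f.unop g.unop h.unop P).trans
        (Torsor.eqToHom_pull (by simp) _ P).symm)
    (fun f => by
      ext P : 3
      exact (Torsor.pull_id_comp f.unop P).trans (Torsor.eqToHom_pull (by simp) _ P).symm)
    (fun f => by
      ext P : 3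
      exact (Torsor.pull_comp_id f.unop P).trans (Torsor.eqToHom_pull (by simp) _ P).symm)

end Over

/-! ### Base change of contracted products -/

section

variable {C : Type u} [Category.{v} C] {J : GrothendieckTopology C} [IsUSite.{w} J]

/-- The canonical morphism from the contracted product of an inverse image to the inverse image of
the contracted product, `[[q, x]] ↦ [[q, x]]`. -/
noncomputable def contrBC {G X : Sheaf J GrpCat.{w}} (s : LeftAction G X) {S T : C} (f : T ⟶ S)
    (Q : Torsor (G.over S)) :
    contr (Q.pull f) (s.over T) ⟶ (J.overMapPullback (Type w) f).obj (contr Q (s.over S)) :=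
  contr.desc (Q := Q.pull f) (s.over T) _
    (fun {U} q x => contr.mk (s.over S) (U := (Over.map f).obj U) q x)
    (fun {U} q g x => contr.mk_act (s.over S) (U := (Over.map f).obj U) q g x)
    (fun g q x => contr.mk_res (s.over S) ((Over.map f).map g) q x)

/-- The maps on sections induced by `contrBC`. -/
noncomputable def bc {G X : Sheaf J GrpCat.{w}} (s : LeftAction G X) {S T : C} (f : T ⟶ S)
    (Q : Torsor (G.over S)) {U : Over T} (z : CSec (Q.pull f) (s.over T) U) :
    CSec Q (s.over S) ((Over.map f).obj U) :=
  sapp (contrBC s f Q) U z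

theorem bc_mk {G X : Sheaf J GrpCat.{w}} (s : LeftAction G X) {S T : C} (f : T ⟶ S)
    (Q : Torsor (G.over S)) {U : Over T} (q : (Q.pull f).sec U) (x : Sec (X.over T) U) :
    bc s f Q (contr.mk (s.over T) q x) =
      contr.mk (s.over S) (Q := Q) (U := (Over.map f).obj U) q x :=
  contr.desc_mk ..

theorem bc_res {G X : Sheaf J GrpCat.{w}} (s : LeftAction G X) {S T : C} (f : T ⟶ S)
    (Q : Torsor (G.over S)) {U V : Over T} (g : V ⟶ U) (z : CSec (Q.pull f) (s.over T) U) :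
    bc s f Q (sres _ g z) = sres _ ((Over.map f).map g) (bc s f Q z) :=
  sapp_res ..

namespace ext

variable {G H : Sheaf J GrpCat.{w}} (u : G ⟶ H)

theorem bc_act {S T : C} (f : T ⟶ S) (Q : Torsor (G.over S)) {U : Over T}
    (z : (ext (homOver u T) (Q.pull f)).sec U) (h : Sec (H.over T) U) :
    bc (translation u) f Q ((ext (homOver u T) (Q.pull f)).act z h) =
      ((ext (homOver u S) Q).pull f).act (X := U) (bc (translation u) f Q z) h := by
  obtain ⟨R, hR, hR'⟩ := (Q.pull f).locally_nonempty U
  refine sres_eq_of_cover ((ext (homOver u S) Q).pull f).carrier R hR _ _ fun V g hg => ?_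
  refine (bc_res (translation u) f Q g _).symm.trans ?_
  refine (congrArg _ ((ext (homOver u T) (Q.pull f)).act_res g z h)).trans ?_
  refine Eq.trans ?_ (((ext (homOver u S) Q).pull f).act_res g _ _).symm
  refine Eq.trans ?_ (congrArg (((ext (homOver u S) Q).pull f).act (X := V) · _)
    (bc_res (translation u) f Q g _))
  obtain ⟨x, hx⟩ := exists_mk (homOver u T) ((ext (homOver u T) (Q.pull f)).res g z)
    (hR' g hg).some
  refine (congrArg (fun z => bc (translation u) f Q
    ((ext (homOver u T) (Q.pull f)).act (X := V) z _)) hx).trans ?_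
  refine Eq.trans ?_ (congrArg (fun z => ((ext (homOver u S) Q).pull f).act (X := V)
    (bc (translation u) f Q z) _) hx.symm)
  refine (congrArg (bc (translation u) f Q) (act_mk' (homOver u T) _ _ _)).trans ?_
  refine (bc_mk (translation u) f Q _ _).trans ?_
  refine Eq.trans ?_ (congrArg (((ext (homOver u S) Q).pull f).act (X := V) · _)
    (bc_mk (translation u) f Q _ _).symm)
  exact (act_mk' (homOver u S) (Q := Q) (U := (Over.map f).obj V) _ _ _).symm

/-- The compatibility of the extension of the structural group with inverse images. -/
noncomputable def baseChange {S T : C} (f : T ⟶ S) (Q : Torsor (G.over S)) :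
    ext (homOver u T) (Q.pull f) ⟶ (ext (homOver u S) Q).pull f where
  app z := bc (translation u) f Q z
  app_res g z := bc_res (translation u) f Q g z
  app_act z h := bc_act u f Q z h

theorem baseChange_mk {S T : C} (f : T ⟶ S) (Q : Torsor (G.over S)) {U : Over T}
    (q : (Q.pull f).sec U) (x : Sec (H.over T) U) :
    (baseChange u f Q).app (mk (homOver u T) q x) =
      mk (homOver u S) (U := (Over.map f).obj U) (Q := Q) q x :=
  bc_mk ..

/-- The functor "extension of the structural group" over an object `S`. -/
noncomputable def functor (S : C) : Torsor (G.over S) ⥤ Torsor (H.over S) where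
  obj Q := ext (homOver u S) Q
  map m := map (homOver u S) m
  map_id Q := hom_ext _ fun q => by rw [map_mk]; rfl
  map_comp m n := hom_ext _ fun q => by
    rw [Torsor.comp_app, map_mk, map_mk, map_mk]; rfl

theorem baseChange_naturality {S T : C} (f : T ⟶ S) {Q Q' : Torsor (G.over S)} (m : Q ⟶ Q') :
    map (homOver u T) (Torsor.pullMap f m) ≫ baseChange u f Q' =
      baseChange u f Q ≫ Torsor.pullMap f (map (homOver u S) m) :=
  hom_ext _ fun {U} q => by
    rw [Torsor.comp_app, map_mk, Torsor.comp_app, baseChange_mk, baseChange_mk]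
    exact (map_mk (homOver u S) m (U := (Over.map f).obj U) q _).symm

theorem baseChange_id (S : C) (Q : Torsor (G.over S)) :
    baseChange u (𝟙 S) Q ≫ (Torsor.pullId (ext (homOver u S) Q)).hom =
      map (homOver u S) (Torsor.pullId Q).hom :=
  hom_ext _ fun {U} q => by
    rw [Torsor.comp_app, map_mk, baseChange_mk]
    refine (mk_res (homOver u S) (Q := Q) (U := (Over.map (𝟙 S)).obj U) (V := U) _ q _).trans ?_
    exact congrArg _ (map_one _)

theorem baseChange_comp {S T V : C} (f : T ⟶ S) (g : V ⟶ T) (Q : Torsor (G.over S)) :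
    baseChange u (g ≫ f) Q ≫ (Torsor.pullComp f g (ext (homOver u S) Q)).hom =
      map (homOver u V) (Torsor.pullComp f g Q).hom ≫ baseChange u g (Q.pull f) ≫
        Torsor.pullMap g (baseChange u f Q) :=
  hom_ext _ fun {U} q => by
    rw [Torsor.comp_app, Torsor.comp_app, Torsor.comp_app, map_mk, baseChange_mk, baseChange_mk]
    refine (mk_res (homOver u S) (Q := Q) (U := (Over.map (g ≫ f)).obj U) _ q _).trans ?_
    exact (congrArg _ (map_one _)).trans
      (baseChange_mk u f Q (U := (Over.map g).obj U) _ _).symm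

end ext

open scoped Pseudofunctor.StrongTrans

theorem map₂_eq {F G : LocallyDiscrete Cᵒᵖ ⥤ᵖ Cat.{v', u'}}
    (app : ∀ a, F.obj a ⟶ G.obj a)
    (nat : ∀ {a b} (f : a ⟶ b), F.map f ≫ app b ≅ app a ≫ G.map f)
    {a b : LocallyDiscrete Cᵒᵖ} {f g : a ⟶ b} (η : f ⟶ g) :
    F.map₂ η ▷ app b ≫ (nat g).hom = (nat f).hom ≫ app a ◁ G.map₂ η := by
  obtain rfl := LocallyDiscrete.eq_of_hom η
  obtain rfl : η = 𝟙 _ := Subsingleton.elim _ _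
  simp

/-- The components of `extTrans`. -/
noncomputable def extApp {G H : Sheaf J GrpCat.{w}} (u : G ⟶ H) (S : LocallyDiscrete Cᵒᵖ) :
    (TORSC G).obj S ⟶ (TORSC H).obj S :=
  (ext.functor u S.as.unop).toCatHom

/-- The compatibility of `extTrans` with inverse images. -/
noncomputable def extNat {G H : Sheaf J GrpCat.{w}} (u : G ⟶ H) {S T : LocallyDiscrete Cᵒᵖ}
    (f : S ⟶ T) : (TORSC G).map f ≫ extApp u T ≅ extApp u S ≫ (TORSC H).map f :=
  Cat.Hom.isoMk (NatIso.ofComponents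
    (fun Q => Torsor.isoOfHom (ext.baseChange u f.as.unop Q))
    (fun m => ext.baseChange_naturality u f.as.unop m))

/-- The morphism of stacks of torsors `TORSC(u)`, given by the extension of the
structural group along `u`. -/
noncomputable def extTrans {G H : Sheaf J GrpCat.{w}} (u : G ⟶ H) : TORSC G ⟶ TORSC H where
  app S := extApp u S
  naturality f := extNat u f
  naturality_naturality η := map₂_eq (extApp u) (extNat u) η
  naturality_id S := by
    ext Q : 3
    exact (ext.baseChange_id u S.as.unop Q)
  naturality_comp f g := by
    ext Q : 3
    exact (ext.baseChange_comp u f.as.unop g.as.unop Q)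

end

/-! ### The gerbe of liftings of a torsor -/

/-- A lifting to `G` of an `H`-torsor `P` along `h : G ⟶ H`: a `G`-torsor with an `h`-morphism
to `P`. -/
structure Lifting {D : Type u} [Category.{v} D] {K : GrothendieckTopology D}
    {G H : Sheaf K GrpCat.{w}} (h : G ⟶ H) (P : Torsor H) where
  /-- the torsor -/
  torsor : Torsor G
  /-- the morphism to `P` -/
  lam : Torsor.SemiHom h torsor P

namespace Lifting

section

variable {D : Type u} [Category.{v} D] {K : GrothendieckTopology D}
    {G H : Sheaf K GrpCat.{w}} {h : G ⟶ H} {P : Torsor H}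

/-- Morphisms of liftings: morphisms of torsors compatible with the morphisms to `P`. -/
@[ext]
structure Hom (L M : Lifting h P) where
  /-- the morphism of torsors -/
  hom : L.torsor ⟶ M.torsor
  lam_app : ∀ {X : D} (q : L.torsor.sec X), M.lam.app (hom.app q) = L.lam.app q

instance : Category (Lifting h P) where
  Hom := Hom
  id L := ⟨𝟙 L.torsor, fun _ => rfl⟩
  comp m n := ⟨m.hom ≫ n.hom, fun q => (n.lam_app _).trans (m.lam_app q)⟩

theorem hom_ext {L M : Lifting h P} {m n : L ⟶ M} (e : Hom.hom m = Hom.hom n) : m = n :=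
  Hom.ext e

/-- Constructor for isomorphisms of liftings. -/
def isoMk {L M : Lifting h P} (e : L.torsor ≅ M.torsor)
    (he : ∀ {X : D} (q : L.torsor.sec X), M.lam.app (e.hom.app q) = L.lam.app q) : L ≅ M where
  hom := ⟨e.hom, he⟩
  inv := ⟨e.inv, fun q => (he _).symm.trans
    (congrArg (M.lam.app ·) (congrArg (fun t => Torsor.Hom.app t q) e.inv_hom_id))⟩
  hom_inv_id := hom_ext e.hom_inv_id
  inv_hom_id := hom_ext e.inv_hom_id

/-- The functor which forgets the morphism to `P`. -/
def forget (h : G ⟶ H) (P : Torsor H) : Lifting h P ⥤ Torsor G where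
  obj L := L.torsor
  map m := m.hom

end

variable {C : Type u} [Category.{v} C] {J : GrothendieckTopology C}
  {G H : Sheaf J GrpCat.{w}} (h : G ⟶ H) (P : Torsor H)

/-- The category of liftings of the restriction of `P` to `C/S`. -/
abbrev Fiber (S : C) := Lifting (homOver h S) (P.localize S)

variable {h P}

/-- The inverse image of a lifting. -/
def pull {S T : C} (f : T ⟶ S) (L : Fiber h P S) : Fiber h P T where
  torsor := L.torsor.pull f
  lam :=
    { app {U} q := L.lam.app (X := (Over.map f).obj U) q
      app_res g q := L.lam.app_res ((Over.map f).map g) q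
      app_act {U} q g := L.lam.app_act (X := (Over.map f).obj U) q g }

variable (h P)

/-- The inverse image functor on liftings. -/
def pullFunctor {S T : C} (f : T ⟶ S) : Fiber h P S ⥤ Fiber h P T where
  obj L := L.pull f
  map m := ⟨Torsor.pullMap f m.hom, fun {U} q => m.lam_app (X := (Over.map f).obj U) q⟩

/-- The isomorphism between the inverse image along an identity and the identity. -/
def pullFunctorId (S : C) : pullFunctor h P (𝟙 S) ≅ 𝟭 _ :=
  NatIso.ofComponents
    (fun L => isoMk (Torsor.pullId L.torsor) fun {U} q =>
      (L.lam.app_res (X := (Over.map (𝟙 S)).obj U) (Y := U) (Over.homMk (𝟙 U.left)) q).trans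
        (sres_id P.carrier (X := U.left) _))
    (fun m => hom_ext (Torsor.pullId_naturality m.hom))

/-- The isomorphism between the inverse image along a composition and the composition of the
inverse images. -/
def pullFunctorComp {S T V : C} (f : T ⟶ S) (g : V ⟶ T) :
    pullFunctor h P (g ≫ f) ≅ pullFunctor h P f ⋙ pullFunctor h P g :=
  NatIso.ofComponents
    (fun L => isoMk (Torsor.pullComp f g L.torsor) fun {U} q =>
      (L.lam.app_res (X := (Over.map (g ≫ f)).obj U) (Y := (Over.map f).obj ((Over.map g).obj U))
        (Over.homMk (𝟙 U.left)) q).trans (sres_id P.carrier (X := U.left) _))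
    (fun m => hom_ext (Torsor.pullComp_naturality f g m.hom))

theorem eqToHom_pull {S T : C} {f f' : T ⟶ S} (e : f = f')
    (e' : (pullFunctor h P f).toCatHom = (pullFunctor h P f').toCatHom) (L : Fiber h P S) :
    Hom.hom ((eqToHom e').toNatTrans.app L) = Torsor.pullCongr e L.torsor := by
  subst e
  refine Torsor.hom_ext (P := L.torsor.pull f) (Q := L.torsor.pull f) fun p => ?_
  refine (sres_id L.torsor.carrier p).symm.trans ?_
  exact Torsor.sres_over_congr _ rfl _

end Lifting

section

variable {C : Type u} [Category.{v} C] {J : GrothendieckTopology C}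
  {G H : Sheaf J GrpCat.{w}} (h : G ⟶ H) (P : Torsor H)

/-- The fibered category `K(P)` of liftings of `P` along `h : G ⟶ H`, as a pseudofunctor. -/
def liftings : LocallyDiscrete Cᵒᵖ ⥤ᵖ Cat.{max u v w, max u v (w + 1)} :=
  LocallyDiscrete.mkPseudofunctor
    (fun S => Cat.of (Lifting.Fiber h P S.unop))
    (fun f => (Lifting.pullFunctor h P f.unop).toCatHom)
    (fun S => Cat.Hom.isoMk (Lifting.pullFunctorId h P S.unop))
    (fun f g => Cat.Hom.isoMk (Lifting.pullFunctorComp h P f.unop g.unop))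
    (fun f g h' => by
      ext L : 3
      exact Lifting.hom_ext ((Torsor.pull_assoc f.unop g.unop h'.unop L.torsor).trans
        (Lifting.eqToHom_pull h P (by simp) _ L).symm))
    (fun f => by
      ext L : 3
      exact Lifting.hom_ext ((Torsor.pull_id_comp f.unop L.torsor).trans
        (Lifting.eqToHom_pull h P (by simp) _ L).symm))
    (fun f => by
      ext L : 3
      exact Lifting.hom_ext ((Torsor.pull_comp_id f.unop L.torsor).trans
        (Lifting.eqToHom_pull h P (by simp) _ L).symm))

open scoped Pseudofunctor.StrongTrans

/-- The components of `forgetTrans`. -/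
def forgetApp (S : LocallyDiscrete Cᵒᵖ) : (liftings h P).obj S ⟶ (TORSC G).obj S :=
  (Lifting.forget (homOver h S.as.unop) (P.localize S.as.unop)).toCatHom

/-- The compatibility of `forgetTrans` with inverse images. -/
def forgetNat {S T : LocallyDiscrete Cᵒᵖ} (f : S ⟶ T) :
    (liftings h P).map f ≫ forgetApp h P T ≅ forgetApp h P S ≫ (TORSC G).map f :=
  Cat.Hom.isoMk (NatIso.ofComponents (fun L => Iso.refl (L.torsor.pull f.as.unop))
    (fun _ => (comp_id _).trans (id_comp _).symm))

/-- The forgetful morphism `k(P) : K(P) ⟶ TORSC(G)`. -/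
def forgetTrans : liftings h P ⟶ TORSC G where
  app S := forgetApp h P S
  naturality f := forgetNat h P f
  naturality_naturality η := map₂_eq (forgetApp h P) (forgetNat h P) η
  naturality_id S := by
    ext L : 3
    exact Torsor.hom_ext fun p => rfl
  naturality_comp f g := by
    ext L : 3
    exact Torsor.hom_ext fun p => rfl

end

/-! ### Gerbes and crossed gerbes -/

section Gerbe

variable {C : Type u} [Category.{v} C]

/-- Fibered categories over `C`, given as pseudofunctors. -/
abbrev FiberedCat (C : Type u) [Category.{v} C] :=
  LocallyDiscrete Cᵒᵖ ⥤ᵖ Cat.{max u v w, max u v (w + 1)}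

/-- The fiber of `F` at `S`. -/
abbrev Fib (F : FiberedCat.{w} C) (S : C) := F.obj (.mk (op S))

/-- The inverse image functor along `f : T ⟶ S`. -/
abbrev invIm (F : FiberedCat.{w} C) {S T : C} (f : T ⟶ S) : Fib F S ⥤ Fib F T :=
  (F.map f.op.toLoc).toFunctor

/-- The canonical isomorphism between `(f g)^* x` and `g^* f^* x`. -/
def invComp (F : FiberedCat.{w} C) {S T V : C} (f : T ⟶ S) (g : V ⟶ T) (k : V ⟶ S)
    (h : g ≫ f = k) (x : Fib F S) : (invIm F g).obj ((invIm F f).obj x) ≅ (invIm F k).obj x :=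
  (Cat.Hom.toNatIso (F.mapComp' f.op.toLoc g.op.toLoc k.op.toLoc (by rw [← h]; rfl))).symm.app x

/-- The restriction of automorphisms, `Aut (f^* x) → Aut ((f g)^* x)`. -/
def autRes (F : FiberedCat.{w} C) {S T V : C} (f : T ⟶ S) (g : V ⟶ T) (k : V ⟶ S)
    (h : g ≫ f = k) (x : Fib F S) (σ : Aut ((invIm F f).obj x)) : Aut ((invIm F k).obj x) :=
  (invComp F f g k h x).conjAut ((invIm F g).mapAut _ σ)

/-- `F` is a gerbe: a stack in groupoids which is locally non-empty, and such that any two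
objects of a fiber are locally isomorphic. -/
structure IsGerbe (F : FiberedCat.{w} C) (J : GrothendieckTopology C) : Prop where
  isStack : F.IsStack J
  isIso : ∀ {S : C} {x y : Fib F S} (m : x ⟶ y), IsIso m
  locally_nonempty : ∀ S : C, ∃ R ∈ J S, ∀ ⦃T : C⦄ (f : T ⟶ S), R f → Nonempty (Fib F T)
  locally_iso : ∀ {S : C} (x y : Fib F S), ∃ R ∈ J S, ∀ ⦃T : C⦄ (f : T ⟶ S), R f →
    Nonempty ((invIm F f).obj x ≅ (invIm F f).obj y)

open scoped Pseudofunctor.StrongTrans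

variable {J : GrothendieckTopology C} {F F' : FiberedCat.{w} C}

/-- The functor induced on the fibers at `S` by a morphism of fibered categories. -/
abbrev fibMap (l : F ⟶ F') (S : C) : Fib F S ⥤ Fib F' S := (l.app (.mk (op S))).toFunctor

/-- The canonical isomorphism between `l (f^* x)` and `f^* (l x)`. -/
def fibNat (l : F ⟶ F') {S T : C} (f : T ⟶ S) (x : Fib F S) :
    (fibMap l T).obj ((invIm F f).obj x) ≅ (invIm F' f).obj ((fibMap l S).obj x) :=
  (Cat.Hom.toNatIso (l.naturality f.op.toLoc)).app x

/-- The map `Aut (f^* x) → Aut (f^* (l x))` defined by a morphism `l` of fibered categories. -/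
def autMap (l : F ⟶ F') {S T : C} (f : T ⟶ S) (x : Fib F S) (σ : Aut ((invIm F f).obj x)) :
    Aut ((invIm F' f).obj ((fibMap l S).obj x)) :=
  (fibNat l f x).conjAut ((fibMap l T).mapAut _ σ)

variable {A A' Pi Pi' : Sheaf J GrpCat.{w}}

/-- The torsor `μ(x)`. -/
abbrev tors (μ : F ⟶ TORSC Pi) {S : C} (x : Fib F S) : Torsor (Pi.over S) := (fibMap μ S).obj x

/-- The morphism of torsors `μ(m)`. -/
abbrev torsMap (μ : F ⟶ TORSC Pi) {S : C} {x y : Fib F S} (m : x ⟶ y) : tors μ x ⟶ tors μ y :=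
  (fibMap μ S).map m

/-- The canonical isomorphism `μ(f^* x) ⟶ f^* μ(x)`. -/
def torsNat (μ : F ⟶ TORSC Pi) {S T : C} (f : T ⟶ S) (x : Fib F S) :
    tors μ ((invIm F f).obj x) ⟶ (tors μ x).pull f :=
  (fibNat μ f x).hom

/-- The automorphism of `f^* μ(x)` defined by an automorphism of `f^* x`. -/
def torsAut (μ : F ⟶ TORSC Pi) {S T : C} (f : T ⟶ S) (x : Fib F S) (σ : Aut ((invIm F f).obj x)) :
    (tors μ x).pull f ⟶ (tors μ x).pull f :=
  (autMap μ f x σ).hom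

variable [IsUSite.{w} J]

/-- An isomorphism `j : Aut(F) ≅ (- ∧^Π A) ∘ μ` of morphisms from `F` to the stack of
sheaves of groups: for every `x` over `S`, an isomorphism from the sheaf (on `C/S`) of
automorphisms of `x` to the sheaf of groups `μ(x) ∧^Π A`, which is natural in `x` and compatible
with inverse images. -/
@[ext]
structure AutIso (Φ : CrossedGroup A Pi) (F : FiberedCat.{w} C) (μ : F ⟶ TORSC Pi) where
  /-- the group isomorphisms on sections -/
  equiv : ∀ {S : C} (x : Fib F S) (T : Over S),
    Aut ((invIm F T.hom).obj x) ≃* CSec (tors μ x) (Φ.over S).action T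
  equiv_res : ∀ {S : C} (x : Fib F S) {T V : Over S} (g : V ⟶ T) (σ : Aut ((invIm F T.hom).obj x)),
    equiv x V (autRes F T.hom g.left V.hom (Over.w g) x σ) = sres _ g (equiv x T σ)
  equiv_natural : ∀ {S : C} {x y : Fib F S} (e : x ≅ y) (T : Over S)
    (σ : Aut ((invIm F T.hom).obj x)),
    equiv y T (((invIm F T.hom).mapIso e).conjAut σ) =
      sapp (contrMap (Φ.over S).action (torsMap μ e.hom)) T (equiv x T σ)
  equiv_inv : ∀ {S S' : C} (f : S' ⟶ S) (x : Fib F S) (T : Over S')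
    (σ : Aut ((invIm F T.hom).obj ((invIm F f).obj x))),
    equiv x ((Over.map f).obj T) ((invComp F f T.hom ((Over.map f).obj T).hom rfl x).conjAut σ) =
      bc Φ.action f (tors μ x)
        (sapp (contrMap (Φ.over S').action (torsNat μ f x)) T (equiv ((invIm F f).obj x) T σ))

/-- `(F, μ, j)` is an `(A, Π)`-gerbe: `F` is a gerbe and, if a section `z` of `μ(x) ∧^Π A` is
locally represented by `(p, a)`, then the automorphism of `μ(x)` induced by `j⁻¹(z)` is locally
given by `p ↦ p ρ(a)`. -/
structure IsCrossedGerbe (Φ : CrossedGroup A Pi) (F : FiberedCat.{w} C) (μ : F ⟶ TORSC Pi)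
    (j : AutIso Φ F μ) : Prop where
  isGerbe : IsGerbe F J
  torsAut_app : ∀ {S : C} (x : Fib F S) (T : Over S) (z : CSec (tors μ x) (Φ.over S).action T)
    (U : Over T.left) (p : (tors μ x).sec ((Over.map T.hom).obj U))
    (a : Sec (A.over S) ((Over.map T.hom).obj U)),
    sres _ (Over.homMk U.hom : (Over.map T.hom).obj U ⟶ T) z =
      contr.mk (Φ.over S).action p a →
    (torsAut μ T.hom x ((j.equiv x T).symm z)).app (X := U) p =
      (tors μ x).act p (gapp (Φ.over S).ρ _ a)

/-- `(f, φ)` is a morphism of sheaves of crossed groups. -/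
structure CrossedGroup.IsHom (Φ : CrossedGroup A Pi) (Φ' : CrossedGroup A' Pi') (f : A ⟶ A')
    (φ : Pi ⟶ Pi') : Prop where
  comm : f ≫ Φ'.ρ = Φ.ρ ≫ φ
  map_smul : ∀ {U : C} (α : Sec Pi U) (a : Sec A U),
    gapp f U (Φ.action.smul α a) = Φ'.action.smul (gapp φ U α) (gapp f U a)

/-- The morphism `ω_x : μ(x) ∧^Π A ⟶ μ'(l x) ∧^Π' A'` defined by the canonical morphism
`μ(x) ⟶ μ(x) ∧^Π Π'` along `φ`, by `f` and by an isomorphism `i` from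
`TORSC(φ) ∘ μ` to `μ' ∘ l`. -/
noncomputable def omega {Φ : CrossedGroup A Pi} {Φ' : CrossedGroup A' Pi'} {f : A ⟶ A'}
    {φ : Pi ⟶ Pi'} (hf : Φ.IsHom Φ' f φ) {μ : F ⟶ TORSC Pi} {μ' : F' ⟶ TORSC Pi'} {l : F ⟶ F'}
    (i : μ ≫ extTrans φ ≅ l ≫ μ') {S : C} (x : Fib F S) :
    contr (tors μ x) (Φ.over S).action ⟶ contr (tors μ' ((fibMap l S).obj x)) (Φ'.over S).action :=
  contrSemiMap (s := (Φ.over S).action) (t := (Φ'.over S).action) (ext.unit (homOver φ S) (tors μ x)) (homOver f S)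
      (fun {U} g a => hf.map_smul (U := U.left) g a) ≫
    contrMap (Q := ext (homOver φ S) (tors μ x)) (Φ'.over S).action
      ((i.hom.as.app (.mk (op S))).toNatTrans.app x)

/-- `l : F ⟶ F'` is an `(f, φ)`-morphism from `(F, μ, j)` to `(F', μ', j')`: there is
an isomorphism `i` from `TORSC(φ) ∘ μ` to `μ' ∘ l` such that, for every `x`, the map
`Aut(x) → Aut(l x)` corresponds to `ω_x` through `j` and `j'`. -/
def IsCrossedMorphism {Φ : CrossedGroup A Pi} {Φ' : CrossedGroup A' Pi'} {f : A ⟶ A'}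
    {φ : Pi ⟶ Pi'} (hf : Φ.IsHom Φ' f φ) {μ : F ⟶ TORSC Pi} {μ' : F' ⟶ TORSC Pi'}
    (j : AutIso Φ F μ) (j' : AutIso Φ' F' μ') (l : F ⟶ F') : Prop :=
  ∃ i : μ ≫ extTrans φ ≅ l ≫ μ', ∀ {S : C} (x : Fib F S) (T : Over S)
    (σ : Aut ((invIm F T.hom).obj x)),
    j'.equiv ((fibMap l S).obj x) T (autMap l T.hom x σ) = sapp (omega hf i x) T (j.equiv x T σ)

end Gerbe

/-! ### Exact sequences, and the explicit isomorphisms -/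

section

variable {C : Type u} [Category.{v} C] {J : GrothendieckTopology C}

/-- A short exact sequence `e → (A, Π) → (A', Π') → (A'', Π'') → e` of sheaves of crossed
groups: the sequence `1 → A → A' → A'' → 1` of sheaves of groups is exact,
`Π → Π'` is an isomorphism and `Π' → Π''` is an epimorphism (of sheaves of groups). -/
structure IsShortExact {A A' A'' Pi Pi' Pi'' : Sheaf J GrpCat.{w}} (Φ : CrossedGroup A Pi)
    (Φ' : CrossedGroup A' Pi') (Φ'' : CrossedGroup A'' Pi'') (f : A ⟶ A') (φ : Pi ⟶ Pi')
    (h : A' ⟶ A'') (ψ : Pi' ⟶ Pi'') : Prop where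
  isHom_left : Φ.IsHom Φ' f φ
  isHom_right : Φ'.IsHom Φ'' h ψ
  injective : ∀ U : C, Function.Injective (gapp f U)
  exact_middle : ∀ {U : C} (a : Sec A' U), gapp h U a = 1 ↔ ∃ b : Sec A U, gapp f U b = a
  locally_surjective : ∀ {U : C} (c : Sec A'' U), ∃ R ∈ J U, ∀ ⦃V : C⦄ (g : V ⟶ U), R g →
    ∃ a : Sec A' V, gapp h V a = gres A'' g c
  isIso : IsIso φ
  locally_surjective' : ∀ {U : C} (c : Sec Pi'' U), ∃ R ∈ J U, ∀ ⦃V : C⦄ (g : V ⟶ U), R g →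
    ∃ a : Sec Pi' V, gapp ψ V a = gres Pi'' g c

/-- `σ` is the automorphism `σ_q(b)` of the restriction of `Q` to `T`, such that
`σ_q(b)(q b') = (q b) b'`. -/
def IsSigma {G : Sheaf J GrpCat.{w}} {S : C} (Q : Torsor (G.over S)) (T : Over S) (q : Q.sec T)
    (b : Sec (G.over S) T) (σ : Q.pull T.hom ⟶ Q.pull T.hom) : Prop :=
  ∀ (U : Over T.left) (b' : Sec (G.over S) ((Over.map T.hom).obj U)),
    σ.app (X := U) (Q.act (Q.res (Over.homMk U.hom : (Over.map T.hom).obj U ⟶ T) q) b') =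
      Q.act (Q.act (Q.res (Over.homMk U.hom : (Over.map T.hom).obj U ⟶ T) q)
        (gres (G.over S) (Over.homMk U.hom : (Over.map T.hom).obj U ⟶ T) b)) b'

open scoped Pseudofunctor.StrongTrans

variable [IsUSite.{w} J] {A A' A'' Pi : Sheaf J GrpCat.{w}}

/-- The morphism `μ_TORS : TORSC(A) ⟶ TORSC(Π)`, `Q ↦ Q ∧^A Π`. -/
noncomputable abbrev muTORS (Φ : CrossedGroup A Pi) : TORSC A ⟶ TORSC Pi := extTrans Φ.ρ

/-- The morphism `μ_P : K(P) ⟶ TORSC(Π)`, `(Q, λ) ↦ Q ∧^{A'} Π`. -/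
noncomputable abbrev muLift (Φ' : CrossedGroup A' Pi) (h : A' ⟶ A'') (P : Torsor A'') :
    liftings h P ⟶ TORSC Pi :=
  forgetTrans h P ≫ extTrans Φ'.ρ

/-- The formula which defines `j_TORS`: the automorphism of `Q` which corresponds to the section of
`(Q ∧^A Π) ∧^Π A` locally represented by `((q, α), a)` is locally `σ_q(α a)`. -/
def IsCanonicalTORS (Φ : CrossedGroup A Pi) (j : AutIso Φ (TORSC A) (muTORS Φ)) : Prop :=
  ∀ {S : C} (Q : Torsor (A.over S)) (T : Over S) (q : Q.sec T) (α : Sec (Pi.over S) T)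
    (a : Sec (A.over S) T),
    IsSigma Q T q ((Φ.over S).action.smul α a)
      ((j.equiv (S := S) Q T).symm (contr.mk (Q := ext (homOver Φ.ρ S) Q) (Φ.over S).action
        (ext.mk (homOver Φ.ρ S) q α) a)).hom

/-- The formula which defines `j_P`: the automorphism of `(Q, λ)` which corresponds to the section
of `(Q ∧^{A'} Π) ∧^Π A` locally represented by `((q, α), a)` is locally `σ_q(f(α a))`. -/
def IsCanonicalLift (Φ : CrossedGroup A Pi) (Φ' : CrossedGroup A' Pi) (f : A ⟶ A') (h : A' ⟶ A'')
    (P : Torsor A'') (j : AutIso Φ (liftings h P) (muLift Φ' h P)) : Prop :=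
  ∀ {S : C} (L : Lifting.Fiber h P S) (T : Over S) (q : L.torsor.sec T) (α : Sec (Pi.over S) T)
    (a : Sec (A.over S) T),
    IsSigma L.torsor T q (gapp (homOver f S) T ((Φ.over S).action.smul α a))
      (Lifting.Hom.hom ((j.equiv (S := S) L T).symm
        (contr.mk (Q := ext (homOver Φ'.ρ S) L.torsor) (Φ.over S).action
          (ext.mk (homOver Φ'.ρ S) q α) a)).hom)

end

end CrossedGerbe

open CrossedGerbe

/-!
Let `Q` be an `A'`-torsor. A section `z` of `(Q ∧^{A'} Π) ∧^Π A` has, with respect to a local section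
`q` of `Q`, a unique coordinate `a` in `A` with `z = [[q, 1], a]`. Replacing `q` by `q g` changes `f(a)`
to `g⁻¹ f(a) g`, because `ρ'(g)` acts on `A'` as conjugation by `g`. Hence `q ↦ q f(a)` is a well-defined
endomorphism of the torsor `Q`; the relation between `z` and this endomorphism is the predicate
`IsTwist`. It determines the endomorphism (`IsTwist.hom_unique`) and, `f` being injective, the section
(`IsTwist.section_unique`); it is compatible with products, restrictions, isomorphisms of torsors and
inverse images (`IsTwist.mul`, `IsTwist.pullHom`, `IsTwist.conj`, `IsTwist.baseChange`). An endomorphism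
which locally has the form `q ↦ q f(a)` comes from a section (`exists_isTwist`).

For `A = A'` and `f = 1` every endomorphism of `Q` has this form, which gives `j_TORS` (`autIsoTORS`). For a
lifting `(Q, λ)`, an automorphism `q ↦ q g` respects `λ` if and only if `h(g) = 1`, that is, if and only
if `g` lies in the image of `f`, which gives `j_P` (`autIsoLift`). The formulas with `σ_q(f(α a))` follow from
`[[q, α], a] = [[q, 1], α a]`, and they characterize the two isomorphisms because the case `α = 1`
already says that `IsTwist` holds. On `Q ∧^{A'} Π` the endomorphism maps `[[q, α]]` to
`[[q f(α a), α]] = [[q, ρ(α a) α]] = [[q, α]] ρ(a)`, which is the condition on crossed gerbes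
(`IsTwist.app_ext`). Finally `ω` maps `[[q, 1], a]` to `[[q, 1], f(a)]`, and the automorphism of `Q` is the same
for both sections, so that `k(P)` is an `(f, 1)`-morphism.

That `TORSC(A')` and `K(P)` are gerbes rests on descent for torsors. The sections of the descended torsor
are the compatible families of sections of the given torsors (`TorsorDescent.glued`); they form a set which
need not be small a priori, but a set on which a small group acts simply transitively is small
(`LargeTorsor.shrink`). The maps to `P` glue because `P` is a sheaf. Two liftings are locally isomorphic
because `h` is locally surjective (`liftings_isGerbe`).
-/

universe t

namespace CrossedGerbe

open Pseudofunctor.LocallyDiscreteOpToCat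

/-! ### Coherence isomorphisms of torsors and liftings -/

section

variable {C : Type u} [Category.{v} C] {J : GrothendieckTopology C}

/-- The coherence isomorphism `(f g)^* P ≅ g^* f^* P` of `TORSC G` is the restriction of sections
along a morphism of `C/S` over an identity. -/
theorem TORSC_mapComp'_hom_app {G : Sheaf J GrpCat.{w}} {S T V : C} (f : T ⟶ S) (g : V ⟶ T)
    (k : V ⟶ S) (h : f.op.toLoc ≫ g.op.toLoc = k.op.toLoc) (P : Torsor (G.over S)) {U : Over V}
    (p : P.sec ((Over.map k).obj U)) :
    Torsor.Hom.app (P := P.pull k) (Q := (P.pull f).pull g)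
        (((TORSC G).mapComp' f.op.toLoc g.op.toLoc k.op.toLoc h).hom.toNatTrans.app P) p =
      P.res (X := (Over.map k).obj U) (Y := (Over.map f).obj ((Over.map g).obj U))
        (Over.homMk (𝟙 U.left) (by
          obtain rfl : k = g ≫ f := by simpa using congrArg (fun x => Quiver.Hom.unop x.as) h.symm
          simp)) p := by
  obtain rfl : k = g ≫ f := by simpa using congrArg (fun x => Quiver.Hom.unop x.as) h.symm
  obtain rfl : h = rfl := rfl
  have := Pseudofunctor.mapComp'_eq_mapComp (TORSC G) f.op.toLoc g.op.toLoc
  erw [this]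
  rfl

theorem TORSC_mapComp'_inv_app {G : Sheaf J GrpCat.{w}} {S T V : C} (f : T ⟶ S) (g : V ⟶ T)
    (k : V ⟶ S) (h : f.op.toLoc ≫ g.op.toLoc = k.op.toLoc) (P : Torsor (G.over S)) {U : Over V}
    (p : P.sec ((Over.map f).obj ((Over.map g).obj U))) :
    Torsor.Hom.app (P := (P.pull f).pull g) (Q := P.pull k)
        (((TORSC G).mapComp' f.op.toLoc g.op.toLoc k.op.toLoc h).inv.toNatTrans.app P) p =
      P.res (Y := (Over.map k).obj U) (X := (Over.map f).obj ((Over.map g).obj U))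
        (Over.homMk (𝟙 U.left) (by
          obtain rfl : k = g ≫ f := by simpa using congrArg (fun x => Quiver.Hom.unop x.as) h.symm
          simp)) p := by
  obtain rfl : k = g ≫ f := by simpa using congrArg (fun x => Quiver.Hom.unop x.as) h.symm
  obtain rfl : h = rfl := rfl
  have := Pseudofunctor.mapComp'_eq_mapComp (TORSC G) f.op.toLoc g.op.toLoc
  erw [this]
  rfl

/-- The map `g^* m` between inverse images, up to the coherence isomorphisms, has the same values as
`m`. -/
theorem TORSC_pullHom_app {G : Sheaf J GrpCat.{w}} {X₁ X₂ Y Y' : C} (P₁ : Torsor (G.over X₁))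
    (P₂ : Torsor (G.over X₂))
    {f₁ : Y ⟶ X₁} {f₂ : Y ⟶ X₂} (m : P₁.pull f₁ ⟶ P₂.pull f₂) (g : Y' ⟶ Y) (gf₁ : Y' ⟶ X₁)
        (gf₂ : Y' ⟶ X₂)
    (h₁ : g ≫ f₁ = gf₁) (h₂ : g ≫ f₂ = gf₂) {U : Over Y'} (p : P₁.sec ((Over.map gf₁).obj U)) :
    Torsor.Hom.app (P := P₁.pull gf₁) (Q := P₂.pull gf₂)
      (pullHom (F := TORSC G) (M₁ := P₁) (M₂ := P₂) m g gf₁ gf₂ h₁ h₂) p =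
    P₂.res (Over.homMk (𝟙 U.left) (by simp [← h₂]))
      (m.app (X := (Over.map g).obj U) (P₁.res (X := (Over.map gf₁).obj U)
        (Y := (Over.map f₁).obj ((Over.map g).obj U))
            (Over.homMk (𝟙 U.left) (by simp [← h₁])) p)) := by
  unfold pullHom
  refine (TORSC_mapComp'_inv_app f₂ g gf₂ (by rw [← h₂]; rfl) P₂ _).trans ?_
  exact congrArg (fun x => P₂.res _ (m.app (X := (Over.map g).obj U) x))
      (TORSC_mapComp'_hom_app f₁ g gf₁ (by rw [← h₁]; rfl) P₁ p)

/-- The coherence isomorphisms of `K(P)` are, on the underlying torsors, those of `TORSC`. -/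
theorem liftings_mapComp'_hom {G H : Sheaf J GrpCat.{w}} {h : G ⟶ H} {P : Torsor H} {S T V : C}
    (f : T ⟶ S) (g : V ⟶ T)
    (k : V ⟶ S) (e : f.op.toLoc ≫ g.op.toLoc = k.op.toLoc) (L : Lifting.Fiber h P S) :
    Lifting.Hom.hom (L := L.pull k) (M := (L.pull f).pull g)
      (((liftings h P).mapComp' f.op.toLoc g.op.toLoc k.op.toLoc e).hom.toNatTrans.app L) =
    ((TORSC G).mapComp' f.op.toLoc g.op.toLoc k.op.toLoc e).hom.toNatTrans.app L.torsor := by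
  obtain rfl : k = g ≫ f := by simpa using congrArg (fun x => Quiver.Hom.unop x.as) e.symm
  obtain rfl : e = rfl := rfl
  have h1 := Pseudofunctor.mapComp'_eq_mapComp (TORSC G) f.op.toLoc g.op.toLoc
  have h2 := Pseudofunctor.mapComp'_eq_mapComp (liftings h P) f.op.toLoc g.op.toLoc
  erw [h1, h2]
  rfl

theorem liftings_mapComp'_inv {G H : Sheaf J GrpCat.{w}} {h : G ⟶ H} {P : Torsor H} {S T V : C}
    (f : T ⟶ S) (g : V ⟶ T)
    (k : V ⟶ S) (e : f.op.toLoc ≫ g.op.toLoc = k.op.toLoc) (L : Lifting.Fiber h P S) :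
    Lifting.Hom.hom (L := (L.pull f).pull g) (M := L.pull k)
      (((liftings h P).mapComp' f.op.toLoc g.op.toLoc k.op.toLoc e).inv.toNatTrans.app L) =
    ((TORSC G).mapComp' f.op.toLoc g.op.toLoc k.op.toLoc e).inv.toNatTrans.app L.torsor := by
  obtain rfl : k = g ≫ f := by simpa using congrArg (fun x => Quiver.Hom.unop x.as) e.symm
  obtain rfl : e = rfl := rfl
  have h1 := Pseudofunctor.mapComp'_eq_mapComp (TORSC G) f.op.toLoc g.op.toLoc
  have h2 := Pseudofunctor.mapComp'_eq_mapComp (liftings h P) f.op.toLoc g.op.toLoc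
  erw [h1, h2]
  rfl

theorem liftings_pullHom {G H : Sheaf J GrpCat.{w}} {h : G ⟶ H} {P : Torsor H} {X₁ X₂ Y Y' : C}
    (L₁ : Lifting.Fiber h P X₁) (L₂ : Lifting.Fiber h P X₂)
    {f₁ : Y ⟶ X₁} {f₂ : Y ⟶ X₂} (m : L₁.pull f₁ ⟶ L₂.pull f₂) (g : Y' ⟶ Y) (gf₁ : Y' ⟶ X₁)
        (gf₂ : Y' ⟶ X₂)
    (h₁ : g ≫ f₁ = gf₁) (h₂ : g ≫ f₂ = gf₂) :
    Lifting.Hom.hom (L := L₁.pull gf₁) (M := L₂.pull gf₂)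
      (pullHom (F := liftings h P) (M₁ := L₁) (M₂ := L₂) m g gf₁ gf₂ h₁ h₂) =
    pullHom (F := TORSC G) (M₁ := L₁.torsor) (M₂ := L₂.torsor) m.hom g gf₁ gf₂ h₁ h₂ := by
  unfold pullHom
  rw [← liftings_mapComp'_hom, ← liftings_mapComp'_inv]
  rfl

end

/-! ### Morphisms between inverse images of torsors -/

section

variable {C : Type u} [Category.{v} C] {J : GrothendieckTopology C}
  {G : Sheaf J GrpCat.{w}}

namespace Torsor

theorem res_comp {S : C} (P : Torsor (G.over S)) {U V W : Over S} (f : V ⟶ U) (g : W ⟶ V)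
    (h : W ⟶ U)
    (e : g.left ≫ f.left = h.left) (p : P.sec U) : P.res g (P.res f p) = P.res h p :=
  (sres_comp _ _ _ _).symm.trans (sres_over_congr _ e _)

theorem res_eq_self {S : C} (P : Torsor (G.over S)) {U : Over S} (f : U ⟶ U)
    (e : f.left = 𝟙 U.left) (p : P.sec U) : P.res f p = p :=
  (sres_over_congr _ e p).trans (sres_id _ _)

/-- The value of a morphism `m : f₁^* P₁ ⟶ f₂^* P₂` of inverse images on a section `p` of `P₁`
over `V₁`, restricted along `c` to a section of `P₂` over `V₂`. -/
def ev {X₁ X₂ Y : C} {P₁ : Torsor (G.over X₁)} {P₂ : Torsor (G.over X₂)} {f₁ : Y ⟶ X₁}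
    {f₂ : Y ⟶ X₂} (m : P₁.pull f₁ ⟶ P₂.pull f₂) {V₁ : Over X₁} {V₂ : Over X₂}
    (c : V₂.left ⟶ V₁.left) (b : V₂.left ⟶ Y) (h₁ : b ≫ f₁ = c ≫ V₁.hom) (h₂ : b ≫ f₂ = V₂.hom)
    (p : P₁.sec V₁) : P₂.sec V₂ :=
  P₂.res (Over.homMk (𝟙 V₂.left) (by simp [h₂]) : V₂ ⟶ (Over.map f₂).obj (Over.mk b))
    (m.app (X := Over.mk b)
      (P₁.res (Over.homMk c (by simp [h₁]) : (Over.map f₁).obj (Over.mk b) ⟶ V₁) p))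

section

variable {X₁ X₂ X₃ Y : C} {P₁ : Torsor (G.over X₁)} {P₂ : Torsor (G.over X₂)}
  {P₃ : Torsor (G.over X₃)} {f₁ : Y ⟶ X₁}
  {f₂ : Y ⟶ X₂} {f₃ : Y ⟶ X₃} (m : P₁.pull f₁ ⟶ P₂.pull f₂) {V₁ : Over X₁} {V₂ : Over X₂}
  (c : V₂.left ⟶ V₁.left) (b : V₂.left ⟶ Y) (h₁ : b ≫ f₁ = c ≫ V₁.hom) (h₂ : b ≫ f₂ = V₂.hom)

theorem res_ev {V₂' : Over X₂} (k : V₂' ⟶ V₂) (p : P₁.sec V₁) {c' : V₂'.left ⟶ V₁.left}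
    {b' : V₂'.left ⟶ Y} (hc : k.left ≫ c = c') (hb : k.left ≫ b = b') :
    P₂.res k (ev m c b h₁ h₂ p) =
      ev m c' b' (by simp [← hc, ← hb, h₁]) (by simp [← hb, h₂]) p := by
  subst hc hb
  let l : Over.mk (k.left ≫ b) ⟶ Over.mk b := Over.homMk k.left
  have h := m.app_res l (P₁.res (X := V₁) (Y := (Over.map f₁).obj (Over.mk b))
    (Over.homMk c (by simp [h₁])) p)
  refine (res_comp P₂ (Over.homMk (𝟙 V₂.left) (by simp [h₂]) : V₂ ⟶ (Over.map f₂).obj (Over.mk b))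
    k (Over.homMk k.left (by simp [h₂]) : V₂' ⟶ (Over.map f₂).obj (Over.mk b)) (by simp) _).trans
    (Eq.trans (Eq.symm (res_comp P₂ ((Over.map f₂).map l) (Over.homMk (𝟙 V₂'.left) (by simp [h₂]) :
      V₂' ⟶ (Over.map f₂).obj (Over.mk (k.left ≫ b))) _ (by simp [l]) _)) ?_)
  refine congrArg (P₂.res _) (h.symm.trans ?_)
  exact congrArg (fun x => m.app (X := Over.mk (k.left ≫ b)) x)
    (res_comp P₁ _ ((Over.map f₁).map l) _ (by simp [l]) p)

theorem ev_res {V₁' : Over X₁} (k : V₁ ⟶ V₁') (p : P₁.sec V₁') {c' : V₂.left ⟶ V₁'.left}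
    (hc : c ≫ k.left = c') :
    ev m c b h₁ h₂ (P₁.res k p) = ev m c' b (by simp [← hc, h₁]) h₂ p := by
  subst hc
  exact congrArg (fun x => P₂.res _ (m.app (X := Over.mk b) x))
    (res_comp P₁ k _ _ (by simp) p)

theorem ev_act (p : P₁.sec V₁) (g : Sec (G.over X₁) V₁) :
    ev m c b h₁ h₂ (P₁.act p g) = P₂.act (ev m c b h₁ h₂ p) (gres G c g) := by
  refine (congrArg (fun x => P₂.res _ (m.app (X := Over.mk b) x)) (P₁.act_res _ _ _)).trans ?_
  refine (congrArg (fun x => P₂.res _ x) (m.app_act (X := Over.mk b) _ _)).trans ?_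
  refine (P₂.act_res _ _ _).trans ?_
  refine congrArg (P₂.act _) ?_
  exact gres_id G _

theorem ev_pullHom {Y' : C} (g : Y' ⟶ Y) (gf₁ : Y' ⟶ X₁) (gf₂ : Y' ⟶ X₂) (e₁ : g ≫ f₁ = gf₁)
    (e₂ : g ≫ f₂ = gf₂) (b : V₂.left ⟶ Y') (h₁ : b ≫ gf₁ = c ≫ V₁.hom) (h₂ : b ≫ gf₂ = V₂.hom)
    (p : P₁.sec V₁) :
    ev (P₁ := P₁) (P₂ := P₂) (pullHom (F := TORSC G) (M₁ := P₁) (M₂ := P₂) m g gf₁ gf₂ e₁ e₂)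
      c b h₁ h₂ p = ev m c (b ≫ g) (by simp [e₁, h₁]) (by simp [e₂, h₂]) p := by
  refine (congrArg (fun x => P₂.res _ x) (TORSC_pullHom_app P₁ P₂ m g gf₁ gf₂ e₁ e₂ _)).trans ?_
  refine (res_comp P₂ (Over.homMk (𝟙 V₂.left) (by simp [e₂]) :
      (Over.map gf₂).obj (Over.mk b) ⟶ (Over.map f₂).obj ((Over.map g).obj (Over.mk b)))
    (Over.homMk (𝟙 V₂.left) (by simp [h₂]) : V₂ ⟶ (Over.map gf₂).obj (Over.mk b))
    (Over.homMk (𝟙 V₂.left) (by simp [h₂, e₂]) : V₂ ⟶ (Over.map f₂).obj (Over.mk (b ≫ g)))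
    (by simp) _).trans ?_
  exact congrArg (fun x => P₂.res _ (m.app (X := Over.mk (b ≫ g)) x))
    (res_comp P₁ _ _ _ (by simp) p)

theorem ev_id (f : Y ⟶ X₁) {V : Over X₁} (c : V.left ⟶ V₁.left) (b : V.left ⟶ Y)
    (h₁ : b ≫ f = c ≫ V₁.hom) (h₂ : b ≫ f = V.hom) (p : P₁.sec V₁) :
    ev (𝟙 (P₁.pull f)) c b h₁ h₂ p = P₁.res (Over.homMk c (by rw [← h₁, h₂])) p :=
  res_comp P₁ _ _ _ (by simp) p

theorem ev_ev (n : P₂.pull f₂ ⟶ P₃.pull f₃) {V₃ : Over X₃} (d : V₃.left ⟶ V₂.left)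
    (p : P₁.sec V₁) {c' : V₃.left ⟶ V₁.left} {b' : V₃.left ⟶ Y} (hc : d ≫ c = c')
    (hb : d ≫ b = b') (h₃ : b' ≫ f₃ = V₃.hom) :
    ev n d b' (by simp [← hb, h₂]) h₃ (ev m c b h₁ h₂ p) =
      ev (m ≫ n) c' b' (by simp [← hc, ← hb, h₁]) h₃ p := by
  subst hc hb
  let l : Over.mk (d ≫ b) ⟶ Over.mk b := Over.homMk d
  have h := m.app_res l (P₁.res (X := V₁) (Y := (Over.map f₁).obj (Over.mk b))
    (Over.homMk c (by simp [h₁])) p)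
  refine congrArg (fun x => P₃.res _ (n.app (X := Over.mk (d ≫ b)) x)) ?_
  refine (res_comp P₂ _ _ ((Over.map f₂).map l) (by simp [l]) _).trans (h.symm.trans ?_)
  exact congrArg (fun x => m.app (X := Over.mk (d ≫ b)) x)
    (res_comp P₁ _ ((Over.map f₁).map l) _ (by simp [l]) p)

/-- The value over `X` of a morphism of inverse images can be computed by `ev`, so that identities
between morphisms of inverse images reduce to identities between values of `ev`. -/
theorem app_eq_ev {W : Over Y} (p : P₁.sec ((Over.map f₁).obj W)) :
    m.app (X := W) p = ev m (V₁ := (Over.map f₁).obj W) (V₂ := (Over.map f₂).obj W) (𝟙 W.left)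
      W.hom (by simp) (by simp) p := by
  refine ((res_eq_self P₂ (U := (Over.map f₂).obj W) _ rfl _).trans ?_).symm
  exact congrArg (fun x => m.app (X := W) x) (res_eq_self P₁ (U := (Over.map f₁).obj W) _ rfl p)

theorem hom_ext_ev {m n : P₁.pull f₁ ⟶ P₂.pull f₂}
    (h : ∀ {V₁ : Over X₁} {V₂ : Over X₂} (c : V₂.left ⟶ V₁.left) (b : V₂.left ⟶ Y)
      (h₁ : b ≫ f₁ = c ≫ V₁.hom) (h₂ : b ≫ f₂ = V₂.hom) (p : P₁.sec V₁),
      ev m c b h₁ h₂ p = ev n c b h₁ h₂ p) : m = n :=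
  hom_ext fun p => (app_eq_ev m p).trans ((h _ _ _ _ p).trans (app_eq_ev n p).symm)

end

/-- Morphisms between inverse images of torsors glue. -/
theorem existsUnique_hom {S : C} (P Q : Torsor (G.over S)) (U : Over S) (R : Sieve U)
    (hR : R ∈ J.over S U)
    (x : ∀ {V : Over S} (g : V ⟶ U), R g → (P.pull V.hom ⟶ Q.pull V.hom))
    (hx : ∀ {V Z : Over S} (g : V ⟶ U) (hg : R g) (k : Z ⟶ V),
      pullHom (F := TORSC G) (M₁ := P) (M₂ := Q) (x g hg) k.left Z.hom Z.hom (Over.w k) (Over.w k)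
        = x (k ≫ g) (R.downward_closed hg k)) :
    ∃! m : P.pull U.hom ⟶ Q.pull U.hom, ∀ {V : Over S} (g : V ⟶ U) (hg : R g),
      pullHom (F := TORSC G) (M₁ := P) (M₂ := Q) m g.left V.hom V.hom (Over.w g) (Over.w g)
        = x g hg := by
  have hx' : ∀ {V Z : Over S} (g : V ⟶ U) (hg : R g) (k : Z ⟶ V) (g' : Z ⟶ U) (hg' : R g')
      (_ : k.left ≫ g.left = g'.left)
      {V₁ V₂ : Over S} (c : V₂.left ⟶ V₁.left) (b : V₂.left ⟶ Z.left)
      (h₁ : b ≫ Z.hom = c ≫ V₁.hom) (h₂ : b ≫ Z.hom = V₂.hom) (p : P.sec V₁)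
      (b' : V₂.left ⟶ V.left) (hb : b ≫ k.left = b'),
      ev (x g hg) c b' (by simp [← hb, h₁]) (by simp [← hb, h₂]) p = ev (x g' hg') c b h₁ h₂ p := by
    intro V Z g hg k g' hg' e V₁ V₂ c b h₁ h₂ p b' hb
    obtain rfl : k ≫ g = g' := by ext; exact e
    subst hb
    rw [← hx g hg k]
    exact (ev_pullHom (x g hg) c k.left Z.hom Z.hom (Over.w k) (Over.w k) b h₁ h₂ p).symm
  let q (W : Over U.left) : (Over.map U.hom).obj W ⟶ U := Over.homMk W.hom
  have key : ∀ {W : Over U.left} (p : P.sec ((Over.map U.hom).obj W)),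
      ∃! t : Q.sec ((Over.map U.hom).obj W), ∀ {Z : Over S} (k : Z ⟶ (Over.map U.hom).obj W)
        (hk : R (k ≫ q W)), Q.res k t = ev (x (k ≫ q W) hk) k.left (𝟙 _)
          (by simpa using (Over.w k).symm) (by simp) p := by
    intro W p
    refine CrossedGerbe.glue Q.carrier _ ((J.over S).pullback_stable (q W) hR)
      (fun Z k hk => ev (x (k ≫ q W) hk) k.left (𝟙 _)
        (by simpa using (Over.w k).symm) (by simp) p) fun Z Z' k hk l => ?_
    refine (res_ev _ _ _ _ _ l p rfl rfl).trans ?_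
    exact hx' (k ≫ q W) hk l ((l ≫ k) ≫ q W) (by simpa using R.downward_closed hk l) (by simp)
      (V₁ := (Over.map U.hom).obj W) (V₂ := Z') (l ≫ k).left (𝟙 _)
        (by simpa using (Over.w (l ≫ k)).symm) (by simp) p _ (by simp)
  choose t ht ht' using @key
  -- the value of the glued morphism at `p` is the section glued from the values of the given
  -- morphisms
  let m : P.pull U.hom ⟶ Q.pull U.hom :=
    { app := fun p => t p
      app_res := fun {W W'} l p => by
        refine (ht' _ _ fun {Z} k hk => ?_).symm
        have hk' : R ((k ≫ (Over.map U.hom).map l) ≫ q W) := by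
          convert hk using 1
          ext
          simp [q]
        refine (res_comp Q _ _ (k ≫ (Over.map U.hom).map l) rfl _).trans ((ht p _ hk').trans ?_)
        refine Eq.trans ?_ (ev_res _ _ _ _ _ ((Over.map U.hom).map l) p rfl).symm
        exact hx' _ hk' (𝟙 Z) _ hk (by simp [q]) (V₁ := (Over.map U.hom).obj W) (V₂ := Z)
          (k ≫ (Over.map U.hom).map l).left (𝟙 _)
          (by simpa using (Over.w (k ≫ (Over.map U.hom).map l)).symm) (by simp) p _ (by simp)
      app_act := fun {W} p g => by
        refine (ht' _ _ fun {Z} k hk => ?_).symm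
        refine (Q.act_res _ _ _).trans ?_
        refine Eq.trans ?_ (ev_act (P₁ := P) (P₂ := Q) (x _ hk) _ _ _ _ p g).symm
        exact congrArg (fun y => Q.act y _) (ht p k hk) }
  have hm : ∀ {V : Over S} (g : V ⟶ U) (hg : R g) {V₁ V₂ : Over S} (c : V₂.left ⟶ V₁.left)
      (b : V₂.left ⟶ V.left) (h₁ : b ≫ V.hom = c ≫ V₁.hom) (h₂ : b ≫ V.hom = V₂.hom)
      (p : P.sec V₁), ev m c (b ≫ g.left) (by simp [h₁]) (by simp [h₂]) p =
        ev (x g hg) c b h₁ h₂ p := by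
    intro V g hg V₁ V₂ c b h₁ h₂ p
    let k : V₂ ⟶ (Over.map U.hom).obj (Over.mk (b ≫ g.left)) := Over.homMk (𝟙 _) (by simp [h₂])
    have hk : R (k ≫ q _) := by
      convert R.downward_closed hg (Over.homMk b h₂ : V₂ ⟶ V) using 1
      ext
      simp [q, k]
    refine (ht _ k hk).trans ?_
    refine (ev_res _ _ _ _ _ _ p (c' := c) (by simp [k])).trans ?_
    exact (hx' g hg (Over.homMk b h₂ : V₂ ⟶ V) _ hk (by simp [k, q]) c (𝟙 _) (by simp [← h₁, h₂])
      (by simp) p b (by simp)).symm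
  refine ⟨m, fun {V} g hg => hom_ext_ev (P₁ := P) (P₂ := Q) fun c b h₁ h₂ p =>
    (ev_pullHom m c _ _ _ (Over.w g) (Over.w g) b h₁ h₂ p).trans (hm g hg c b h₁ h₂ p),
        fun m' hm' => ?_⟩
  refine hom_ext_ev fun {V₁ V₂} c b h₁ h₂ p => ?_
  refine sres_eq_of_cover Q.carrier _ ((J.over S).pullback_stable (Over.homMk b h₂ : V₂ ⟶ U) hR) _ _
    fun Z k hk => ?_
  refine (res_ev m' _ _ _ _ k p rfl rfl).trans (Eq.trans ?_ (res_ev m _ _ _ _ k p rfl rfl).symm)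
  have h3 := ev_pullHom m' (k.left ≫ c) _ Z.hom Z.hom (Over.w (k ≫ Over.homMk b h₂))
    (Over.w (k ≫ Over.homMk b h₂)) (V₁ := V₁) (V₂ := Z) (𝟙 _) (by simp [← h₁, h₂]) (by simp) p
  have h4 := hm _ hk (V₂ := Z) (k.left ≫ c) (𝟙 _) (by simp [← h₁, h₂]) (by simp) p
  rw [hm' _ hk] at h3
  simpa using h3.symm.trans h4.symm

end Torsor

/-- Morphisms of torsors form a sheaf: `TORSC G` is a prestack. -/
theorem TORSC_isPrestack (G : Sheaf J GrpCat.{w}) : (TORSC G).IsPrestack J where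
  isSheaf {S} P Q := by
    rw [isSheaf_iff_isSheaf_of_type]
    intro U R hR x hx
    rw [Presieve.compatible_iff_sieveCompatible] at hx
    exact Torsor.existsUnique_hom P Q U R hR (fun {V} g hg => x g hg)
      (fun {V Z} g hg k => (hx g k hg).symm)

end

/-! ### Descent of torsors -/

/-- A torsor whose sets of sections live in an arbitrary universe: the same data as a `Torsor`, with
the sheaf condition spelled out. Descent produces such torsors, as families indexed by all the
objects over a covering; they are small because a small group acts simply transitively on their
sections. -/
structure LargeTorsor {D : Type u} [Category.{v} D] {K : GrothendieckTopology D}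
    (G : Sheaf K GrpCat.{w}) where
  /-- the sets of sections -/
  sec : D → Type t
  /-- the restriction maps -/
  res : ∀ {X Y : D}, (Y ⟶ X) → sec X → sec Y
  res_id : ∀ {X : D} (p : sec X), res (𝟙 X) p = p
  res_comp : ∀ {X Y Z : D} (f : Y ⟶ X) (g : Z ⟶ Y) (p : sec X), res (g ≫ f) p = res g (res f p)
  glue : ∀ {X : D} (R : Sieve X) (_ : R ∈ K X) (x : ∀ ⦃Y : D⦄ (f : Y ⟶ X), R f → sec Y)
    (_ : ∀ ⦃Y Z : D⦄ (f : Y ⟶ X) (hf : R f) (g : Z ⟶ Y),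
      res g (x f hf) = x (g ≫ f) (R.downward_closed hf g)),
    ∃! p : sec X, ∀ ⦃Y : D⦄ (f : Y ⟶ X) (hf : R f), res f p = x f hf
  /-- the right action -/
  act : ∀ {X : D}, sec X → Sec G X → sec X
  act_one : ∀ {X : D} (p : sec X), act p 1 = p
  act_mul : ∀ {X : D} (p : sec X) (g g' : Sec G X), act p (g * g') = act (act p g) g'
  act_res : ∀ {X Y : D} (f : Y ⟶ X) (p : sec X) (g : Sec G X),
    res f (act p g) = act (res f p) (gres G f g)
  simply_transitive : ∀ {X : D} (p p' : sec X), ∃! g : Sec G X, act p g = p'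
  locally_nonempty : ∀ X : D, ∃ R ∈ K X, ∀ ⦃Y : D⦄ (f : Y ⟶ X), R f → Nonempty (sec Y)

namespace LargeTorsor

variable {D : Type u} [Category.{v} D] {K : GrothendieckTopology D}
    {G : Sheaf K GrpCat.{w}} (E : LargeTorsor.{w, v, u, t} G)

/-- A set on which a small group acts simply transitively is small. -/
instance (X : D) : Small.{w} (E.sec X) := by
  rcases isEmpty_or_nonempty (E.sec X) with h | ⟨⟨p⟩⟩
  · infer_instance
  · exact small_of_surjective (f := E.act p) fun p' => (E.simply_transitive p p').exists

/-- The sheaf of small sets which is isomorphic to the sheaf of sections of a large torsor. -/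
noncomputable def shrinkCarrier : Sheaf K (Type w) where
  obj :=
    { obj := fun X => Shrink.{w} (E.sec X.unop)
      map := fun f => ↾(fun p => equivShrink _ (E.res f.unop ((equivShrink _).symm p)))
      map_id := fun X => by
        ext p
        simp [E.res_id]
      map_comp := fun f g => by
        ext p
        simp [E.res_comp] }
  property := by
    rw [isSheaf_iff_isSheaf_of_type]
    intro X R hR x hx
    rw [Presieve.compatible_iff_sieveCompatible] at hx
    obtain ⟨p, hp, hp'⟩ := E.glue R hR (fun Y f hf => (equivShrink _).symm (x f hf))
      (fun Y Z f hf g => by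
        rw [hx f g hf]
        simp)
    refine ⟨equivShrink _ p, fun Y f hf => ?_, fun p' h => ?_⟩
    · change equivShrink _ (E.res f ((equivShrink _).symm (equivShrink _ p))) = _
      rw [Equiv.symm_apply_apply, hp f hf, Equiv.apply_symm_apply]
    · rw [← hp' ((equivShrink _).symm p') fun Y f hf => ?_, Equiv.apply_symm_apply]
      rw [← h f hf]
      exact ((equivShrink _).symm_apply_apply _).symm

/-- The sections of `E.shrinkCarrier` are those of `E`. -/
noncomputable def secEquiv (X : D) : E.shrinkCarrier.obj.obj (op X) ≃ E.sec X :=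
  (equivShrink.{w} (E.sec X)).symm

theorem secEquiv_res {X Y : D} (f : Y ⟶ X) (p : E.shrinkCarrier.obj.obj (op X)) :
    E.secEquiv Y (sres E.shrinkCarrier f p) = E.res f (E.secEquiv X p) :=
  (equivShrink.{w} (E.sec Y)).symm_apply_apply _

/-- The torsor with small sets of sections defined by a large one. -/
noncomputable def shrink : Torsor G where
  carrier := E.shrinkCarrier
  act {X} p g := (E.secEquiv X).symm (E.act (E.secEquiv X p) g)
  act_one p := by rw [E.act_one, Equiv.symm_apply_apply]
  act_mul p g g' := by rw [Equiv.apply_symm_apply, E.act_mul]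
  act_res {X Y} f p g := (E.secEquiv Y).injective (by
    rw [secEquiv_res, Equiv.apply_symm_apply, Equiv.apply_symm_apply, secEquiv_res, E.act_res])
  simply_transitive {X} p p' := by
    simp only [Equiv.symm_apply_eq]
    exact E.simply_transitive _ _
  locally_nonempty X := by
    obtain ⟨R, hR, h⟩ := E.locally_nonempty X
    exact ⟨R, hR, fun Y f hf => (h f hf).map (E.secEquiv Y).symm⟩

theorem secEquiv_act {X : D} (p : E.shrink.sec X) (g : Sec G X) :
    E.secEquiv X (E.shrink.act p g) = E.act (E.secEquiv X p) g :=
  (E.secEquiv X).apply_symm_apply _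

end LargeTorsor

section

variable {C : Type u} [Category.{v} C] {J : GrothendieckTopology C}
  {G : Sheaf J GrpCat.{w}}

/-- A descent datum for torsors with respect to a family `f i : X i ⟶ S`, given by torsors on
the `X i` and by maps `tr` on sections, which combine restrictions and the identifications
between the different torsors. -/
structure TorsorDescent (G : Sheaf J GrpCat.{w}) {S : C} {ι : Type t} {X : ι → C}
    (f : ∀ i, X i ⟶ S) where
  /-- the torsors -/
  obj (i : ι) : Torsor (G.over (X i))
  /-- the transition maps -/
  tr {i j : ι} {W : Over (X i)} {W' : Over (X j)} (c : W'.left ⟶ W.left)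
    (hc : W'.hom ≫ f j = c ≫ W.hom ≫ f i) : (obj i).sec W → (obj j).sec W'
  tr_eq_res {i : ι} {W W' : Over (X i)} (g : W' ⟶ W) (p : (obj i).sec W) :
    tr g.left (by simp) p = (obj i).res g p
  tr_tr {i j k : ι} {W : Over (X i)} {W' : Over (X j)} {W'' : Over (X k)} (c : W'.left ⟶ W.left)
    (hc : W'.hom ≫ f j = c ≫ W.hom ≫ f i) (c' : W''.left ⟶ W'.left)
    (hc' : W''.hom ≫ f k = c' ≫ W'.hom ≫ f j) (p : (obj i).sec W) :
    tr c' hc' (tr c hc p) = tr (c' ≫ c) (by simp [hc', hc]) p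
  tr_act {i j : ι} {W : Over (X i)} {W' : Over (X j)} (c : W'.left ⟶ W.left)
    (hc : W'.hom ≫ f j = c ≫ W.hom ≫ f i) (p : (obj i).sec W) (g : Sec (G.over (X i)) W) :
    tr c hc ((obj i).act p g) = (obj j).act (tr c hc p) (gres G c g)

namespace TorsorDescent

variable {S : C} {ι : Type t} {X : ι → C} {f : ∀ i, X i ⟶ S} (D : TorsorDescent G f)

/-- The sections over `U` of the torsor obtained by descent: compatible families of sections of the
given torsors. -/
@[ext]
structure Section (U : Over S) where
  /-- the members of the family -/
  val : ∀ (i : ι) (W : Over (X i)) (b : W.left ⟶ U.left), W.hom ≫ f i = b ≫ U.hom →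
    (D.obj i).sec W
  tr_val : ∀ {i j : ι} {W : Over (X i)} {W' : Over (X j)} (b : W.left ⟶ U.left)
    (hb : W.hom ≫ f i = b ≫ U.hom) (c : W'.left ⟶ W.left)
    (hc : W'.hom ≫ f j = c ≫ W.hom ≫ f i),
    D.tr c hc (val i W b hb) = val j W' (c ≫ b) (by simp [hc, hb])

variable {D}

theorem Section.val_congr {U : Over S} (s : D.Section U) {i : ι} {W : Over (X i)}
    {b b' : W.left ⟶ U.left} (e : b = b') (hb : W.hom ≫ f i = b ≫ U.hom) :
    s.val i W b hb = s.val i W b' (by rw [← e, hb]) := by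
  subst e
  rfl

theorem Section.res_val {U : Over S} (s : D.Section U) {i : ι} {W W' : Over (X i)} (k : W' ⟶ W)
    (b : W.left ⟶ U.left) (hb : W.hom ≫ f i = b ≫ U.hom) {b' : W'.left ⟶ U.left}
    (e : k.left ≫ b = b') :
    (D.obj i).res k (s.val i W b hb) = s.val i W' b' (by simp [← e, ← hb]) := by
  subst e
  rw [← D.tr_eq_res, s.tr_val]

/-- The restriction of a section. -/
def Section.res {U V : Over S} (g : V ⟶ U) (s : D.Section U) : D.Section V where
  val i W b hb := s.val i W (b ≫ g.left) (by simp [hb])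
  tr_val b hb c hc := (s.tr_val _ _ c hc).trans (s.val_congr (by simp) _)

/-- The action of the group on the sections. -/
def Section.act {U : Over S} (s : D.Section U) (g : Sec (G.over S) U) : D.Section U where
  val i W b hb := (D.obj i).act (s.val i W b hb) (gres G b g)
  tr_val b hb c hc := by
    refine (D.tr_act c hc _ _).trans ?_
    rw [s.tr_val]
    exact congrArg _ (gres_comp G _ _ _).symm

/-- The section which extends a section of one of the given torsors. -/
def Section.ofSec {i : ι} {W : Over (X i)} {U : Over S} (e : U.left ⟶ W.left)
    (he : U.hom = e ≫ W.hom ≫ f i) (p : (D.obj i).sec W) : D.Section U where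
  val j W' b hb := D.tr (b ≫ e) (by simp [hb, he]) p
  tr_val b hb c hc := by simp [D.tr_tr]

variable (D)

/-- The torsor obtained by descent, with large sets of sections. -/
def glued (hf : Sieve.ofArrows X f ∈ J S) : LargeTorsor (G.over S) where
  sec := D.Section
  res g s := s.res g
  res_id s := Section.ext (by
    funext i W b hb
    exact s.val_congr (by simp) _)
  res_comp g k s := Section.ext (by
    funext i W b hb
    exact s.val_congr (by simp) _)
  act s g := s.act g
  act_one s := Section.ext (by
    funext i W b hb
    exact (congrArg _ (map_one _)).trans ((D.obj i).act_one _))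
  act_mul s g g' := Section.ext (by
    funext i W b hb
    exact (congrArg _ (map_mul _ _ _)).trans ((D.obj i).act_mul _ _ _))
  act_res k s g := Section.ext (by
    funext i W b hb
    exact congrArg _ (gres_comp G _ _ _))
  glue {U} R hR x hx := by
    have hR' := (J.mem_over_iff _).1 hR
    have hmem : ∀ {i : ι} {W : Over (X i)} (b : W.left ⟶ U.left) {W' : Over (X i)} (k : W' ⟶ W),
        (Sieve.overEquiv W).symm ((Sieve.overEquiv U R).pullback b) k ↔
          R (Over.homMk (k.left ≫ b) : Over.mk ((k.left ≫ b) ≫ U.hom) ⟶ U) := fun b W' k => by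
      rw [Sieve.overEquiv_symm_iff, Sieve.pullback_apply, Sieve.overEquiv_iff]
    have hx' : ∀ {V V' : Over S} (g : V ⟶ U) (hg : R g) (g' : V' ⟶ U) (hg' : R g') {i : ι}
        {W : Over (X i)} (b : W.left ⟶ V.left) (hb : W.hom ≫ f i = b ≫ V.hom)
            (b' : W.left ⟶ V'.left)
        (hb' : W.hom ≫ f i = b' ≫ V'.hom) (_ : b ≫ g.left = b' ≫ g'.left),
        (x g hg).val i W b hb = (x g' hg').val i W b' hb' := by
      intro V V' g hg g' hg' i W b hb b' hb' e
      let k : Over.mk (W.hom ≫ f i) ⟶ V := Over.homMk b hb.symm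
      let k' : Over.mk (W.hom ≫ f i) ⟶ V' := Over.homMk b' hb'.symm
      have hk : k ≫ g = k' ≫ g' := by
        ext
        exact e
      have h1 := hx g hg k
      have h2 := hx g' hg' k'
      have h3 : (x (k ≫ g) (R.downward_closed hg k)) =
          (x (k' ≫ g') (R.downward_closed hg' k')) := by
        congr 1
      have h4 := congrArg (fun s : D.Section _ => s.val i W (𝟙 _) (by simp))
        (h1.trans (h3.trans h2.symm))
      refine Eq.trans ?_ (h4.trans ?_)
      · exact (x g hg).val_congr (by simp [k]) _
      · exact (x g' hg').val_congr (by simp [k']) _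
    have key : ∀ (i : ι) (W : Over (X i)) (b : W.left ⟶ U.left) (hb : W.hom ≫ f i = b ≫ U.hom),
        ∃! p : (D.obj i).sec W, ∀ {V : Over S} (g : V ⟶ U) (hg : R g) {W' : Over (X i)}
          (k : W' ⟶ W) (b' : W'.left ⟶ V.left) (hb' : W'.hom ≫ f i = b' ≫ V.hom)
          (_ : k.left ≫ b = b' ≫ g.left),
          (D.obj i).res k p = (x g hg).val i W' b' hb' := by
      intro i W b hb
      obtain ⟨p, hp, hp'⟩ := CrossedGerbe.glue (D.obj i).carrier _
        (J.overEquiv_symm_mem_over W _ (J.pullback_stable b hR'))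
        (fun W' k hk => (x _ ((hmem b k).1 hk)).val i W' (𝟙 _) (by simp [← hb]))
        (fun W' W'' k hk l => ((x _ ((hmem b k).1 hk)).res_val l _ _ rfl).trans
          (hx' _ _ _ _ _ _ _ _ (by simp)))
      refine ⟨p, fun {V} g hg {W'} k b' hb' e => ?_, fun p' h => hp' p' fun W' k hk => ?_⟩
      · refine (hp k ((hmem b k).2 ?_)).trans (hx' _ _ _ _ _ _ _ _ (by simp [e]))
        convert R.downward_closed hg (Over.homMk b' (by simp [reassoc_of% e]) :
            Over.mk ((k.left ≫ b) ≫ U.hom) ⟶ V) using 1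
        ext
        exact e
      · exact h _ ((hmem b k).1 hk) k _ _ (by simp)
    choose p hp hp' using key
    refine ⟨⟨p, fun {i j W W'} b hb c hc => ?_⟩, fun V g hg => Section.ext ?_, fun s hs =>
        Section.ext ?_⟩
    · refine hp' _ _ _ _ _ fun {V} g hg {W''} k b' hb' e => ?_
      let l : Over.mk ((k.left ≫ c) ≫ W.hom) ⟶ W := Over.homMk (k.left ≫ c)
      have h1 : W''.hom ≫ f j = k.left ≫ c ≫ W.hom ≫ f i := by simp [← hc]
      have h2 := hp i W b hb g hg l b' (by simp [← hb', h1]) (by simpa [l] using e)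
      rw [← D.tr_eq_res] at h2
      have h3 := congrArg (D.tr (W := Over.mk ((k.left ≫ c) ≫ W.hom)) (W' := W'') (𝟙 W''.left)
          (by simp [h1])) h2
      rw [D.tr_tr, Section.tr_val] at h3
      rw [← D.tr_eq_res, D.tr_tr]
      refine Eq.trans ?_ (h3.trans ((x g hg).val_congr (by simp) _))
      congr 1
      simp [l]
    · funext i W b hb
      exact ((D.obj i).res_eq_self (𝟙 W) rfl _).symm.trans (hp _ _ _ _ g hg (𝟙 W) b hb (by simp))
    · funext i W b hb
      refine hp' _ _ _ _ _ fun {V} g hg {W'} k b' hb' e => ?_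
      rw [← hs g hg]
      exact s.res_val k _ _ e
  simply_transitive {U} s s' := by
    choose γ hγ hγ' using fun (i : ι) (W : Over (X i)) (b : W.left ⟶ U.left)
      (hb : W.hom ≫ f i = b ≫ U.hom) =>
        (D.obj i).simply_transitive (s.val i W b hb) (s'.val i W b hb)
    have hc : ∀ {i j : ι} {W : Over (X i)} {W' : Over (X j)} (b : W.left ⟶ U.left)
        (hb : W.hom ≫ f i = b ≫ U.hom) (c : W'.left ⟶ W.left) (b' : W'.left ⟶ U.left)
        (hb' : W'.hom ≫ f j = b' ≫ U.hom) (_ : b' = c ≫ b),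
        (gres G c (γ i W b hb) : Sec G W'.left) = γ j W' b' hb' := by
      intro i j W W' b hb c b' hb' e
      subst e
      refine hγ' j W' _ hb' _ ?_
      have h : W'.hom ≫ f j = c ≫ W.hom ≫ f i := by simp [hb', hb]
      refine (congrArg (fun y => (D.obj j).act y _) (s.tr_val b hb c h).symm).trans ?_
      refine (D.tr_act c h _ _).symm.trans ?_
      exact (congrArg _ (hγ i W b hb)).trans (s'.tr_val b hb c h)
    have hU : (Sieve.ofArrows X f).pullback U.hom ∈ J U.left := J.pullback_stable U.hom hf
    have hU' : ∀ {Y : C} (b : Y ⟶ U.left), (Sieve.ofArrows X f).pullback U.hom b →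
        ∃ (i : ι) (a : Y ⟶ X i), a ≫ f i = b ≫ U.hom := by
      intro Y b hb
      obtain ⟨i, a, ha⟩ := (Sieve.mem_ofArrows_iff _ _ _).1 hb
      exact ⟨i, a, ha.symm⟩
    choose i a ha using @hU'
    -- the sections `γ i W b hb` of `G` which carry `s` to `s'` are compatible, hence glue
    obtain ⟨g, hg, hg'⟩ := CrossedGerbe.glue (und G) _ hU
      (fun Y b hb => γ (i b hb) (Over.mk (a b hb)) b (ha b hb))
      (fun Y Z b hb k => hc (W := Over.mk (a b hb)) (W' := Over.mk (a (k ≫ b) _)) b _ k _ _ rfl)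
    refine ⟨g, Section.ext ?_, fun g' h => hg' g' fun Y b hb => ?_⟩
    · funext j W b hb
      have h : (Sieve.ofArrows X f).pullback U.hom b :=
        (Sieve.mem_ofArrows_iff _ _ _).2 ⟨j, W.hom, hb.symm⟩
      have h1 : gres G b g = γ j W b hb := (hg b h).trans
        ((gres_id G _).symm.trans (hc (W := Over.mk (a b h)) (W' := W) b (ha b h) (𝟙 _) b hb
            (by simp)))
      change (D.obj j).act (s.val j W b hb) (gres G b g) = _
      rw [h1]
      exact hγ j W b hb
    · refine hγ' _ (Over.mk (a b hb)) b (ha b hb) _ ?_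
      exact congrArg (fun s : D.Section U => s.val _ (Over.mk (a b hb)) b (ha b hb)) h
  locally_nonempty U := by
    -- over an object `W` of some `C/X i`, a section of `D.obj i` extends to a compatible family
    let T : Sieve U :=
      { arrows := fun V _ => Nonempty (D.Section V)
        downward_closed := fun {V V'} _ h g => h.map (Section.res g) }
    refine ⟨T, (J.over S).transitive (J.overEquiv_symm_mem_over U _ (J.pullback_stable U.hom hf)) T
      fun {V} g hg => ?_, fun V g h => h⟩
    rw [Sieve.overEquiv_symm_iff] at hg
    obtain ⟨i, a, ha⟩ := (Sieve.mem_ofArrows_iff _ _ _).1 hg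
    replace ha : V.hom = a ≫ f i := by simpa using ha
    obtain ⟨R, hR, h⟩ := (D.obj i).locally_nonempty (Over.mk a)
    rw [J.mem_over_iff] at hR ⊢
    refine J.superset_covering ?_ hR
    intro Y k hk
    rw [Sieve.overEquiv_iff] at hk ⊢
    obtain ⟨p⟩ := h _ hk
    exact ⟨Section.ofSec (U := Over.mk (k ≫ V.hom)) (W := Over.mk (k ≫ a)) (𝟙 Y) (by simp [ha]) p⟩

/-- The torsor obtained by descent. -/
noncomputable def descended (hf : Sieve.ofArrows X f ∈ J S) : Torsor (G.over S) :=
  (D.glued hf).shrink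

/-- The identification of the inverse images of the torsor obtained by descent with the given
torsors. -/
noncomputable def descendedHom (hf : Sieve.ofArrows X f ∈ J S) (i : ι) :
    (D.descended hf).pull (f i) ⟶ D.obj i where
  app {W} p := Section.val ((D.glued hf).secEquiv ((Over.map (f i)).obj W) p) i W (𝟙 _) (by simp)
  app_res {W W'} k p := by
    refine (congrArg (fun s : D.Section ((Over.map (f i)).obj W') => s.val i W' (𝟙 _) (by simp))
      ((D.glued hf).secEquiv_res ((Over.map (f i)).map k) p)).trans ?_
    refine Eq.trans ?_ (Section.res_val (D := D) (U := (Over.map (f i)).obj W)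
      ((D.glued hf).secEquiv _ p) k (𝟙 W.left) (by simp) rfl).symm
    exact Section.val_congr (D := D) (U := (Over.map (f i)).obj W) ((D.glued hf).secEquiv _ p)
      ((id_comp k.left).trans (comp_id _).symm) _
  app_act {W} p g := by
    refine (congrArg (fun s : D.Section ((Over.map (f i)).obj W) => s.val i W (𝟙 _) (by simp))
      ((D.glued hf).secEquiv_act (X := (Over.map (f i)).obj W) p g)).trans ?_
    exact congrArg _ (gres_id G (X := W.left) g)

/-- The identifications `descendedHom` transform restriction into the transition maps. -/
theorem tr_descendedHom (hf : Sieve.ofArrows X f ∈ J S) {i j : ι} {W : Over (X i)}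
    {W' : Over (X j)} (c : W'.left ⟶ W.left) (hc : W'.hom ≫ f j = c ≫ W.hom ≫ f i)
    (p : (D.descended hf).sec ((Over.map (f i)).obj W)) :
    D.tr c hc ((D.descendedHom hf i).app (X := W) p) =
      (D.descendedHom hf j).app (X := W') ((D.descended hf).res (Over.homMk c (by simp [hc]) :
        (Over.map (f j)).obj W' ⟶ (Over.map (f i)).obj W) p) := by
  refine (Section.tr_val _ _ _ c hc).trans ?_
  refine Eq.trans ?_ (congrArg (fun s : D.Section ((Over.map (f j)).obj W') =>
    s.val j W' (𝟙 _) (by simp)) ((D.glued hf).secEquiv_res (Over.homMk c (by simp [hc]) :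
      (Over.map (f j)).obj W' ⟶ (Over.map (f i)).obj W) p)).symm
  exact Section.val_congr _ (by simp) _

end TorsorDescent

end

/-! ### The stack of torsors -/

section

variable {C : Type u} [Category.{v} C] {J : GrothendieckTopology C}
  {G : Sheaf J GrpCat.{w}}

/-- The transition maps defined by a descent datum for the fibered category of torsors. -/
def TorsorDescent.ofDescentData {S : C} {ι : Type t} {X : ι → C} {f : ∀ i, X i ⟶ S}
    (D : (TORSC G).DescentData f) : TorsorDescent G f where
  obj i := D.obj i
  tr {i j W W'} c hc p :=
    Torsor.ev (P₁ := D.obj i) (P₂ := D.obj j)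
      (D.hom (W'.hom ≫ f j) (c ≫ W.hom) W'.hom (by simp [hc]) rfl) c (𝟙 W'.left) (by simp)
      (by simp) p
  tr_eq_res {i W W'} g p := by
    have key : ∀ (a : W'.left ⟶ X i) (ha : g.left ≫ W.hom = a) (h : a ≫ f i = W'.hom ≫ f i)
        (h₂ : a = W'.hom),
        Torsor.ev (P₁ := D.obj i) (P₂ := D.obj i) (D.hom (W'.hom ≫ f i) a W'.hom h rfl) g.left
          (𝟙 W'.left) (by simp [ha]) (by simp) p = Torsor.res (D.obj i) g p := by
      rintro a ha h rfl
      rw [D.hom_self _ _ rfl]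
      exact Torsor.ev_id (P₁ := D.obj i) W'.hom g.left (𝟙 _) (by simp) (by simp) p
    exact key _ rfl (by simp) (by simp)
  tr_tr {i j k W W' W''} c hc c' hc' p := by
    let n : Torsor.pull (c' ≫ W'.hom) (D.obj j) ⟶ Torsor.pull W''.hom (D.obj k) :=
      D.hom (W''.hom ≫ f k) (c' ≫ W'.hom) W''.hom (by simp [hc']) rfl
    let m : Torsor.pull (c ≫ W.hom) (D.obj i) ⟶ Torsor.pull W'.hom (D.obj j) :=
      D.hom (W'.hom ≫ f j) (c ≫ W.hom) W'.hom (by simp [hc]) rfl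
    let l : Torsor.pull ((c' ≫ c) ≫ W.hom) (D.obj i) ⟶ Torsor.pull (c' ≫ W'.hom) (D.obj j) :=
      D.hom (W''.hom ≫ f k) ((c' ≫ c) ≫ W.hom) (c' ≫ W'.hom) (by simp [hc, hc']) (by simp [hc'])
    have hl : pullHom (F := TORSC G) m c' _ _ (by simp) rfl = l :=
      D.pullHom_hom c' _ _ (by simp [hc']) _ _ (by simp [hc]) rfl _ _ (by simp) rfl
    have hln : l ≫ n = D.hom (W''.hom ≫ f k) ((c' ≫ c) ≫ W.hom) W''.hom (by simp [hc, hc']) rfl :=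
      D.hom_comp _ _ _ _ _ _ _
    have h1 := Torsor.ev_res n (𝟙 W''.left) (𝟙 W''.left) (V₁ := Over.mk (c' ≫ W'.hom))
      (V₂ := W'') (by simp) (by simp) (Over.homMk c' : Over.mk (c' ≫ W'.hom) ⟶ W')
      (Torsor.ev m c (𝟙 W'.left) (by simp) (by simp) p) (c' := c') (by simp)
    refine h1.symm.trans ?_
    have h2 := Torsor.res_ev m c (𝟙 W'.left) (by simp) (by simp)
      (Over.homMk c' : Over.mk (c' ≫ W'.hom) ⟶ W') p (c' := c' ≫ c) (b' := 𝟙 _ ≫ c') (by simp)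
          (by simp)
    have h3 := Torsor.ev_pullHom m (c' ≫ c) c' ((c' ≫ c) ≫ W.hom) (c' ≫ W'.hom) (by simp) rfl
      (V₁ := W) (V₂ := Over.mk (c' ≫ W'.hom)) (𝟙 _) (by simp) (by simp) p
    rw [h2]
    refine (congrArg _ h3.symm).trans ?_
    rw [hl]
    refine (Torsor.ev_ev l (V₁ := W) (V₂ := Over.mk (c' ≫ W'.hom)) (c' ≫ c) (𝟙 _) (by simp)
      (by simp) n (V₃ := W'') (𝟙 _) p (c' := c' ≫ c) (b' := 𝟙 _) (by simp) (by simp)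
      (by simp)).trans ?_
    rw [hln]
    rfl
  tr_act {i j W W'} c hc p g := Torsor.ev_act (P₁ := D.obj i) (P₂ := D.obj j) _ _ _ _ _ p g

/-- The torsor obtained by descent solves the descent problem. -/
theorem TorsorDescent.descendedHom_comm {S : C} {ι : Type t} {X : ι → C} {f : ∀ i, X i ⟶ S}
    (D : (TORSC G).DescentData f) (hf : Sieve.ofArrows X f ∈ J S) {Y : C} (q : Y ⟶ S) {i₁ i₂ : ι}
    (f₁ : Y ⟶ X i₁) (f₂ : Y ⟶ X i₂) (hf₁ : f₁ ≫ f i₁ = q) (hf₂ : f₂ ≫ f i₂ = q) :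
    ((TORSC G).map f₁.op.toLoc).toFunctor.map ((ofDescentData D).descendedHom hf i₁) ≫
        D.hom q f₁ f₂ hf₁ hf₂ =
      (Pseudofunctor.DescentData.ofObj ((ofDescentData D).descended hf)).hom q f₁ f₂ hf₁ hf₂ ≫
        ((TORSC G).map f₂.op.toLoc).toFunctor.map ((ofDescentData D).descendedHom hf i₂) := by
  obtain rfl : q = f₂ ≫ f i₂ := hf₂.symm
  let T := ofDescentData D
  refine Torsor.hom_ext fun {U} p => ?_
  let E := T.descended hf
  let m : Torsor.pull f₁ (D.obj i₁) ⟶ Torsor.pull f₂ (D.obj i₂) :=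
    D.hom (f₂ ≫ f i₂) f₁ f₂ hf₁ rfl
  let e₁ := T.descendedHom hf i₁
  let e₂ := T.descendedHom hf i₂
  let W₁ : Over (X i₁) := (Over.map f₁).obj U
  let W₂ : Over (X i₂) := (Over.map f₂).obj U
  have hW : W₂.hom ≫ f i₂ = 𝟙 U.left ≫ W₁.hom ≫ f i₁ := by simp [W₁, W₂, hf₁]
  have h1 : m.app (X := U) (e₁.app (X := W₁) p) =
      T.tr (i := i₁) (j := i₂) (W := W₁) (W' := W₂) (𝟙 U.left) hW (e₁.app (X := W₁) p) := by
    refine (Torsor.app_eq_ev m _).trans ?_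
    have hl : pullHom (F := TORSC G) m U.hom (𝟙 U.left ≫ W₁.hom) W₂.hom (by simp [W₁]) rfl =
        D.hom (W₂.hom ≫ f i₂) (𝟙 U.left ≫ W₁.hom) W₂.hom ((assoc _ _ _).trans hW.symm) rfl :=
      D.pullHom_hom U.hom _ _ (by simp [W₂]) _ _ hf₁ rfl _ _ (by simp [W₁]) rfl
    have h3 := Torsor.ev_pullHom m (V₁ := W₁) (V₂ := W₂) (𝟙 U.left) U.hom (𝟙 U.left ≫ W₁.hom) W₂.hom
      (by simp [W₁]) rfl (𝟙 U.left) (id_comp _) (id_comp _) (e₁.app (X := W₁) p)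
    rw [hl] at h3
    refine Eq.trans ?_ h3.symm
    congr 1
    exact (id_comp _).symm
  have h2 := T.tr_descendedHom hf (i := i₁) (j := i₂) (W := W₁) (W' := W₂) (𝟙 U.left) hW p
  refine h1.trans (h2.trans ?_)
  refine congrArg (fun x => e₂.app (X := W₂) x) ?_
  refine Eq.trans ?_ (TORSC_mapComp'_hom_app (f i₂) f₂ _ rfl E _).symm
  refine Eq.trans ?_ (congrArg (fun x => E.res _ x)
      (TORSC_mapComp'_inv_app (f i₁) f₁ (f₂ ≫ f i₂) (by rw [← hf₁]; rfl) E _)).symm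
  exact (E.res_comp _ _ _ (by simp) _).symm

/-- Descent data for torsors are effective: `TORSC G` is a stack. -/
theorem TORSC_isStack (G : Sheaf J GrpCat.{w}) : (TORSC G).IsStack J where
  isSheaf := (TORSC_isPrestack G).isSheaf
  essSurj_of_sieve {S} R hR := by
    have hR' : Sieve.ofArrows _ (fun f : R.arrows.category => f.obj.hom) ∈ J S := by
      rwa [Sieve.ofArrows_category', Sieve.generate_sieve]
    exact ⟨fun D => ⟨_, ⟨Pseudofunctor.DescentData.isoMk
      (fun i => Torsor.isoOfHom ((TorsorDescent.ofDescentData D).descendedHom hR' i))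
      (fun _ q _ _ f₁ f₂ hf₁ hf₂ =>
        TorsorDescent.descendedHom_comm D hR' q f₁ f₂ hf₁ hf₂)⟩⟩⟩

end

/-! ### The stack of liftings -/

section

variable {C : Type u} [Category.{v} C] {J : GrothendieckTopology C}
  {G H : Sheaf J GrpCat.{w}} {h : G ⟶ H} {P : Torsor H}

/-- A morphism of torsors which underlies a morphism of liftings respects the maps to `P`. -/
theorem Lifting.lam_ev {X₁ X₂ Y : C} {L₁ : Lifting.Fiber h P X₁} {L₂ : Lifting.Fiber h P X₂}
    {f₁ : Y ⟶ X₁} {f₂ : Y ⟶ X₂} (m : L₁.pull f₁ ⟶ L₂.pull f₂) {V₁ : Over X₁} {V₂ : Over X₂}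
    (c : V₂.left ⟶ V₁.left) (b : V₂.left ⟶ Y) (h₁ : b ≫ f₁ = c ≫ V₁.hom) (h₂ : b ≫ f₂ = V₂.hom)
    (p : L₁.torsor.sec V₁) :
    L₂.lam.app (Torsor.ev m.hom c b h₁ h₂ p) = P.res c (L₁.lam.app p) := by
  refine (L₂.lam.app_res _ _).trans ?_
  refine (sres_id P.carrier (X := V₂.left) _).trans ?_
  refine (m.lam_app (X := Over.mk b) _).trans ?_
  exact L₁.lam.app_res _ p

/-- The morphisms of liftings are the sections of a subsheaf of the sheaf of morphisms of torsors,
because compatibility with the maps to `P` is a local condition. -/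
theorem liftings_isPrestack (h : G ⟶ H) (P : Torsor H) : (liftings h P).IsPrestack J where
  isSheaf {S} L M := by
    rw [isSheaf_iff_isSheaf_of_type]
    intro U R hR x hx
    rw [Presieve.compatible_iff_sieveCompatible] at hx
    let x' : ∀ {V : Over S} (g : V ⟶ U), R g → (Lifting.pull V.hom L ⟶ Lifting.pull V.hom M) :=
      fun {V} g hg => x g hg
    obtain ⟨m, hm, hm'⟩ := Torsor.existsUnique_hom L.torsor M.torsor U R hR
      (fun {V} g hg => Lifting.Hom.hom (x' g hg)) (fun {V Z} g hg k =>
        (liftings_pullHom L M (x' g hg) k.left Z.hom Z.hom (Over.w k) (Over.w k)).symm.trans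
          (congrArg Lifting.Hom.hom (hx g k hg).symm))
    have hlam : ∀ {W : Over U.left} (p : L.torsor.sec ((Over.map U.hom).obj W)),
        M.lam.app (m.app (X := W) p) = L.lam.app p := by
      intro W p
      have hR' := (J.mem_over_iff _).1 ((J.over S).pullback_stable
        (Over.homMk W.hom : (Over.map U.hom).obj W ⟶ U) hR)
      refine sres_eq_of_cover P.carrier _ hR' _ _ fun Y k hk => ?_
      rw [Sieve.overEquiv_iff] at hk
      let l : Over.mk (k ≫ W.hom ≫ U.hom) ⟶ (Over.map U.hom).obj W := Over.homMk k
      have h1 := Torsor.res_ev m (V₁ := (Over.map U.hom).obj W) (V₂ := (Over.map U.hom).obj W)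
        (𝟙 W.left) W.hom (by simp) (by simp) l p (c' := k) (b' := k ≫ W.hom) (by simp [l])
            (by simp [l])
      rw [← Torsor.app_eq_ev m p] at h1
      have h2 := Torsor.ev_pullHom m (V₁ := (Over.map U.hom).obj W)
        (V₂ := Over.mk (k ≫ W.hom ≫ U.hom)) k (k ≫ W.hom) _ _ (assoc _ _ _) (assoc _ _ _) (𝟙 Y)
        (by simp) (by simp) p
      have h3 := Lifting.lam_ev (x' _ hk) (V₁ := (Over.map U.hom).obj W)
        (V₂ := Over.mk (k ≫ W.hom ≫ U.hom)) k (𝟙 Y) (by simp) (by simp) p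
      rw [← hm _ hk] at h3
      refine (M.lam.app_res l _).symm.trans (Eq.trans ?_ h3)
      refine congrArg M.lam.app (h1.trans (Eq.trans ?_ h2.symm))
      congr 1
      exact (id_comp _).symm
    refine ⟨(⟨m, hlam⟩ : L.pull U.hom ⟶ M.pull U.hom), fun {V} g hg => ?_, fun m' h' => ?_⟩
    · exact Lifting.hom_ext ((liftings_pullHom L M _ _ _ _ _ _).trans (hm g hg))
    · refine Lifting.hom_ext (hm' _ fun {V} g hg => ?_)
      exact (liftings_pullHom L M m' g.left V.hom V.hom (Over.w g) (Over.w g)).symm.trans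
          (congrArg Lifting.Hom.hom (h' g hg))

/-- The descent datum for torsors which underlies a descent datum for liftings. -/
def forgetDescentData {S : C} {ι : Type t} {X : ι → C} {f : ∀ i, X i ⟶ S}
    (D : (liftings h P).DescentData f) : (TORSC G).DescentData f where
  obj i := (show Lifting.Fiber h P (X i) from D.obj i).torsor
  hom _ q _ _ f₁ f₂ hf₁ hf₂ := Lifting.Hom.hom (D.hom q f₁ f₂ hf₁ hf₂)
  pullHom_hom _ _ g q q' hq i₁ i₂ f₁ f₂ hf₁ hf₂ gf₁ gf₂ hgf₁ hgf₂ :=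
    (liftings_pullHom (D.obj i₁) (D.obj i₂) (D.hom q f₁ f₂ hf₁ hf₂) g gf₁ gf₂ hgf₁ hgf₂).symm.trans
      (congrArg Lifting.Hom.hom (D.pullHom_hom g q q' hq f₁ f₂ hf₁ hf₂ gf₁ gf₂ hgf₁ hgf₂))
  hom_self _ q _ g hg := congrArg Lifting.Hom.hom (D.hom_self q g hg)
  hom_comp _ q _ _ _ f₁ f₂ f₃ hf₁ hf₂ hf₃ :=
    congrArg Lifting.Hom.hom (D.hom_comp q f₁ f₂ f₃ hf₁ hf₂ hf₃)

section

variable {S : C} {ι : Type t} {X : ι → C} {f : ∀ i, X i ⟶ S} (D : (liftings h P).DescentData f)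
  (hf : Sieve.ofArrows X f ∈ J S)

/-- The torsor obtained by descent from a descent datum for liftings. -/
noncomputable abbrev descendedTorsor : Torsor (G.over S) :=
  (TorsorDescent.ofDescentData (forgetDescentData D)).descended hf

/-- The restrictions of the torsor obtained by descent. -/
noncomputable abbrev descendedTorsorHom (i : ι) :
    (descendedTorsor D hf).pull (f i) ⟶ (show Lifting.Fiber h P (X i) from D.obj i).torsor :=
  (TorsorDescent.ofDescentData (forgetDescentData D)).descendedHom hf i

/-- The member over `W` of the family which defines the map to `P` on the torsor obtained by
descent. -/
noncomputable def descendedLamAux {U : Over S} (s : (descendedTorsor D hf).sec U) {i : ι}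
    {W : Over (X i)}
    (b : W.left ⟶ U.left) (hb : W.hom ≫ f i = b ≫ U.hom) : P.sec W.left :=
  (show Lifting.Fiber h P (X i) from D.obj i).lam.app ((descendedTorsorHom D hf i).app (X := W)
    ((descendedTorsor D hf).res (Over.homMk b (by simp [hb]) : (Over.map (f i)).obj W ⟶ U) s))

theorem descendedLamAux_res {U : Over S} (s : (descendedTorsor D hf).sec U) {i j : ι}
    {W : Over (X i)}
    (b : W.left ⟶ U.left) (hb : W.hom ≫ f i = b ≫ U.hom) {W' : Over (X j)} (c : W'.left ⟶ W.left)
    (b' : W'.left ⟶ U.left) (hb' : W'.hom ≫ f j = b' ≫ U.hom) (e : c ≫ b = b') :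
    P.res c (descendedLamAux D hf s b hb) = descendedLamAux D hf s b' hb' := by
  subst e
  have hc : W'.hom ≫ f j = c ≫ W.hom ≫ f i := by simp [hb', hb]
  have h1 := (TorsorDescent.ofDescentData (forgetDescentData D)).tr_descendedHom hf c hc
    ((descendedTorsor D hf).res (Over.homMk b (by simp [hb]) : (Over.map (f i)).obj W ⟶ U) s)
  refine (Lifting.lam_ev (L₁ := D.obj i) (L₂ := D.obj j) (V₁ := W) (V₂ := W')
      (D.hom (W'.hom ≫ f j) (c ≫ W.hom) W'.hom
    (by simp [hc]) rfl) c (𝟙 W'.left) (by simp) (by simp) _).symm.trans ?_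
  refine congrArg (fun x => (show Lifting.Fiber h P (X j) from D.obj j).lam.app x) (h1.trans ?_)
  exact congrArg (fun x => (descendedTorsorHom D hf j).app (X := W') x)
    ((descendedTorsor D hf).res_comp _ _ _ rfl s)

theorem exists_descendedLam {U : Over S} (s : (descendedTorsor D hf).sec U) :
    ∃! t : P.sec U.left, ∀ {i : ι} {W : Over (X i)} (b : W.left ⟶ U.left)
      (hb : W.hom ≫ f i = b ≫ U.hom), P.res b t = descendedLamAux D hf s b hb := by
  have hU : (Sieve.ofArrows X f).pullback U.hom ∈ J U.left := J.pullback_stable U.hom hf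
  have hU' : ∀ {Y : C} (b : Y ⟶ U.left), (Sieve.ofArrows X f).pullback U.hom b →
      ∃ (i : ι) (a : Y ⟶ X i), a ≫ f i = b ≫ U.hom := by
    intro Y b hb
    obtain ⟨i, a, ha⟩ := (Sieve.mem_ofArrows_iff _ _ _).1 hb
    exact ⟨i, a, ha.symm⟩
  choose i a ha using @hU'
  obtain ⟨t, ht, ht'⟩ := CrossedGerbe.glue P.carrier _ hU
    (fun Y b hb => descendedLamAux D hf s (W := Over.mk (a b hb)) b (ha b hb))
    (fun Y Z b hb k => descendedLamAux_res D hf s (W := Over.mk (a b hb))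
        (W' := Over.mk (a (k ≫ b) _))
      b (ha b hb) k (k ≫ b) (ha _ _) rfl)
  refine ⟨t, fun {j W} b hb => ?_, fun t' h => ht' t' fun Y b hb => h (W := Over.mk (a b hb)) b
      (ha b hb)⟩
  have hb' : (Sieve.ofArrows X f).pullback U.hom b :=
    (Sieve.mem_ofArrows_iff _ _ _).2 ⟨j, W.hom, hb.symm⟩
  exact (ht b hb').trans ((sres_id P.carrier _).symm.trans (descendedLamAux_res D hf s
    (W := Over.mk (a b hb')) b (ha b hb') (W' := W) (𝟙 _) b hb (by simp)))

/-- The map to `P` on the torsor obtained by descent. -/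
noncomputable def descendedLam {U : Over S} (s : (descendedTorsor D hf).sec U) : P.sec U.left :=
  (exists_descendedLam D hf s).choose

theorem res_descendedLam {U : Over S} (s : (descendedTorsor D hf).sec U) {i : ι} {W : Over (X i)}
    (b : W.left ⟶ U.left)
      (hb : W.hom ≫ f i = b ≫ U.hom) :
    P.res b (descendedLam D hf s) = descendedLamAux D hf s b hb :=
  (exists_descendedLam D hf s).choose_spec.1 b hb

theorem eq_descendedLam {U : Over S} (s : (descendedTorsor D hf).sec U) (t : P.sec U.left)
    (ht : ∀ {i : ι} {W : Over (X i)} (b : W.left ⟶ U.left)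
      (hb : W.hom ≫ f i = b ≫ U.hom), P.res b t = descendedLamAux D hf s b hb) :
    descendedLam D hf s = t :=
  ((exists_descendedLam D hf s).choose_spec.2 t ht).symm

/-- The lifting obtained by descent. -/
noncomputable def descendedLifting : Lifting.Fiber h P S where
  torsor := descendedTorsor D hf
  lam :=
    { app := fun {U} s => descendedLam D hf s
      app_res := fun {U V} g s => eq_descendedLam D hf _ _ fun {i W} b hb => by
        refine (sres_comp P.carrier g.left b _).symm.trans
          ((res_descendedLam D hf s (b ≫ g.left) (by simp [hb])).trans ?_)
        refine congrArg (fun x => (show Lifting.Fiber h P (X i) from D.obj i).lam.app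
          ((descendedTorsorHom D hf i).app (X := W) x)) ?_
        exact ((descendedTorsor D hf).res_comp _ _ _ rfl s).symm
      app_act := fun {U} s g => eq_descendedLam D hf _ _ fun {i W} b hb => by
        refine (P.act_res b _ _).trans ?_
        refine (congrArg (fun x => P.act x _) (res_descendedLam D hf s b hb)).trans ?_
        unfold descendedLamAux
        refine Eq.trans ?_ (congrArg (fun x => (show Lifting.Fiber h P (X i) from D.obj i).lam.app
          ((descendedTorsorHom D hf i).app (X := W) x)) ((descendedTorsor D hf).act_res _ s g)).symm
        refine Eq.trans ?_ (congrArg (fun x => (show Lifting.Fiber h P (X i) from D.obj i).lam.app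
          x) ((descendedTorsorHom D hf i).app_act (X := W) _ _)).symm
        refine Eq.trans ?_ ((show Lifting.Fiber h P (X i) from D.obj i).lam.app_act _ _).symm
        exact congrArg (P.act (X := W.left) _) (gapp_res h b g).symm }

theorem lam_descendedTorsorHom {i : ι} {W : Over (X i)}
    (s : (descendedTorsor D hf).sec ((Over.map (f i)).obj W)) :
    (show Lifting.Fiber h P (X i) from D.obj i).lam.app
        ((descendedTorsorHom D hf i).app (X := W) s) =
      descendedLam D hf s := by
  have h1 := res_descendedLam D hf s (W := W) (𝟙 W.left) (by simp)
  refine Eq.trans ?_ (h1.symm.trans (sres_id P.carrier (X := W.left) _))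
  refine congrArg (fun x => (show Lifting.Fiber h P (X i) from D.obj i).lam.app
          ((descendedTorsorHom D hf i).app (X := W) x)) ?_
  exact ((descendedTorsor D hf).res_eq_self (U := (Over.map (f i)).obj W) _ rfl s).symm

end

/-- Descent data for liftings are effective: the underlying torsors descend, and the maps to `P`,
being sections of the sheaf `P`, glue. -/
theorem liftings_isStack (h : G ⟶ H) (P : Torsor H) : (liftings h P).IsStack J where
  isSheaf := (liftings_isPrestack h P).isSheaf
  essSurj_of_sieve {S} R hR := by
    have hR' : Sieve.ofArrows _ (fun f : R.arrows.category => f.obj.hom) ∈ J S := by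
      rwa [Sieve.ofArrows_category', Sieve.generate_sieve]
    refine ⟨fun D => ⟨descendedLifting D hR', ⟨Pseudofunctor.DescentData.isoMk
      (fun i => Lifting.isoMk (L := (descendedLifting D hR').pull i.obj.hom) (M := D.obj i)
        (Torsor.isoOfHom (descendedTorsorHom D hR' i)) fun s => lam_descendedTorsorHom D hR' s)
      (fun Y q i₁ i₂ f₁ f₂ hf₁ hf₂ => Lifting.hom_ext ?_)⟩⟩⟩
    refine (TorsorDescent.descendedHom_comm (forgetDescentData D) hR' q f₁ f₂ hf₁ hf₂).trans ?_
    unfold Pseudofunctor.DescentData.ofObj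
    dsimp only
    have h1 := liftings_mapComp'_inv (i₁.obj.hom) f₁ q (by rw [← hf₁]; rfl) (descendedLifting D hR')
    have h2 := liftings_mapComp'_hom (i₂.obj.hom) f₂ q (by rw [← hf₂]; rfl) (descendedLifting D hR')
    refine Eq.trans (congrArg₂ (fun a b => (a ≫ b) ≫ _) h1.symm h2.symm) ?_
    rfl

end

/-! ### The gerbes of torsors and of liftings -/

section

variable {D : Type u} [Category.{v} D] {K : GrothendieckTopology D} {G : Sheaf K GrpCat.{w}}

/-- The trivial torsor: the group acting on itself by right translations. -/
def trivialTorsor (G : Sheaf K GrpCat.{w}) : Torsor G where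
  carrier := und G
  act := fun {X} (p g : Sec G X) => p * g
  act_one := fun {X} (p : Sec G X) => mul_one p
  act_mul := fun {X} (p g g' : Sec G X) => (mul_assoc p g g').symm
  act_res := fun {X _} f (p g : Sec G X) => map_mul (gres G f) p g
  simply_transitive := fun {X} (p p' : Sec G X) =>
    ⟨p⁻¹ * p', mul_inv_cancel_left p p', fun _ hg => eq_inv_mul_of_mul_eq hg⟩
  locally_nonempty X := ⟨⊤, K.top_mem X, fun Y _ _ => ⟨(1 : Sec G Y)⟩⟩

/-- Two torsors with a global section are isomorphic, by an isomorphism which maps one section to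
the other. -/
theorem Torsor.exists_hom_of_sections {P Q : Torsor G} (s : ∀ X : D, P.sec X)
    (hs : ∀ {X Y : D} (f : Y ⟶ X), P.res f (s X) = s Y) (t : ∀ X : D, Q.sec X)
    (ht : ∀ {X Y : D} (f : Y ⟶ X), Q.res f (t X) = t Y) :
    ∃ m : P ⟶ Q, ∀ X : D, Hom.app m (s X) = t X := by
  choose γ hγ hγ' using fun (X : D) (p : P.sec X) => P.simply_transitive (s X) p
  refine ⟨⟨fun {X} p => Q.act (t X) (γ X p), fun {X Y} f p => ?_, fun {X} p g => ?_⟩, fun X => ?_⟩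
  · refine Eq.trans ?_ (Q.act_res f _ _).symm
    refine congrArg₂ Q.act (ht f).symm (hγ' Y _ _ ?_).symm
    dsimp only
    rw [← hs f, ← P.act_res, hγ]
  · rw [← Q.act_mul]
    congr 1
    refine (hγ' X _ _ ?_).symm
    dsimp only
    rw [P.act_mul, hγ]
  · dsimp only
    rw [← hγ' X (s X) 1 (P.act_one _), Q.act_one]

end

section

variable {C : Type u} [Category.{v} C] {J : GrothendieckTopology C}

/-- Sections over `f : T ⟶ S` of two torsors on `C/S` define a morphism between their inverse
images along `f`. -/
theorem Torsor.exists_pull_hom {G : Sheaf J GrpCat.{w}} {S T : C} (f : T ⟶ S)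
    (P Q : Torsor (G.over S)) (p : P.sec (Over.mk f)) (q : Q.sec (Over.mk f)) :
    ∃ m : P.pull f ⟶ Q.pull f, ∀ U : Over T,
      m.app (X := U) (P.res (Over.homMk U.hom : (Over.map f).obj U ⟶ Over.mk f) p) =
        Q.res (Over.homMk U.hom : (Over.map f).obj U ⟶ Over.mk f) q :=
  Torsor.exists_hom_of_sections (P := P.pull f) (Q := Q.pull f)
    (fun U => P.res (Over.homMk U.hom : (Over.map f).obj U ⟶ Over.mk f) p)
    (fun g => P.res_comp _ ((Over.map f).map g) _ (by simp) p)
    (fun U => Q.res (Over.homMk U.hom : (Over.map f).obj U ⟶ Over.mk f) q)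
    (fun g => Q.res_comp _ ((Over.map f).map g) _ (by simp) q)

theorem TORSC_isGerbe (G : Sheaf J GrpCat.{w}) : IsGerbe (TORSC G) J where
  isStack := TORSC_isStack G
  isIso {S x y} m := (Torsor.isoOfHom (G := G.over S) (P := x) (Q := y) m).isIso_hom
  locally_nonempty S := ⟨⊤, J.top_mem S, fun T _ _ => ⟨trivialTorsor (G.over T)⟩⟩
  locally_iso {S} P Q := by
    obtain ⟨R, hR, hP⟩ := Torsor.locally_nonempty (G := G.over S) P (Over.mk (𝟙 S))
    obtain ⟨R', hR', hQ⟩ := Torsor.locally_nonempty (G := G.over S) Q (Over.mk (𝟙 S))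
    refine ⟨_, (J.mem_over_iff _).1 ((J.over S).intersection_covering hR hR'), fun T f hf => ?_⟩
    rw [Sieve.overEquiv_iff] at hf
    obtain ⟨p⟩ := hP _ hf.1
    obtain ⟨q⟩ := hQ _ hf.2
    let l : Over.mk f ⟶ Over.mk (f ≫ 𝟙 S) := Over.homMk (𝟙 T)
    obtain ⟨m, -⟩ := Torsor.exists_pull_hom f P Q (Torsor.res P l p) (Torsor.res Q l q)
    exact ⟨Torsor.isoOfHom m⟩

variable {G H : Sheaf J GrpCat.{w}} {h : G ⟶ H} {P : Torsor H}

/-- The trivial lifting defined by a section of `P`. -/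
def trivialLifting (h : G ⟶ H) {S : C} (p : P.sec S) : Lifting.Fiber h P S where
  torsor := trivialTorsor (G.over S)
  lam :=
    { app := fun {U} (g : Sec G U.left) => P.act (P.res U.hom p) (gapp h U.left g)
      app_res := fun {U V} k (g : Sec G U.left) => by
        refine Eq.trans ?_ (P.act_res k.left _ _).symm
        refine congrArg₂ P.act ?_ (gapp_res h k.left g)
        exact (congrArg (P.res · p) (Over.w k).symm).trans (sres_comp P.carrier U.hom k.left p)
      app_act := fun {U} (g g' : Sec G U.left) =>
          (congrArg _ (map_mul (gapp h U.left) g g')).trans (P.act_mul _ _ _) }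

/-- Two liftings are locally isomorphic when they locally have sections with the same image in `P`.
Such sections exist since `H` acts transitively on `P` and every section of `H` locally comes from
`G`. -/
theorem liftings_isGerbe (h : G ⟶ H) (P : Torsor H)
    (hs : ∀ {U : C} (c : Sec H U), ∃ R ∈ J U, ∀ ⦃V : C⦄ (g : V ⟶ U), R g →
      ∃ a : Sec G V, gapp h V a = gres H g c) : IsGerbe (liftings h P) J where
  isStack := liftings_isStack h P
  isIso {S L M} m := (Lifting.isoMk (h := homOver h S) (P := P.localize S) (L := L) (M := M)
    (Torsor.isoOfHom (Lifting.Hom.hom m)) (Lifting.Hom.lam_app m)).isIso_hom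
  locally_nonempty S := by
    obtain ⟨R, hR, hP⟩ := P.locally_nonempty S
    exact ⟨R, hR, fun T f hf => (hP f hf).map (trivialLifting h)⟩
  locally_iso {S} L M := by
    let L' : Lifting.Fiber h P S := L
    let M' : Lifting.Fiber h P S := M
    let R₀ : Sieve S :=
      { arrows := fun T f => ∃ (p : L'.torsor.sec (Over.mk f)) (q : M'.torsor.sec (Over.mk f)),
          L'.lam.app p = M'.lam.app q
        downward_closed := by
          rintro T V f ⟨p, q, e⟩ g
          let k : Over.mk (g ≫ f) ⟶ Over.mk f := Over.homMk g
          refine ⟨L'.torsor.res k p, M'.torsor.res k q, ?_⟩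
          rw [L'.lam.app_res, M'.lam.app_res, e] }
    refine ⟨R₀, ?_, fun T f hf => ?_⟩
    · obtain ⟨R, hR, hP⟩ := L'.torsor.locally_nonempty (Over.mk (𝟙 S))
      obtain ⟨R', hR', hQ⟩ := M'.torsor.locally_nonempty (Over.mk (𝟙 S))
      refine J.transitive ((J.mem_over_iff _).1 ((J.over S).intersection_covering hR hR')) R₀
        fun T f hf => ?_
      rw [Sieve.overEquiv_iff] at hf
      obtain ⟨p⟩ := hP _ hf.1
      obtain ⟨q⟩ := hQ _ hf.2
      -- the images of the two sections in `P` differ by a section of `H`, which locally comes from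
      -- `G`
      obtain ⟨c, hc, -⟩ := P.simply_transitive (X := T) (L'.lam.app p) (M'.lam.app q)
      obtain ⟨R₁, hR₁, h₁⟩ := hs c
      refine J.superset_covering (fun V g hg => ?_) hR₁
      obtain ⟨a, ha⟩ := h₁ g hg
      let k : Over.mk (g ≫ f) ⟶ Over.mk (f ≫ 𝟙 S) := Over.homMk g
      refine ⟨L'.torsor.act (L'.torsor.res k p) a, M'.torsor.res k q, ?_⟩
      refine (L'.lam.app_act (X := Over.mk (g ≫ f)) _ a).trans ?_
      rw [L'.lam.app_res, M'.lam.app_res, ← hc]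
      refine Eq.trans ?_ (P.act_res g _ _).symm
      exact congrArg (P.act (X := V) _) ha
    · obtain ⟨p, q, e⟩ := hf
      obtain ⟨m, hm⟩ := Torsor.exists_pull_hom f L'.torsor M'.torsor p q
      refine ⟨Lifting.isoMk (L := L'.pull f) (M := M'.pull f) (Torsor.isoOfHom m) fun {U} x => ?_⟩
      let k : (Over.map f).obj U ⟶ Over.mk f := Over.homMk U.hom
      obtain ⟨g, rfl, -⟩ := L'.torsor.simply_transitive (L'.torsor.res k p) x
      refine (congrArg (fun x => M'.lam.app x) ((m.app_act (X := U) _ g).trans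
        (congrArg (fun y => M'.torsor.act y g) (hm U)))).trans ?_
      refine (M'.lam.app_act _ _).trans (Eq.trans ?_ (L'.lam.app_act _ _).symm)
      refine congrArg (fun y => (P.localize S).act y _) ?_
      rw [L'.lam.app_res, M'.lam.app_res, e]

end

/-! ### Automorphisms defined by sections of the contracted product -/

section

variable {D : Type u} [Category.{v} D] {K : GrothendieckTopology D} {A A' Pi : Sheaf K GrpCat.{w}}

/-- `f : A ⟶ A'` is a morphism of sheaves of crossed groups over the identity of `Π`. -/
structure IsCrossedHom (Φ : CrossedGroup A Pi) (Φ' : CrossedGroup A' Pi) (f : A ⟶ A') : Prop where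
  ρ_map : ∀ {U : D} (a : Sec A U), gapp Φ'.ρ U (gapp f U a) = gapp Φ.ρ U a
  map_smul : ∀ {U : D} (α : Sec Pi U) (a : Sec A U),
    gapp f U (Φ.action.smul α a) = Φ'.action.smul α (gapp f U a)

theorem IsCrossedHom.id (Φ : CrossedGroup A Pi) : IsCrossedHom Φ Φ (𝟙 A) where
  ρ_map _ := rfl
  map_smul _ _ := rfl

variable [HasSheafify K (Type w)] [K.WEqualsLocallyBijective (Type w)]
  (Φ : CrossedGroup A Pi) (Φ' : CrossedGroup A' Pi)

namespace contr

variable {Q : Torsor A'} {U : D}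

/-- The section `[[q, 1], a]` of `(Q ∧^{A'} Π) ∧^Π A`. -/
noncomputable def dmk (q : Q.sec U) (a : Sec A U) : CSec (ext Φ'.ρ Q) Φ.action U :=
  contr.mk (Q := ext Φ'.ρ Q) Φ.action (ext.mk Φ'.ρ q 1) a

/-- The unique `a` such that `z = [[q, 1], a]`. -/
noncomputable def coord (z : CSec (ext Φ'.ρ Q) Φ.action U) (q : Q.sec U) : Sec A U :=
  contr.rep Φ.action z (ext.mk Φ'.ρ q 1 : (ext Φ'.ρ Q).sec U)

variable {Φ Φ'}

theorem dmk_coord (z : CSec (ext Φ'.ρ Q) Φ.action U) (q : Q.sec U) :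
    dmk Φ Φ' q (coord Φ Φ' z q) = z :=
  contr.mk_rep ..

theorem coord_dmk (q : Q.sec U) (a : Sec A U) : coord Φ Φ' (dmk Φ Φ' q a) q = a :=
  contr.rep_mk ..

theorem dmk_res {V : D} (k : V ⟶ U) (q : Q.sec U) (a : Sec A U) :
    sres _ k (dmk Φ Φ' q a) = dmk Φ Φ' (Q.res k q) (gres A k a) := by
  refine (contr.mk_res (Q := ext Φ'.ρ Q) Φ.action k _ _).trans ?_
  rw [ext.mk_res, map_one]
  rfl

theorem coord_res {V : D} (k : V ⟶ U) (z : CSec (ext Φ'.ρ Q) Φ.action U) (q : Q.sec U) :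
    coord Φ Φ' (sres _ k z) (Q.res k q) = gres A k (coord Φ Φ' z q) := by
  conv_lhs => rw [← dmk_coord z q, dmk_res, coord_dmk]

/-- Changing `α` in `[[q, α], a]` amounts to letting it act on `a`. -/
theorem mk_extMk (q : Q.sec U) (α : Sec Pi U) (a : Sec A U) :
    contr.mk (Q := ext Φ'.ρ Q) Φ.action (ext.mk Φ'.ρ q α) a = dmk Φ Φ' q (Φ.action.smul α a) := by
  refine Eq.trans ?_ (contr.mk_act (Q := ext Φ'.ρ Q) Φ.action _ α a)
  rw [ext.act_mk', one_mul]

theorem dmk_act (q : Q.sec U) (g : Sec A' U) (a : Sec A U) :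
    dmk Φ Φ' (Q.act q g) a = dmk Φ Φ' q (Φ.action.smul (gapp Φ'.ρ U g) a) := by
  rw [← mk_extMk, dmk, ext.mk_act, mul_one]

/-- The coordinate of `z` depends on `q` through conjugation in `A'`; this is where the identity
`ρ'(g) • b = g b g⁻¹` enters. -/
theorem coord_act {f : A ⟶ A'} (hf : IsCrossedHom Φ Φ' f) (z : CSec (ext Φ'.ρ Q) Φ.action U)
    (q : Q.sec U) (g : Sec A' U) :
    gapp f U (coord Φ Φ' z (Q.act q g)) = g⁻¹ * gapp f U (coord Φ Φ' z q) * g := by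
  have h : coord Φ Φ' z q = Φ.action.smul (gapp Φ'.ρ U g) (coord Φ Φ' z (Q.act q g)) := by
    conv_lhs => rw [← dmk_coord z (Q.act q g), dmk_act, coord_dmk]
  rw [h, hf.map_smul, Φ'.smul_ρ]
  group

theorem coord_mul {V : D} (k : V ⟶ U) (z z' : CSec (ext Φ'.ρ Q) Φ.action U) (q : Q.sec V) :
    coord Φ Φ' (sres _ k (z * z')) q = coord Φ Φ' (sres _ k z) q * coord Φ Φ' (sres _ k z') q :=
  (Φ.exists_mul (ext Φ'.ρ Q) z z').choose_spec k _

theorem ext_coord {z z' : CSec (ext Φ'.ρ Q) Φ.action U}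
    (h : ∀ {V : D} (k : V ⟶ U) (q : Q.sec V),
      coord Φ Φ' (sres _ k z) q = coord Φ Φ' (sres _ k z') q) : z = z' := by
  obtain ⟨R, hR, h'⟩ := Q.locally_nonempty U
  refine sres_eq_of_cover _ R hR _ _ fun V k hk => ?_
  rw [← dmk_coord (sres _ k z) (h' k hk).some, h k, dmk_coord]

theorem coord_contrMap {Q' : Torsor A'} (e : Q ⟶ Q') (z : CSec (ext Φ'.ρ Q) Φ.action U)
    (q : Q.sec U) :
    coord Φ Φ' (sapp (contrMap Φ.action (ext.map Φ'.ρ e)) U z) (Torsor.Hom.app e q) =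
      coord Φ Φ' z q := by
  conv_lhs => rw [← dmk_coord z q]
  refine (congrArg (fun y => coord Φ Φ' y _) ((contrMap_mk Φ.action (ext.map Φ'.ρ e) _ _).trans
      ?_)).trans
    (coord_dmk _ _)
  rw [ext.map_mk]
  rfl

variable (f : A ⟶ A')

/-- The section `q f(a)`, if `a` is such that the restriction of `z` along `b` is `[[q, 1], a]`. -/
noncomputable def tw (z : CSec (ext Φ'.ρ Q) Φ.action U) {V : D} (b : V ⟶ U) (q : Q.sec V) :
    Q.sec V :=
  Q.act q (gapp f V (coord Φ Φ' (sres _ b z) q))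

theorem res_tw (z : CSec (ext Φ'.ρ Q) Φ.action U) {V W : D} (b : V ⟶ U) (q : Q.sec V) (k : W ⟶ V) :
    Q.res k (tw f z b q) = tw f z (k ≫ b) (Q.res k q) := by
  refine (Q.act_res k q _).trans ?_
  rw [← gapp_res, ← coord_res, ← sres_comp]
  rfl

theorem tw_sres (z : CSec (ext Φ'.ρ Q) Φ.action U) {V W : D} (b : V ⟶ U) (k : W ⟶ V) (q : Q.sec W) :
    tw f (sres _ b z) k q = tw f z (k ≫ b) q := by
  rw [tw, tw, sres_comp]

/-- The map `q ↦ q f(a)` commutes with the action of `A'`, although `f(a)` does not: the coordinate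
`a` of `z` with respect to `q g` is conjugate to the one with respect to `q`. -/
theorem tw_act {f : A ⟶ A'} (hf : IsCrossedHom Φ Φ' f) (z : CSec (ext Φ'.ρ Q) Φ.action U) {V : D}
    (b : V ⟶ U) (q : Q.sec V) (g : Sec A' V) : tw f z b (Q.act q g) = Q.act (tw f z b q) g := by
  rw [tw, tw, coord_act hf, ← Q.act_mul, ← Q.act_mul]
  group

theorem tw_mul (z z' : CSec (ext Φ'.ρ Q) Φ.action U) {V : D} (b : V ⟶ U) (q : Q.sec V) :
    tw f (z * z') b q = Q.act (tw f z b q) (gapp f V (coord Φ Φ' (sres _ b z') q)) := by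
  rw [tw, tw, coord_mul, map_mul, Q.act_mul]

end contr

end

section

variable {C : Type u} [Category.{v} C] {J : GrothendieckTopology C}
  {A A' Pi : Sheaf J GrpCat.{w}} {Φ : CrossedGroup A Pi} {Φ' : CrossedGroup A' Pi} {f : A ⟶ A'}

theorem IsCrossedHom.over (hf : IsCrossedHom Φ Φ' f) (S : C) :
    IsCrossedHom (Φ.over S) (Φ'.over S) (homOver f S) where
  ρ_map {U} a := hf.ρ_map (U := U.left) a
  map_smul {U} α a := hf.map_smul (U := U.left) α a

variable [IsUSite.{w} J]

open contr

/-- The endomorphism `m` of the restriction of `Q` to `T` is given by `q ↦ q f(a)`, if `a` is the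
local section of `A` such that `z = [[q, 1], a]`. -/
def IsTwist (f : A ⟶ A') {S : C} (Q : Torsor (A'.over S)) (T : Over S)
    (z : CSec (ext (Φ'.over S).ρ Q) (Φ.over S).action T) (m : Q.pull T.hom ⟶ Q.pull T.hom) : Prop :=
  ∀ ⦃V : Over S⦄ (b : V ⟶ T) (q : Q.sec V),
    Torsor.ev m (V₁ := V) (V₂ := V) (𝟙 V.left) b.left (by simp) (by simp) q =
      tw (homOver f S) z b q

section

variable {S : C} {Q : Torsor (A'.over S)} {T : Over S}
  {z z' : CSec (ext (Φ'.over S).ρ Q) (Φ.over S).action T} {m m' : Q.pull T.hom ⟶ Q.pull T.hom}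

/-- A section of `(Q ∧^{A'} Π) ∧^Π A` defines an endomorphism of `Q`. -/
noncomputable def twist (hf : IsCrossedHom Φ Φ' f)
    (z : CSec (ext (Φ'.over S).ρ Q) (Φ.over S).action T) : Q.pull T.hom ⟶ Q.pull T.hom where
  app {W} q := tw (homOver f S) z (Over.homMk W.hom : (Over.map T.hom).obj W ⟶ T) q
  app_res {W W'} k q := by
    refine Eq.trans ?_ (res_tw (homOver f S) z _ q ((Over.map T.hom).map k)).symm
    have h : (Over.map T.hom).map k ≫ Over.homMk W.hom =
        (Over.homMk W'.hom : (Over.map T.hom).obj W' ⟶ T) := by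
      ext
      simp
    rw [h]
    rfl
  app_act {W} q g := tw_act (hf.over S) z _ q g

theorem isTwist_twist (hf : IsCrossedHom Φ Φ' f)
    (z : CSec (ext (Φ'.over S).ρ Q) (Φ.over S).action T) : IsTwist f Q T z (twist hf z) := by
  intro V b q
  let V' : Over S := (Over.map T.hom).obj (Over.mk b.left)
  let k : V ⟶ V' := Over.homMk (𝟙 V.left) (by simp [V'])
  let l : V' ⟶ V := Over.homMk (𝟙 V.left) (by simp [V'])
  refine (res_tw (homOver f S) z (Over.homMk b.left : V' ⟶ T) (Q.res l q) k).trans ?_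
  have h1 : Q.res k (Q.res l q) = q :=
    (Q.res_comp l k (𝟙 V) (by simp [k, l]) q).trans (Q.res_eq_self _ rfl q)
  have h2 : k ≫ (Over.homMk b.left : V' ⟶ T) = b := by
    ext
    simp [k]
  rw [h1, h2]

/-- The automorphism of `Q` defined by a section of `(Q ∧^{A'} Π) ∧^Π A`. -/
noncomputable def twistAut (hf : IsCrossedHom Φ Φ' f)
    (z : CSec (ext (Φ'.over S).ρ Q) (Φ.over S).action T) : Aut (Q.pull T.hom) :=
  Torsor.isoOfHom (twist hf z)

theorem isTwist_twistAut (hf : IsCrossedHom Φ Φ' f)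
    (z : CSec (ext (Φ'.over S).ρ Q) (Φ.over S).action T) : IsTwist f Q T z (twistAut hf z).hom :=
  isTwist_twist hf z

theorem IsTwist.hom_unique (h : IsTwist f Q T z m) (h' : IsTwist f Q T z m') : m = m' := by
  refine Torsor.hom_ext_ev fun {V₁ V₂} c b h₁ h₂ p => ?_
  let k : V₂ ⟶ V₁ := Over.homMk c (by rw [← h₁, h₂])
  let l : V₂ ⟶ T := Over.homMk b h₂
  have key := (h l (Q.res k p)).trans (h' l (Q.res k p)).symm
  have h1 := Torsor.ev_res m (V₁ := V₂) (V₂ := V₂) (𝟙 _) b (by simp [h₂]) h₂ k p (c' := c)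
      (by simp [k])
  have h2 := Torsor.ev_res m' (V₁ := V₂) (V₂ := V₂) (𝟙 _) b (by simp [h₂]) h₂ k p (c' := c)
      (by simp [k])
  exact h1.symm.trans (key.trans h2)

theorem IsTwist.congr (h : IsTwist f Q T z m) (e : m = m') : IsTwist f Q T z m' := e ▸ h

theorem IsTwist.section_unique (hi : ∀ U : C, Function.Injective (gapp f U))
    (h : IsTwist f Q T z m) (h' : IsTwist f Q T z' m) : z = z' :=
  ext_coord fun {V} b q => hi V.left (Q.act_inj q ((h b q).symm.trans (h' b q)))

/-- An endomorphism of `Q` which locally has the form `q ↦ q f(a)` comes from a section of `(Q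
∧^{A'} Π) ∧^Π A`: the local sections `[[q, 1], a]` do not depend on `q`, and glue along the torsor.
-/
theorem exists_isTwist (hf : IsCrossedHom Φ Φ' f) (hi : ∀ U : C, Function.Injective (gapp f U))
    (hm : ∀ {V : Over S} (b : V ⟶ T) (q : Q.sec V), ∃ a : Sec (A.over S) V,
      Torsor.ev m (V₁ := V) (V₂ := V) (𝟙 V.left) b.left (by simp) (by simp) q =
        Q.act q (gapp (homOver f S) V a)) :
    ∃ z : CSec (ext (Φ'.over S).ρ Q) (Φ.over S).action T, IsTwist f Q T z m := by
  choose a ha using @hm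
  obtain ⟨z, hz, -⟩ := Q.glue (contr (ext (Φ'.over S).ρ Q) (Φ.over S).action) T
    (fun {V} b q => dmk (Φ.over S) (Φ'.over S) q (a b q))
    (fun {V V'} b k q => by
      rw [dmk_res]
      refine congrArg _ (hi V'.left (Q.act_inj (Q.res k q) ?_))
      refine Eq.trans ?_ (ha (k ≫ b) (Q.res k q))
      refine (congrArg (Q.act _) (gapp_res (homOver f S) k _)).trans ?_
      refine (Q.act_res k q _).symm.trans ?_
      rw [← ha]
      refine (Torsor.res_ev m _ _ _ _ k q (c' := k.left) (by simp) rfl).trans ?_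
      exact (Torsor.ev_res m _ _ _ _ k q (c' := k.left) (by simp)).symm)
    (fun {V} b q g => by
      rw [dmk_act]
      refine congrArg _ (hi V.left (Q.act_inj q ?_))
      refine Eq.trans ?_ (ha b q)
      have h1 := (ha b (Q.act q g)).symm.trans (Torsor.ev_act m _ _ _ _ q g)
      have h2 : gapp (homOver f S) V ((Φ.over S).action.smul (gapp (Φ'.over S).ρ V g)
          (a b (Q.act q g)))
          = g * gapp (homOver f S) V (a b (Q.act q g)) * g⁻¹ :=
        ((hf.over S).map_smul _ _).trans ((Φ'.over S).smul_ρ _ _)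
      refine (congrArg (Q.act q) h2).trans ?_
      rw [Q.act_mul, Q.act_mul]
      refine (congrArg (fun y => Q.act y _) h1).trans ?_
      refine (Q.act_mul _ _ _).symm.trans ((congrArg _ ?_).trans (Q.act_one _))
      exact (congrArg (fun y : Sec (A'.over S) V => y * g⁻¹) (gres_id A' (X := V.left) g)).trans
        (mul_inv_cancel g))
  refine ⟨z, fun {V} b q => ?_⟩
  rw [tw, hz b q, coord_dmk]
  exact ha b q

/-- The composition of `Aut` is the one of functions, so that a product of sections corresponds to a
product of automorphisms. -/
theorem IsTwist.mul (h : IsTwist f Q T z m) (h' : IsTwist f Q T z' m') :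
    IsTwist f Q T (z * z') (m' ≫ m) := by
  intro V b q
  have h1 := Torsor.ev_ev m' (V₁ := V) (V₂ := V) (𝟙 V.left) b.left (by simp) (by simp) m
    (V₃ := V) (𝟙 V.left) q (c' := 𝟙 V.left) (b' := b.left) (by simp) (by simp) (by simp)
  refine h1.symm.trans ?_
  rw [h' b q, tw_mul]
  refine (Torsor.ev_act m _ _ _ _ q _).trans ?_
  exact congrArg₂ Q.act (h b q) (gres_id A' (X := V.left) _)

/-- The homomorphism from sections of `(Q ∧^{A'} Π) ∧^Π A` to automorphisms of `Q`. -/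
noncomputable def twistHom (hf : IsCrossedHom Φ Φ' f) (Q : Torsor (A'.over S)) (T : Over S) :
    CSec (ext (Φ'.over S).ρ Q) (Φ.over S).action T →* Aut (Q.pull T.hom) :=
  MonoidHom.mk' (M := CSec (ext (Φ'.over S).ρ Q) (Φ.over S).action T) (G := Aut (Q.pull T.hom))
    (twistAut hf) fun z z' => Iso.ext ((isTwist_twistAut hf _).hom_unique
      ((isTwist_twistAut hf z).mul (isTwist_twistAut hf z')))

theorem isTwist_twistHom (hf : IsCrossedHom Φ Φ' f)
    (z : CSec (ext (Φ'.over S).ρ Q) (Φ.over S).action T) :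
        IsTwist f Q T z (twistHom hf Q T z).hom :=
  isTwist_twist hf z

theorem IsTwist.pullHom (h : IsTwist f Q T z m) {T' : Over S} (g : T' ⟶ T) :
    IsTwist f Q T' (sres _ g z)
      (pullHom (F := TORSC A') (M₁ := Q) (M₂ := Q) m g.left T'.hom T'.hom (Over.w g)
          (Over.w g)) := by
  intro V b q
  refine (Torsor.ev_pullHom m _ _ _ _ _ _ _ _ _ q).trans ?_
  rw [tw_sres]
  exact h (b ≫ g) q

/-- Compatibility with an isomorphism of torsors. -/
theorem IsTwist.conj (h : IsTwist f Q T z m) {Q' : Torsor (A'.over S)} (e : Q ⟶ Q')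
    {n : Q'.pull T.hom ⟶ Q'.pull T.hom}
    (he : m ≫ Torsor.pullMap T.hom e = Torsor.pullMap T.hom e ≫ n) :
    IsTwist f Q' T (sapp (contrMap (Φ.over S).action (ext.map (Φ'.over S).ρ e)) T z) n := by
  intro V b q'
  obtain ⟨q, rfl⟩ := (Torsor.hom_bijective e V).2 q'
  dsimp only
  rw [tw, ← sapp_res, coord_contrMap, ← e.app_act]
  refine Eq.trans ?_ (congrArg (fun x => Torsor.Hom.app e x) (h b q))
  have h1 : ∀ {V : Over S} (b : V.left ⟶ T.left) (hb : b ≫ T.hom = V.hom) (q : Q.sec V),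
      Torsor.ev (Torsor.pullMap T.hom e) (V₁ := V) (V₂ := V) (𝟙 V.left) b (by simp [hb]) hb q =
        Torsor.Hom.app e q := by
    intro V b hb q
    refine (e.app_res _ _).symm.trans (congrArg (fun x => Torsor.Hom.app e x) ?_)
    exact (Q.res_comp _ _ (𝟙 V) (by simp) q).trans (Q.res_eq_self _ rfl q)
  have h2 := Torsor.ev_ev m (V₁ := V) (V₂ := V) (𝟙 V.left) b.left (by simp) (by simp)
    (Torsor.pullMap T.hom e) (V₃ := V) (𝟙 V.left) q (c' := 𝟙 V.left) (b' := b.left) (by simp)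
        (by simp) (by simp)
  have h3 := Torsor.ev_ev (Torsor.pullMap T.hom e) (V₁ := V) (V₂ := V) (𝟙 V.left) b.left (by simp)
      (by simp)
    n (V₃ := V) (𝟙 V.left) q (c' := 𝟙 V.left) (b' := b.left) (by simp) (by simp) (by simp)
  rw [h1 _ (by simp)] at h2 h3
  rw [h2, h3, he]

end

end

/-! ### Inverse images of sections of the contracted product -/

section

variable {C : Type u} [Category.{v} C] {J : GrothendieckTopology C} [IsUSite.{w} J]
  {A A' Pi : Sheaf J GrpCat.{w}} {Φ : CrossedGroup A Pi} {Φ' : CrossedGroup A' Pi} {f : A ⟶ A'}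

open contr

section

variable {S S' : C} (g : S' ⟶ S) {Q : Torsor (A'.over S)} {T : Over S'}

/-- The canonical map `((g^* Q) ∧^{A'} Π) ∧^Π A ⟶ g^* ((Q ∧^{A'} Π) ∧^Π A)` on sections. -/
noncomputable def dbc (z : CSec (ext (Φ'.over S').ρ (Q.pull g)) (Φ.over S').action T) :
    CSec (ext (Φ'.over S).ρ Q) (Φ.over S).action ((Over.map g).obj T) :=
  bc Φ.action g (ext (homOver Φ'.ρ S) Q)
    (sapp (contrMap (Φ.over S').action (ext.baseChange Φ'.ρ g Q)) T z)

theorem dbc_dmk (q : (Q.pull g).sec T) (a : Sec (A.over S') T) :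
    dbc g (dmk (Φ.over S') (Φ'.over S') q a) =
      dmk (Φ.over S) (Φ'.over S) (Q := Q) (U := (Over.map g).obj T) q a := by
  refine (congrArg (bc Φ.action g _)
    ((contrMap_mk (Φ.over S').action (ext.baseChange Φ'.ρ g Q) _ _).trans
      (congrArg (fun y => contr.mk (Φ.over S').action y a) (ext.baseChange_mk Φ'.ρ g Q q 1)))).trans
          ?_
  exact bc_mk ..

theorem tw_dbc (z : CSec (ext (Φ'.over S').ρ (Q.pull g)) (Φ.over S').action T) {V : Over S'}
    (b : V ⟶ T)
    (q : (Q.pull g).sec V) :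
    tw (homOver f S) (dbc g z) ((Over.map g).map b) q = tw (homOver f S') z b q := by
  have h : sres _ ((Over.map g).map b) (dbc g z) = dbc g (sres _ b z) :=
    (bc_res ..).symm.trans (congrArg (bc Φ.action g _) (sapp_res ..).symm)
  refine congrArg (fun a => Q.act (X := (Over.map g).obj V) q (gapp (homOver f S') V a)) ?_
  rw [h]
  conv_lhs => rw [← dmk_coord (sres _ b z) q]
  rw [dbc_dmk]
  exact coord_dmk _ _

/-- Compatibility with inverse images along `g`. -/
theorem IsTwist.baseChange {z : CSec (ext (Φ'.over S').ρ (Q.pull g)) (Φ.over S').action T}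
    {m : (Q.pull g).pull T.hom ⟶ (Q.pull g).pull T.hom} (h : IsTwist f (Q.pull g) T z m)
    {n : Q.pull ((Over.map g).obj T).hom ⟶ Q.pull ((Over.map g).obj T).hom}
    (hn : n = (Torsor.pullComp g T.hom Q).hom ≫ m ≫ (Torsor.pullComp g T.hom Q).inv) :
    IsTwist f Q ((Over.map g).obj T) (dbc g z) n := by
  intro V b q
  let V' : Over S' := Over.mk (b.left ≫ T.hom)
  let b' : V' ⟶ T := Over.homMk b.left
  let k : V ⟶ (Over.map g).obj V' := Over.homMk (𝟙 V.left) (by simpa [V'] using Over.w b)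
  let l : (Over.map g).obj V' ⟶ V := Over.homMk (𝟙 V.left) (by simpa [V'] using (Over.w b).symm)
  have h1 : Q.res k (Q.res l q) = q :=
    (Q.res_comp l k (𝟙 V) (by simp [k, l]) q).trans (Q.res_eq_self _ rfl q)
  have h2 : b = k ≫ (Over.map g).map b' := by
    ext
    simp [k, b']
  have h3 : tw (homOver f S) (dbc g z) b q = Q.res k (tw (homOver f S') z b' (Q.res l q)) := by
    refine Eq.trans ?_ (congrArg (Q.res k) (tw_dbc g z b' (Q.res l q)))
    refine Eq.trans ?_ (res_tw (homOver f S) (dbc g z) _ _ k).symm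
    rw [← h2, h1]
  rw [h3]
  refine Eq.trans ?_ (congrArg (Q.res k) (h b' (Q.res l q)))
  subst hn
  -- Both sides are restrictions, along maps over identities, of one value of `m`.
  refine Eq.trans ?_ (Q.res_comp (U := (Over.map g).obj ((Over.map T.hom).obj (Over.mk b.left)))
    _ k (Over.homMk (𝟙 V.left) (by simpa using Over.w b)) (by simp [k]) _).symm
  refine (Q.res_comp (U := (Over.map g).obj ((Over.map T.hom).obj (Over.mk b.left)))
    _ _ (Over.homMk (𝟙 V.left) (by simpa using Over.w b)) (by simp) _).trans ?_
  refine congrArg (Q.res _) (congrArg (fun x => m.app (X := Over.mk b.left) x) ?_)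
  have hw : V.hom = b.left ≫ T.hom ≫ g := (Over.w b).symm
  refine (Q.res_comp (Over.homMk (𝟙 V.left) (by simp [hw]) :
      (Over.map ((Over.map g).obj T).hom).obj (Over.mk b.left) ⟶ V)
    (Over.homMk (𝟙 V.left) (by simp) : (Over.map g).obj ((Over.map T.hom).obj (Over.mk b.left)) ⟶
      (Over.map ((Over.map g).obj T).hom).obj (Over.mk b.left))
    (Over.homMk (𝟙 V.left) (by simp [hw])) (by simp) q).trans ?_
  exact (Q.res_comp l (Over.homMk (𝟙 V.left) (by simp [V']) :
    (Over.map g).obj ((Over.map T.hom).obj (Over.mk b.left)) ⟶ (Over.map g).obj V') _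
        (by simp [l]) q).symm

end

end

/-! ### Automorphisms of torsors -/

section

variable {C : Type u} [Category.{v} C] {J : GrothendieckTopology C}
  {A A' A'' Pi : Sheaf J GrpCat.{w}} {Φ : CrossedGroup A Pi} {Φ' : CrossedGroup A' Pi} {f : A ⟶ A'}

open contr

theorem TORSC_autRes_hom {S : C} (Q : Torsor (A'.over S)) {T V : Over S} (g : V ⟶ T)
    (σ : Aut ((invIm (TORSC A') T.hom).obj Q)) :
    (autRes (TORSC A') T.hom g.left V.hom (Over.w g) Q σ).hom =
      pullHom (F := TORSC A') (M₁ := Q) (M₂ := Q) σ.hom g.left V.hom V.hom (Over.w g)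
          (Over.w g) := by
  refine (Iso.conjAut_hom _ _).trans ?_
  rfl

theorem invComp_TORSC {S S' : C} (g : S' ⟶ S) (Q : Torsor (A'.over S)) (T : Over S') :
    invComp (TORSC A') g T.hom ((Over.map g).obj T).hom rfl Q =
        (Torsor.pullComp g T.hom Q).symm := by
  refine Iso.ext ?_
  refine Torsor.hom_ext (P := (Q.pull g).pull T.hom) (Q := Q.pull _) fun {U} p => ?_
  exact TORSC_mapComp'_inv_app g T.hom _ rfl Q p

variable [IsUSite.{w} J]

theorem twistHom_id_bijective (Φ : CrossedGroup A Pi) {S : C} (Q : Torsor (A.over S)) (T : Over S) :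
    Function.Bijective (twistHom (.id Φ) Q T) := by
  have hi : ∀ U : C, Function.Injective (gapp (𝟙 A) U) := fun U a b h => h
  constructor
  · intro z z' e
    exact (isTwist_twistHom (.id Φ) z).section_unique hi
      ((isTwist_twistHom (.id Φ) z').congr (congrArg Iso.hom e.symm))
  · intro σ
    obtain ⟨z, hz⟩ := exists_isTwist (Φ := Φ) (m := σ.hom) (.id Φ) hi
      fun {V} b q => by
        obtain ⟨a, ha, -⟩ := Q.simply_transitive q (Torsor.ev σ.hom (V₁ := V) (V₂ := V) (𝟙 V.left)
          b.left (by simp) (by simp) q)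
        exact ⟨a, ha.symm⟩
    exact ⟨z, Iso.ext ((isTwist_twistHom (.id Φ) z).hom_unique hz)⟩

/-- The automorphisms of a torsor `Q` under `A` are the sections of `(Q ∧^A Π) ∧^Π A`. -/
noncomputable def equivTORS (Φ : CrossedGroup A Pi) {S : C} (Q : Torsor (A.over S)) (T : Over S) :
    Aut (Q.pull T.hom) ≃* CSec (ext (Φ.over S).ρ Q) (Φ.over S).action T :=
  (MulEquiv.ofBijective (twistHom (.id Φ) Q T) (twistHom_id_bijective Φ Q T)).symm

theorem isTwist_equivTORS_symm {S : C} (Q : Torsor (A.over S)) (T : Over S)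
    (z : CSec (ext (Φ.over S).ρ Q) (Φ.over S).action T) :
    IsTwist (𝟙 A) Q T z ((equivTORS Φ Q T).symm z).hom :=
  isTwist_twistHom (.id Φ) z

theorem equivTORS_eq {S : C} {Q : Torsor (A.over S)} {T : Over S} {σ : Aut (Q.pull T.hom)}
    {z : CSec (ext (Φ.over S).ρ Q) (Φ.over S).action T} (h : IsTwist (𝟙 A) Q T z σ.hom) :
    equivTORS Φ Q T σ = z :=
  (equivTORS Φ Q T).symm.injective (((equivTORS Φ Q T).symm_apply_apply σ).trans
    (Iso.ext (h.hom_unique (isTwist_equivTORS_symm Q T z))))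

theorem isTwist_equivTORS {S : C} (Q : Torsor (A.over S)) (T : Over S) (σ : Aut (Q.pull T.hom)) :
    IsTwist (𝟙 A) Q T (equivTORS Φ Q T σ) σ.hom := by
  have h := isTwist_equivTORS_symm (Φ := Φ) Q T (equivTORS Φ Q T σ)
  rwa [MulEquiv.symm_apply_apply] at h

/-- The isomorphism `j_TORS`: `Aut(Q) ≅ (Q ∧^A Π) ∧^Π A` for every torsor `Q`. -/
noncomputable def autIsoTORS (Φ : CrossedGroup A Pi) : AutIso Φ (TORSC A) (muTORS Φ) where
  equiv {S} Q T := equivTORS Φ (S := S) Q T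
  equiv_res {S} Q {T V} g σ := by
    refine equivTORS_eq (S := S) (Q := Q) ?_
    exact ((isTwist_equivTORS (Φ := Φ) (S := S) Q T σ).pullHom g).congr
      (TORSC_autRes_hom (S := S) Q g σ).symm
  equiv_natural {S x y} e T σ := by
    refine equivTORS_eq (S := S) (Q := y) ?_
    refine (isTwist_equivTORS (Φ := Φ) (S := S) x T σ).conj (Q := x) (Q' := y) e.hom ?_
    rw [Iso.conjAut_hom, Iso.conj_apply]
    exact (((invIm (TORSC A) T.hom).mapIso e).hom_inv_id_assoc _).symm
  equiv_inv {S S'} g Q T σ := by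
    refine equivTORS_eq (S := S) (Q := Q) ?_
    refine (isTwist_equivTORS (Φ := Φ) (S := S') (Q.pull g) T σ).baseChange g (Q := Q) ?_
    refine (Iso.conjAut_hom _ _).trans ?_
    exact congrArg (fun i : (Q.pull g).pull T.hom ≅ Q.pull ((Over.map g).obj T).hom =>
      i.inv ≫ σ.hom ≫ i.hom) (invComp_TORSC (S := S) g Q T)

end

/-! ### Automorphisms of liftings -/

section

variable {C : Type u} [Category.{v} C] {J : GrothendieckTopology C}
  {A A' A'' Pi : Sheaf J GrpCat.{w}} {Φ : CrossedGroup A Pi} {Φ' : CrossedGroup A' Pi} {f : A ⟶ A'}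
  {h : A' ⟶ A''} {P : Torsor A''}

open contr

theorem liftings_autRes_hom {S : C} (L : Lifting.Fiber h P S) {T V : Over S} (g : V ⟶ T)
    (σ : Aut ((invIm (liftings h P) T.hom).obj L)) :
    Lifting.Hom.hom (autRes (liftings h P) T.hom g.left V.hom (Over.w g) L σ).hom =
      pullHom (F := TORSC A') (M₁ := L.torsor) (M₂ := L.torsor)
          (Lifting.Hom.hom σ.hom) g.left V.hom V.hom
        (Over.w g) (Over.w g) := by
  refine (congrArg Lifting.Hom.hom (Iso.conjAut_hom _ _)).trans ?_
  exact liftings_pullHom L L σ.hom g.left V.hom V.hom (Over.w g) (Over.w g)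

theorem invComp_liftings_hom {S S' : C} (g : S' ⟶ S) (L : Lifting.Fiber h P S) (T : Over S') :
    Lifting.Hom.hom (invComp (liftings h P) g T.hom ((Over.map g).obj T).hom rfl L).hom =
      (Torsor.pullComp g T.hom L.torsor).inv := by
  refine (liftings_mapComp'_inv g T.hom _ rfl L).trans ?_
  exact congrArg Iso.hom (invComp_TORSC g L.torsor T)

theorem invComp_liftings_inv {S S' : C} (g : S' ⟶ S) (L : Lifting.Fiber h P S) (T : Over S') :
    Lifting.Hom.hom (invComp (liftings h P) g T.hom ((Over.map g).obj T).hom rfl L).inv =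
      (Torsor.pullComp g T.hom L.torsor).hom := by
  refine (liftings_mapComp'_hom g T.hom _ rfl L).trans ?_
  exact congrArg Iso.inv (invComp_TORSC g L.torsor T)

variable [IsUSite.{w} J]

/-- The functor `μ_P` is compatible with inverse images through the base change morphism of
extensions of the structural group. -/
theorem torsNat_muLift (Φ' : CrossedGroup A' Pi) {S T : C} (g : T ⟶ S) (L : Lifting.Fiber h P S) :
    torsNat (muLift Φ' h P) g L = ext.baseChange Φ'.ρ g L.torsor := by
  have h1 : ext.map (homOver Φ'.ρ T) (𝟙 (L.torsor.pull g)) = 𝟙 _ := (ext.functor Φ'.ρ T).map_id _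
  refine Eq.trans ?_ ((congrArg (· ≫ ext.baseChange Φ'.ρ g L.torsor) h1).trans (id_comp _))
  rfl

/-- The map `q ↦ q f(a)` respects `λ`, since `h f = 1`. -/
theorem lam_tw (h1 : ∀ {U : C} (a : Sec A U), gapp h U (gapp f U a) = 1)
    {S : C} (L : Lifting.Fiber h P S) {T : Over S}
    (z : CSec (ext (Φ'.over S).ρ L.torsor) (Φ.over S).action T) {V : Over S} (b : V ⟶ T)
    (q : L.torsor.sec V) : L.lam.app (tw (homOver f S) z b q) = L.lam.app q := by
  refine (L.lam.app_act _ _).trans ?_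
  exact (congrArg _ (h1 (U := V.left) _)).trans (P.act_one (X := V.left) _)

/-- The automorphism of a lifting defined by a section of `(Q ∧^{A'} Π) ∧^Π A`. -/
noncomputable def liftTwistAut (hf : IsCrossedHom Φ Φ' f)
    (h1 : ∀ {U : C} (a : Sec A U), gapp h U (gapp f U a) = 1)
    {S : C} (L : Lifting.Fiber h P S) (T : Over S)
    (z : CSec (ext (Φ'.over S).ρ L.torsor) (Φ.over S).action T) : Aut (L.pull T.hom) :=
  Lifting.isoMk (L := L.pull T.hom) (M := L.pull T.hom) (twistAut hf z) fun q => lam_tw h1 L z _ q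

/-- The homomorphism from sections of `(Q ∧^{A'} Π) ∧^Π A` to automorphisms of the lifting `Q`. -/
noncomputable def liftTwistHom (hf : IsCrossedHom Φ Φ' f)
    (h1 : ∀ {U : C} (a : Sec A U), gapp h U (gapp f U a) = 1)
    {S : C} (L : Lifting.Fiber h P S) (T : Over S) :
    CSec (ext (Φ'.over S).ρ L.torsor) (Φ.over S).action T →* Aut (L.pull T.hom) :=
  MonoidHom.mk' (M := CSec (ext (Φ'.over S).ρ L.torsor) (Φ.over S).action T)
      (G := Aut (L.pull T.hom))
    (liftTwistAut hf h1 L T) fun z z' => Iso.ext (Lifting.hom_ext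
      ((isTwist_twistAut hf _).hom_unique ((isTwist_twistAut hf z).mul (isTwist_twistAut hf z'))))

theorem isTwist_liftTwistHom (hf : IsCrossedHom Φ Φ' f)
    (h1 : ∀ {U : C} (a : Sec A U), gapp h U (gapp f U a) = 1)
    {S : C} (L : Lifting.Fiber h P S) (T : Over S)
    (z : CSec (ext (Φ'.over S).ρ L.torsor) (Φ.over S).action T) :
    IsTwist f L.torsor T z (Lifting.Hom.hom (liftTwistHom hf h1 L T z).hom) :=
  isTwist_twist hf z

/-- An automorphism `σ` of the torsor `Q` respects `λ` if and only if it is locally `q ↦ q g` with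
`h(g) = 1`, that is, with `g` in the image of `f`. -/
theorem liftTwistHom_bijective (hf : IsCrossedHom Φ Φ' f)
    (hi : ∀ U : C, Function.Injective (gapp f U))
    (he : ∀ {U : C} (a : Sec A' U), gapp h U a = 1 ↔ ∃ b : Sec A U, gapp f U b = a)
    {S : C} (L : Lifting.Fiber h P S) (T : Over S) :
    Function.Bijective (liftTwistHom hf (fun a => (he _).2 ⟨a, rfl⟩) L T) := by
  constructor
  · intro z z' e
    exact (isTwist_liftTwistHom hf _ L T z).section_unique hi
      ((isTwist_liftTwistHom hf _ L T z').congr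
        (congrArg (fun σ : Aut (L.pull T.hom) => Lifting.Hom.hom σ.hom) e.symm))
  · intro σ
    obtain ⟨z, hz⟩ := exists_isTwist (Φ := Φ) (m := Lifting.Hom.hom σ.hom) hf hi
      fun {V} b q => by
        obtain ⟨g, hg, -⟩ := L.torsor.simply_transitive q
            (Torsor.ev (Lifting.Hom.hom σ.hom) (V₁ := V)
          (V₂ := V) (𝟙 V.left) b.left (by simp) (by simp) q)
        have h2 : L.lam.app (L.torsor.act q g) = L.lam.app q := by
          rw [hg]
          refine (Lifting.lam_ev (L₁ := L) (L₂ := L) σ.hom (V₁ := V) (V₂ := V) (𝟙 V.left) b.left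
              (by simp)
            (by simp) q).trans ?_
          exact sres_id P.carrier (X := V.left) _
        -- `λ(q) h(g) = λ(q)`, and the action on `P` is free
        have h3 : gapp h V.left g = 1 := by
          refine P.act_inj (X := V.left) (L.lam.app q) ?_
          exact (L.lam.app_act q g).symm.trans (h2.trans (P.act_one (X := V.left) _).symm)
        obtain ⟨a, rfl⟩ := (he (U := V.left) g).1 h3
        exact ⟨a, hg.symm⟩
    exact ⟨z, Iso.ext (Lifting.hom_ext ((isTwist_liftTwistHom hf _ L T z).hom_unique hz))⟩

section

variable (hf : IsCrossedHom Φ Φ' f) (hi : ∀ U : C, Function.Injective (gapp f U))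
    (he : ∀ {U : C} (a : Sec A' U), gapp h U a = 1 ↔ ∃ b : Sec A U, gapp f U b = a)

/-- The automorphisms of a lifting `(Q, λ)` are the sections of `(Q ∧^{A'} Π) ∧^Π A`. -/
noncomputable def equivLift {S : C} (L : Lifting.Fiber h P S) (T : Over S) :
    Aut (L.pull T.hom) ≃* CSec (ext (Φ'.over S).ρ L.torsor) (Φ.over S).action T :=
  (MulEquiv.ofBijective (liftTwistHom hf (fun a => (he _).2 ⟨a, rfl⟩) L T)
    (liftTwistHom_bijective hf hi he L T)).symm

theorem isTwist_equivLift_symm {S : C} (L : Lifting.Fiber h P S) (T : Over S)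
    (z : CSec (ext (Φ'.over S).ρ L.torsor) (Φ.over S).action T) :
    IsTwist f L.torsor T z (Lifting.Hom.hom ((equivLift hf hi he L T).symm z).hom) :=
  isTwist_twist hf z

variable {hf hi he}

theorem equivLift_eq {S : C} {L : Lifting.Fiber h P S} {T : Over S} {σ : Aut (L.pull T.hom)}
    {z : CSec (ext (Φ'.over S).ρ L.torsor) (Φ.over S).action T}
    (hz : IsTwist f L.torsor T z (Lifting.Hom.hom σ.hom)) :
    equivLift hf hi he L T σ = z :=
  (equivLift hf hi he L T).symm.injective (((equivLift hf hi he L T).symm_apply_apply σ).trans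
    (Iso.ext (Lifting.hom_ext (hz.hom_unique (isTwist_equivLift_symm hf hi he L T z)))))

variable (hf hi he)

theorem isTwist_equivLift {S : C} (L : Lifting.Fiber h P S) (T : Over S) (σ : Aut (L.pull T.hom)) :
    IsTwist f L.torsor T (equivLift hf hi he L T σ) (Lifting.Hom.hom σ.hom) := by
  have h := isTwist_equivLift_symm hf hi he L T (equivLift hf hi he L T σ)
  rwa [MulEquiv.symm_apply_apply] at h

/-- The isomorphism `j_P`: `Aut(Q, λ) ≅ (Q ∧^{A'} Π) ∧^Π A` for every lifting `(Q, λ)`. -/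
noncomputable def autIsoLift : AutIso Φ (liftings h P) (muLift Φ' h P) where
  equiv {S} L T := equivLift hf hi he (S := S) L T
  equiv_res {S} L {T V} g σ := by
    refine equivLift_eq (S := S) (L := L) ?_
    exact ((isTwist_equivLift hf hi he (S := S) L T σ).pullHom g).congr
      (liftings_autRes_hom (S := S) L g σ).symm
  equiv_natural {S x y} e T σ := by
    refine equivLift_eq (S := S) (L := y) ?_
    refine (isTwist_equivLift hf hi he (S := S) x T σ).conj (Q := x.torsor) (Q' := y.torsor)
      (Lifting.Hom.hom e.hom) ?_
    rw [Iso.conjAut_hom, Iso.conj_apply]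
    exact congrArg Lifting.Hom.hom (((invIm (liftings h P) T.hom).mapIso e).hom_inv_id_assoc
      (σ.hom ≫ ((invIm (liftings h P) T.hom).mapIso e).hom)).symm
  equiv_inv {S S'} g L T σ := by
    refine Eq.trans ?_ (congrArg (fun t : ext (homOver Φ'.ρ S') (Lifting.pull g L).torsor ⟶
        (ext (homOver Φ'.ρ S) (Lifting.torsor L)).pull g =>
            bc Φ.action g (ext (homOver Φ'.ρ S) (Lifting.torsor L))
      (sapp (contrMap (Φ.over S').action t) T
          (equivLift hf hi he (S := S') (Lifting.pull g L) T σ)))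
      (torsNat_muLift (S := S) Φ' g L)).symm
    refine equivLift_eq (S := S) (L := L) ?_
    refine (isTwist_equivLift hf hi he (S := S') (Lifting.pull g L) T σ).baseChange g
        (Q := L.torsor) ?_
    refine (congrArg Lifting.Hom.hom (Iso.conjAut_hom _ _)).trans ?_
    have h1 := invComp_liftings_hom (S := S) g L T
    have h2 := invComp_liftings_inv (S := S) g L T
    exact congrArg₂ (fun i j => i ≫ Lifting.Hom.hom σ.hom ≫ j) h2 h1

end

end

/-! ### The formulas for the automorphisms -/

section

variable {C : Type u} [Category.{v} C] {J : GrothendieckTopology C} [IsUSite.{w} J]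
  {A A' A'' Pi : Sheaf J GrpCat.{w}} {Φ : CrossedGroup A Pi} {Φ' : CrossedGroup A' Pi} {f : A ⟶ A'}
  {h : A' ⟶ A''} {P : Torsor A''}

open contr

section

variable {S : C} {Q : Torsor (A'.over S)} {T : Over S}
  {z : CSec (ext (Φ'.over S).ρ Q) (Φ.over S).action T} {m : Q.pull T.hom ⟶ Q.pull T.hom}

theorem IsTwist.app_eq (hz : IsTwist f Q T z m) {U : Over T.left}
    (q : Q.sec ((Over.map T.hom).obj U)) :
    m.app (X := U) q =
      tw (homOver f S) z (Over.homMk U.hom : (Over.map T.hom).obj U ⟶ T) q :=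
  (Torsor.app_eq_ev m q).trans (hz (Over.homMk U.hom : (Over.map T.hom).obj U ⟶ T) q)

/-- The endomorphism attached to `[[q, α], a]` is `σ_q(f(α a))`. -/
theorem IsTwist.isSigma (hz : IsTwist f Q T z m) (q : Q.sec T) (α : Sec (Pi.over S) T)
    (a : Sec (A.over S) T)
    (e : z = contr.mk (Q := ext (Φ'.over S).ρ Q) (Φ.over S).action (ext.mk (Φ'.over S).ρ q α) a) :
    IsSigma Q T q (gapp (homOver f S) T ((Φ.over S).action.smul α a)) m := by
  intro U b'
  let k : (Over.map T.hom).obj U ⟶ T := Over.homMk U.hom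
  refine (m.app_act (X := U) _ b').trans (congrArg
      (fun y => Q.act (X := (Over.map T.hom).obj U) y b') ?_)
  refine (hz.app_eq (Q.res k q)).trans ?_
  have h1 : z = dmk (Φ.over S) (Φ'.over S) q ((Φ.over S).action.smul α a) :=
      e.trans (mk_extMk q α a)
  rw [tw, coord_res, h1, coord_dmk, gapp_res]

/-- An endomorphism of `Q` all of whose restrictions satisfy the formula `σ_q(f(a))`, with `α = 1`,
is the one attached to `z`. The formula is used at the final object of `C/V` and for `b' = 1`. -/
theorem isTwist_of_isSigma
    (hm : ∀ {V : Over S} (b : V ⟶ T) (q : Q.sec V),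
      IsSigma Q V q (gapp (homOver f S) V ((Φ.over S).action.smul 1
        (coord (Φ.over S) (Φ'.over S) (sres _ b z) q)))
        (pullHom (F := TORSC A') (M₁ := Q) (M₂ := Q) m b.left V.hom V.hom (Over.w b) (Over.w b))) :
    IsTwist f Q T z m := by
  intro V b q
  have h1 := Torsor.ev_pullHom m (V₁ := V) (V₂ := V) (𝟙 _) b.left V.hom V.hom (Over.w b) (Over.w b)
    (𝟙 _) (by simp) (by simp) q
  have h2 := hm b q (Over.mk (𝟙 V.left)) 1
  rw [(Φ.over S).action.one_smul] at h2
  have e : 𝟙 V.left ≫ b.left = b.left := id_comp _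
  have h3 : ∀ (c : V.left ⟶ T.left) (hc : c = b.left), Torsor.ev m (V₁ := V) (V₂ := V) (𝟙 V.left)
    b.left (by simp) (by simp) q = Torsor.ev m (V₁ := V) (V₂ := V) (𝟙 V.left) c (by simp [hc])
        (by simp [hc]) q := by
    rintro _ rfl
    rfl
  refine (h3 _ e).trans (h1.symm.trans ?_)
  let l : (Over.map V.hom).obj (Over.mk (𝟙 V.left)) ⟶ V := Over.homMk (𝟙 V.left)
  let k : V ⟶ (Over.map V.hom).obj (Over.mk (𝟙 V.left)) := Over.homMk (𝟙 V.left)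
  refine (congrArg (fun y => Q.res k (Torsor.Hom.app (P := Q.pull V.hom) (Q := Q.pull V.hom) _
    (X := Over.mk (𝟙 V.left)) y)) (Q.act_one (Q.res l q)).symm).trans ?_
  refine (congrArg (Q.res k) (h2.trans ((Q.act_one
      (X := (Over.map V.hom).obj (Over.mk (𝟙 V.left))) _).trans
    (Q.act_res l q _).symm))).trans ?_
  exact (Q.res_comp l k (𝟙 V) (by simp [k, l]) _).trans (Q.res_eq_self _ rfl _)

/-- The case of `IsTwist.app_ext` in which `p = [[q, α]]`: the automorphism maps `[[q, α]]` to
`[[q f(α a), α]] = [[q, ρ(α a) α]] = [[q, α ρ(a)]]`. -/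
theorem IsTwist.app_extMk (hf : IsCrossedHom Φ Φ' f) (hz : IsTwist f Q T z m)
    {n : (ext (homOver Φ'.ρ S) Q).pull T.hom ⟶ (ext (homOver Φ'.ρ S) Q).pull T.hom}
    (hn : ext.baseChange Φ'.ρ T.hom Q ≫ n = ext.map (homOver Φ'.ρ T.left) m ≫
        ext.baseChange Φ'.ρ T.hom Q)
    {U : Over T.left} (q : Q.sec ((Over.map T.hom).obj U))
        (α : Sec (Pi.over S) ((Over.map T.hom).obj U))
    (a : Sec (A.over S) ((Over.map T.hom).obj U))
    (e : sres _ (Over.homMk U.hom : (Over.map T.hom).obj U ⟶ T) z =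
      contr.mk (Q := ext (Φ'.over S).ρ Q) (Φ.over S).action (ext.mk (Φ'.over S).ρ q α) a) :
    n.app (X := U) (ext.mk (homOver Φ'.ρ S) (Q := Q) (U := (Over.map T.hom).obj U) q α) =
      (ext (homOver Φ'.ρ S) Q).act (X := (Over.map T.hom).obj U)
        (ext.mk (homOver Φ'.ρ S) (Q := Q) (U := (Over.map T.hom).obj U) q α)
        (gapp (homOver Φ.ρ S) ((Over.map T.hom).obj U) a) := by
  have h1 := congrArg (fun t : ext (homOver Φ'.ρ T.left) (Q.pull T.hom) ⟶
    (ext (homOver Φ'.ρ S) Q).pull T.hom => t.app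
        (ext.mk (homOver Φ'.ρ T.left) (Q := Q.pull T.hom) (U := U) q α)) hn
  refine (congrArg (fun y => n.app (X := U) y)
      (ext.baseChange_mk Φ'.ρ T.hom Q (U := U) q α).symm).trans
    (h1.trans ?_)
  refine (congrArg (fun y => (ext.baseChange Φ'.ρ T.hom Q).app (X := U) y)
    (ext.map_mk (homOver Φ'.ρ T.left) m (U := U) q α)).trans ?_
  refine (ext.baseChange_mk Φ'.ρ T.hom Q (U := U) _ α).trans ?_
  have h2 : m.app (X := U) q = Q.act (X := (Over.map T.hom).obj U) q
      (gapp (homOver f S) _ ((Φ.over S).action.smul α a)) := by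
    refine (hz.app_eq q).trans ?_
    rw [tw, e, mk_extMk, coord_dmk]
  refine (congrArg (fun y => ext.mk (homOver Φ'.ρ S) (Q := Q) (U := (Over.map T.hom).obj U) y α)
      h2).trans ?_
  refine (ext.mk_act ..).trans (Eq.trans (congrArg (ext.mk _ q) ?_) (ext.act_mk' ..).symm)
  have h3 : gapp (homOver Φ'.ρ S) ((Over.map T.hom).obj U)
      (gapp (homOver f S) _ ((Φ.over S).action.smul α a)) =
      α * gapp (Φ.over S).ρ _ a * α⁻¹ :=
    ((hf.over S).ρ_map _).trans ((Φ.over S).ρ_smul _ _)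
  rw [h3, inv_mul_cancel_right]
  rfl

/-- The automorphism of `Q ∧^{A'} Π` induced by the automorphism attached to `[[p, a]]` maps `p`
to `p ρ(a)`. -/
theorem IsTwist.app_ext (hf : IsCrossedHom Φ Φ' f) (hz : IsTwist f Q T z m)
    {n : (ext (homOver Φ'.ρ S) Q).pull T.hom ⟶ (ext (homOver Φ'.ρ S) Q).pull T.hom}
    (hn : ext.baseChange Φ'.ρ T.hom Q ≫ n = ext.map (homOver Φ'.ρ T.left) m ≫
        ext.baseChange Φ'.ρ T.hom Q)
    {U : Over T.left} (p : (ext (homOver Φ'.ρ S) Q).sec ((Over.map T.hom).obj U))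
    (a : Sec (A.over S) ((Over.map T.hom).obj U))
    (e : sres _ (Over.homMk U.hom : (Over.map T.hom).obj U ⟶ T) z =
      contr.mk (Q := ext (Φ'.over S).ρ Q) (Φ.over S).action p a) :
    n.app (X := U) p = (ext (homOver Φ'.ρ S) Q).act p
        (gapp (homOver Φ.ρ S) ((Over.map T.hom).obj U) a) := by
  obtain ⟨R, hR, hR'⟩ := (Q.pull T.hom).locally_nonempty U
  refine sres_eq_of_cover ((ext (homOver Φ'.ρ S) Q).pull T.hom).carrier R hR _ _ fun V k hk => ?_
  let k' := (Over.map T.hom).map k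
  obtain ⟨α, hα⟩ := ext.exists_mk (homOver Φ'.ρ S) ((ext (homOver Φ'.ρ S) Q).res k' p)
      (hR' k hk).some
  refine (n.app_res k p).symm.trans (Eq.trans ?_ ((ext (homOver Φ'.ρ S) Q).act_res k' p _).symm)
  have e' : sres _ (Over.homMk V.hom : (Over.map T.hom).obj V ⟶ T) z =
      contr.mk (Q := ext (Φ'.over S).ρ Q) (Φ.over S).action
        (ext.mk (Φ'.over S).ρ (hR' k hk).some α) (gres (A.over S) k' a) := by
    refine Eq.trans ?_ ((congrArg (sres _ k') e).trans ((contr.mk_res ..).trans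
      (congrArg (fun y => contr.mk (Q := ext (Φ'.over S).ρ Q) (Φ.over S).action y _) hα)))
    refine Eq.trans ?_ (sres_comp _ _ _ _)
    congr 1
    ext
    simp [k']
  have h1 := hz.app_extMk hf hn (U := V) _ α _ e'
  refine (congrArg (fun y => n.app (X := V) y) hα).trans (h1.trans ?_)
  refine congrArg₂ (ext (homOver Φ'.ρ S) Q).act hα.symm ?_
  exact gapp_res _ _ _

end

end

/-! ### Extension of the structural group along an identity -/

section

variable {D : Type u} [Category.{v} D] {K : GrothendieckTopology D} {G : Sheaf K GrpCat.{w}}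
  [HasSheafify K (Type w)] [K.WEqualsLocallyBijective (Type w)]

namespace ext

/-- The canonical morphism `R ∧^G G ⟶ R`, `[[r, x]] ↦ r x`, if the homomorphism `u` is the identity
on sections. -/
noncomputable def counit (u : G ⟶ G) (hu : ∀ {U : D} (x : Sec G U), gapp u U x = x) (R : Torsor G) :
    ext u R ⟶ R :=
  let m : contr R (translation u) ⟶ R.carrier := contr.desc (translation u) R.carrier
    (fun r x => R.act r x)
    (fun r g x => by
      rw [← R.act_mul]
      exact congrArg (fun y => R.act r (y * x)) (hu g).symm)
    (fun f r x => R.act_res f r x)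
  { app := fun {U} y => sapp m U y
    app_res := fun f y => sapp_res m f y
    app_act := fun {U} y g => by
      obtain ⟨S, hS, hS'⟩ := R.locally_nonempty U
      refine sres_eq_of_cover _ S hS _ _ fun V f hf => ?_
      have h1 : ∀ (r : R.sec V) (x : Sec G V), sapp m V (mk u r x) = R.act r x :=
        fun r x => contr.desc_mk ..
      obtain ⟨x, hx⟩ := exists_mk u ((ext u R).res f y) (hS' f hf).some
      refine (sapp_res m f _).symm.trans (Eq.trans ?_ (R.act_res f _ g).symm)
      refine (congrArg (sapp m V) (((ext u R).act_res f y g).trans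
        ((congrArg (fun y => (ext u R).act y _) hx).trans (act_mk' ..)))).trans ?_
      refine (h1 _ _).trans ((R.act_mul _ _ _).trans (congrArg (fun y => R.act y (gres G f g)) ?_))
      exact (h1 _ _).symm.trans ((congrArg (sapp m V) hx.symm).trans (sapp_res m f y)) }

variable (u : G ⟶ G) (hu : ∀ {U : D} (x : Sec G U), gapp u U x = x)

theorem counit_mk {R : Torsor G} {U : D} (r : R.sec U) (x : Sec G U) :
    (counit u hu R).app (mk u r x) = R.act r x :=
  contr.desc_mk ..

theorem counit_naturality {R R' : Torsor G} (m : R ⟶ R') :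
    map u m ≫ counit u hu R' = counit u hu R ≫ m :=
  hom_ext _ fun {U} q => by
    rw [Torsor.comp_app, Torsor.comp_app, map_mk, counit_mk, counit_mk, m.app_act]

end ext

end

section

variable {C : Type u} [Category.{v} C] {J : GrothendieckTopology C}
  {A A' A'' Pi : Sheaf J GrpCat.{w}}

theorem gapp_homOver_id {S : C} {U : Over S} (x : Sec (Pi.over S) U) :
    gapp (homOver (𝟙 Pi) S) U x = x := rfl

variable [IsUSite.{w} J]

theorem ext.counit_baseChange {S T : C} (g : T ⟶ S) (R : Torsor (Pi.over S)) :
    ext.baseChange (𝟙 Pi) g R ≫ Torsor.pullMap g (ext.counit (homOver (𝟙 Pi) S) gapp_homOver_id R) =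
      ext.counit (homOver (𝟙 Pi) T) gapp_homOver_id (R.pull g) :=
  ext.hom_ext _ fun {U} q => by
    rw [Torsor.comp_app, ext.baseChange_mk, ext.counit_mk]
    exact ext.counit_mk (homOver (𝟙 Pi) S) gapp_homOver_id (U := (Over.map g).obj U) q 1

open scoped Pseudofunctor.StrongTrans

/-- The extension of the structural group along an identity is isomorphic to the identity. -/
noncomputable def extTransId (Pi : Sheaf J GrpCat.{w}) : extTrans (𝟙 Pi) ≅ 𝟙 (TORSC Pi) :=
  Pseudofunctor.StrongTrans.isoMk
    (fun S => Cat.Hom.isoMk (NatIso.ofComponents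
      (fun R => Torsor.isoOfHom (ext.counit (homOver (𝟙 Pi) S.as.unop) gapp_homOver_id R))
      (fun m => ext.counit_naturality _ gapp_homOver_id m)))
    (fun {S T} g => by
      ext R : 3
      exact (ext.counit_baseChange g.as.unop R).symm)

end

/-! ### Crossed gerbes of torsors and of liftings -/

open scoped Pseudofunctor.StrongTrans

section

variable {C : Type u} [Category.{v} C] {J : GrothendieckTopology C}
  {A A' A'' Pi : Sheaf J GrpCat.{w}} {Φ : CrossedGroup A Pi} {Φ' : CrossedGroup A' Pi} {f : A ⟶ A'}
  {h : A' ⟶ A''} {P : Torsor A''}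

open contr

theorem IsSigma.congr {S : C} {Q : Torsor (A.over S)} {T : Over S} {q : Q.sec T}
    {b : Sec (A.over S) T}
    {σ σ' : Q.pull T.hom ⟶ Q.pull T.hom} (hσ : IsSigma Q T q b σ) (e : σ = σ') :
        IsSigma Q T q b σ' :=
  e ▸ hσ

theorem CrossedGroup.IsHom.isCrossedHom (hf : Φ.IsHom Φ' f (𝟙 Pi)) : IsCrossedHom Φ Φ' f where
  ρ_map a := ConcreteCategory.congr_hom
    (congrArg (fun t : A ⟶ Pi => t.hom.app (op _)) (hf.comm.trans (comp_id _))) a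
  map_smul {_} α a := hf.map_smul α a

theorem torsNat_torsAut {F : FiberedCat.{w} C} (μ : F ⟶ TORSC Pi) {S T : C} (g : T ⟶ S)
    (x : Fib F S)
    (σ : Aut ((invIm F g).obj x)) :
    torsNat μ g x ≫ torsAut μ g x σ = torsMap μ σ.hom ≫ torsNat μ g x := by
  rw [torsAut, autMap, Iso.conjAut_hom, Iso.conj_apply]
  exact (fibNat μ g x).hom_inv_id_assoc _

variable [IsUSite.{w} J]

theorem isCrossedGerbe_autIsoTORS (Φ : CrossedGroup A Pi) :
    IsCrossedGerbe Φ (TORSC A) (muTORS Φ) (autIsoTORS Φ) where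
  isGerbe := TORSC_isGerbe A
  torsAut_app {S} Q T z _ p a e :=
    (isTwist_equivTORS_symm (S := S) Q T z).app_ext (.id Φ)
        (torsNat_torsAut (muTORS Φ) T.hom Q _) p a e

theorem isCanonicalTORS_autIsoTORS (Φ : CrossedGroup A Pi) : IsCanonicalTORS Φ (autIsoTORS Φ) :=
  fun {S} Q T q α a => (isTwist_equivTORS_symm (S := S) Q T _).isSigma q α a rfl

/-- Two isomorphisms which satisfy the formula of `IsCanonicalTORS` coincide, since this formula
determines the automorphism attached to any section. -/
theorem IsCanonicalTORS.eq {j : AutIso Φ (TORSC A) (muTORS Φ)} (hj : IsCanonicalTORS Φ j) :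
    j = autIsoTORS Φ := by
  refine AutIso.ext ?_
  funext S Q T
  refine MulEquiv.ext fun σ => ?_
  refine (equivTORS_eq (S := S) (Q := Q) ?_).symm
  refine isTwist_of_isSigma fun {V} b q => ?_
  have h1 := hj Q V q 1 (coord (Φ.over S) (Φ.over S) (sres _ b (j.equiv Q T σ)) q)
  have h2 : contr.mk (Q := ext (homOver Φ.ρ S) Q) (Φ.over S).action (ext.mk (homOver Φ.ρ S) q 1)
      (coord (Φ.over S) (Φ.over S) (sres _ b (j.equiv Q T σ)) q) =
      j.equiv Q V (autRes (TORSC A) T.hom b.left V.hom (Over.w b) Q σ) :=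
    (dmk_coord (Φ := Φ.over S) (Φ' := Φ.over S) (Q := Q) _ q).trans (j.equiv_res Q b σ).symm
  rw [h2, MulEquiv.symm_apply_apply] at h1
  exact h1.congr (TORSC_autRes_hom (S := S) Q b σ)

section

variable (hf : IsCrossedHom Φ Φ' f) (hi : ∀ U : C, Function.Injective (gapp f U))
    (he : ∀ {U : C} (a : Sec A' U), gapp h U a = 1 ↔ ∃ b : Sec A U, gapp f U b = a)

theorem isCrossedGerbe_autIsoLift (hs : ∀ {U : C} (c : Sec A'' U), ∃ R ∈ J U, ∀ ⦃V : C⦄ (g : V ⟶ U),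
    R g →
    ∃ a : Sec A' V, gapp h V a = gres A'' g c) :
    IsCrossedGerbe Φ (liftings h P) (muLift Φ' h P) (autIsoLift hf hi he) where
  isGerbe := liftings_isGerbe h P hs
  torsAut_app {S} L T z _ p a e := by
    have h1 := torsNat_torsAut (muLift Φ' h P) T.hom L ((equivLift hf hi he (S := S) L T).symm z)
    rw [torsNat_muLift (S := S) Φ' T.hom L] at h1
    exact (isTwist_equivLift_symm hf hi he (S := S) L T z).app_ext hf h1 p a e

theorem isCanonicalLift_autIsoLift :
    IsCanonicalLift Φ Φ' f h P (autIsoLift hf hi he) :=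
  fun {S} L T q α a => (isTwist_equivLift_symm hf hi he (S := S) L T _).isSigma q α a rfl

variable {hf hi he}

/-- The analogue of `IsCanonicalTORS.eq` for liftings. -/
theorem IsCanonicalLift.eq {j : AutIso Φ (liftings h P) (muLift Φ' h P)}
    (hj : IsCanonicalLift Φ Φ' f h P j) : j = autIsoLift hf hi he := by
  refine AutIso.ext ?_
  funext S L T
  refine MulEquiv.ext fun σ => ?_
  refine (equivLift_eq (hf := hf) (hi := hi) (he := he) (S := S) (L := L) ?_).symm
  refine isTwist_of_isSigma fun {V} b q => ?_
  have h1 := hj L V q 1 (coord (Φ.over S) (Φ'.over S) (sres _ b (j.equiv L T σ)) q)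
  have h2 : contr.mk (Q := ext (homOver Φ'.ρ S) (Lifting.torsor L)) (Φ.over S).action
      (ext.mk (homOver Φ'.ρ S) q 1)
      (coord (Φ.over S) (Φ'.over S) (sres _ b (j.equiv L T σ)) q) =
      j.equiv L V (autRes (liftings h P) T.hom b.left V.hom (Over.w b) L σ) :=
    (dmk_coord (Φ := Φ.over S) (Φ' := Φ'.over S) (Q := Lifting.torsor L) _ q).trans
        (j.equiv_res L b σ).symm
  rw [h2, MulEquiv.symm_apply_apply] at h1
  exact h1.congr (liftings_autRes_hom (S := S) L b σ)

end

/-- The isomorphism between `TORSC(1_Π) ∘ μ_P` and `μ_TORS ∘ k(P)`. -/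
noncomputable def muLiftIso (Φ' : CrossedGroup A' Pi) (h : A' ⟶ A'') (P : Torsor A'') :
    muLift Φ' h P ≫ extTrans (𝟙 Pi) ≅ forgetTrans h P ≫ muTORS Φ' :=
  whiskerLeftIso (muLift Φ' h P) (extTransId Pi) ≪≫ ρ_ (muLift Φ' h P)

/-- Through `muLiftIso`, the morphism `ω` maps `[[q, 1], a]` to `[[q, 1], f(a)]`. -/
theorem omega_dmk (hf : Φ.IsHom Φ' f (𝟙 Pi)) {S : C} (L : Lifting.Fiber h P S) {T : Over S}
    (q : L.torsor.sec T) (a : Sec (A.over S) T) :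
    sapp (omega hf (muLiftIso Φ' h P) L) T (dmk (Φ.over S) (Φ'.over S) q a) =
      dmk (Φ'.over S) (Φ'.over S) q (gapp (homOver f S) T a) := by
  refine (congrArg (sapp (contrMap (Φ'.over S).action _) T) (contr.desc_mk ..)).trans ?_
  refine (contrMap_mk ..).trans ?_
  refine congrArg (fun y => contr.mk (Q := ext (homOver Φ'.ρ S) L.torsor) (Φ'.over S).action y _) ?_
  refine (ext.counit_mk (homOver (𝟙 Pi) S) gapp_homOver_id
      (R := ext (homOver Φ'.ρ S) L.torsor) _ 1).trans ?_
  exact (ext (homOver Φ'.ρ S) L.torsor).act_one _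

theorem coord_omega (hf : Φ.IsHom Φ' f (𝟙 Pi)) {S : C} (L : Lifting.Fiber h P S) {T : Over S}
    (z : CSec (ext (Φ'.over S).ρ L.torsor) (Φ.over S).action T) {V : Over S} (b : V ⟶ T)
    (q : L.torsor.sec V) :
    coord (Φ'.over S) (Φ'.over S) (Q := L.torsor)
        (sres _ b (sapp (omega hf (muLiftIso Φ' h P) L) T z)) q =
      gapp (homOver f S) V (coord (Φ.over S) (Φ'.over S) (sres _ b z) q) := by
  refine Eq.trans (congrArg (fun y => coord (Φ'.over S) (Φ'.over S) (Q := L.torsor) y q) ?_)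
    (coord_dmk (Φ := Φ'.over S) (Φ' := Φ'.over S) q _)
  refine (sapp_res _ b z).symm.trans (Eq.trans ?_ (omega_dmk hf L q _))
  exact congrArg _ (dmk_coord (sres _ b z) q).symm

/-- The automorphism of `Q` which underlies the automorphism of `(Q, λ)` attached to `z` is the one
attached to `ω(z)`: both are locally `q ↦ q f(a)`. -/
theorem isCrossedMorphism_forgetTrans (hf : Φ.IsHom Φ' f (𝟙 Pi))
    (hi : ∀ U : C, Function.Injective (gapp f U))
    (he : ∀ {U : C} (a : Sec A' U), gapp h U a = 1 ↔ ∃ b : Sec A U, gapp f U b = a) :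
    IsCrossedMorphism hf (autIsoLift hf.isCrossedHom hi he) (autIsoTORS Φ') (forgetTrans h P) := by
  refine ⟨muLiftIso Φ' h P, fun {S} L T σ => ?_⟩
  refine equivTORS_eq (S := S) (Q := Lifting.torsor L) ?_
  intro V b q
  refine (isTwist_equivLift hf.isCrossedHom hi he (S := S) L T σ b q).trans ?_
  exact congrArg (Torsor.act _ q) (coord_omega (S := S) hf L _ b q).symm

end

end CrossedGerbe

theorem mainTheorem9 {C : Type u} [Category.{v} C] (J : GrothendieckTopology C) [IsUSite.{w} J]
    {A A' A'' Pi Pi'' : Sheaf J GrpCat.{w}} (Φ : CrossedGroup A Pi) (Φ' : CrossedGroup A' Pi)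
    (Φ'' : CrossedGroup A'' Pi'') (f : A ⟶ A') (h : A' ⟶ A'') (ψ : Pi ⟶ Pi'')
    (hex : IsShortExact Φ Φ' Φ'' f (𝟙 Pi) h ψ) (P : CrossedGerbe.Torsor A'') :
    ∃ (jP : AutIso Φ (liftings h P) (muLift Φ' h P)) (jT : AutIso Φ' (TORSC A') (muTORS Φ')),
      (IsCrossedGerbe Φ (liftings h P) (muLift Φ' h P) jP ∧ IsCanonicalLift Φ Φ' f h P jP ∧
        ∀ j, IsCanonicalLift Φ Φ' f h P j → j = jP) ∧
      (IsCrossedGerbe Φ' (TORSC A') (muTORS Φ') jT ∧ IsCanonicalTORS Φ' jT ∧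
        ∀ j, IsCanonicalTORS Φ' j → j = jT) ∧
      IsCrossedMorphism hex.isHom_left jP jT (forgetTrans h P) := by
  have hf := hex.isHom_left.isCrossedHom
  exact ⟨autIsoLift hf hex.injective hex.exact_middle, autIsoTORS Φ',
    ⟨isCrossedGerbe_autIsoLift hf _ _ hex.locally_surjective, isCanonicalLift_autIsoLift hf _ _,
      fun j hj => hj.eq⟩,
    ⟨isCrossedGerbe_autIsoTORS Φ', isCanonicalTORS_autIsoTORS Φ', fun j hj => hj.eq⟩,
    isCrossedMorphism_forgetTrans hex.isHom_left hex.injective hex.exact_middle⟩
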